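/- Let $A=\sqrt{-\Delta}$ on $\mathbb R^3$, let $\|\cdot\|$ be the norm of $(L^2(\mathbb R^3))^3$, $\langle x\rangle=\sqrt{1+x^2}$, and for $r<3/2$ let $\dot H^r$ be the space of tempered (vector-valued) distributions $f$ such that $\hat f$ is a function and $\|A^rf\|<\infty$. Fix a real $3\times3$ matrix $M$ and an orthogonal projection $P$ on $(L^2)^3$ of the form $\widehat{Pf}(\xi)=P(\xi)\hat f(\xi)$ with measurable $P(\xi)$ (for Navier–Stokes, $M=I$ and $P$ is the Leray projection). For $u_0\in\dot H^{1/2}$ consider the integral equation $X=Y+B(X,X)$, where $Y(t)=e^{-tA^2}u_0$ and $$B(u,v)(t)=-\int_0^te^{-(t-s)A^2}P\,(Mu(s)\cdot\nabla)v(s)\,ds .$$ For an interval $I=(0,T]$ or $I=(0,\infty)$ and continuous $\zeta:I\to\mathbb R$, $\theta:I\to[0,\infty)$, let $\mathcal B_{\zeta,\theta,I}$ be the space of $v:I\to\dot H^{5/4}$ for which $e^{-\zeta(t)}t^{3/8}e^{\theta(t)A}A^{5/4}v(t)$ is bounded and continuous from $I$ to $(L^2)^3$, with the norm $\|v\|_{\zeta,\theta,I}=\sup_{t\in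 I}e^{-\zeta(t)}t^{3/8}\|e^{\theta(t)A}A^{5/4}v(t)\|$. For $\lambda_0\ge0$, $T>0$ put $\lambda(t)=\lambda_0\sqrt{t/T}$, $\zeta(t)=\lambda(t)^2/4+\tfrac34\ln\langle\lambda(t)\rangle$, $\theta(t)=\lambda(t)\sqrt t$. (0) There are constants $C_1,C_3>0$ such that for all $\lambda_0\ge0$ and $T>0$, with $I=(0,T]$: $Y\in\mathcal B_{\zeta,\theta,I}$ and $\|Y\|_{\zeta,\theta,I}\le C_1\|A^{1/2}u_0\|$ for all $u_0\in\dot H^{1/2}$; and $B$ maps $\mathcal B_{\zeta,\theta,I}\times\mathcal B_{\zeta,\theta,I}$ to $\mathcal B_{\zeta,\theta,I}$ with $\|B(u,v)\|_{\zeta,\theta,I}\le C_3\langle\lambda_0\rangle^2e^{\lambda_0^2/4}\|u\|_{\zeta,\theta,I}\|v\|_{\zeta,\theta,I}$. There are also constants $C,\tilde C>0$, depending only on $M$ and $P$, such that for every such pair $C_1,C_3$ and every $u_0\in\dot H^{1/2}$ with $4C_1C_3\|A^{1/2}u_0\|<1$ the following holds. (i) There is exactly one global mild solution $X$ on $[0,\infty)$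 of $X=Y+B(X,X)$ with the property that, in $\mathcal B_{0,0,(0,\infty)}$, for some $R\ge0$ and some $\gamma\ge 0$ with $\|B(u,v)\|\le\gamma\|u\|\|v\|$ for all $u,v$, one has $\|Y\|\le R$, $4\gamma R<1$ and $\|X\|\le2R$. If $u_0\ne0$, the equation $$4C_1C_3\|A^{1/2}u_0\|\langle\bar\lambda\rangle^2e^{\bar\lambda^2/4}=1$$ has exactly one solution $\bar\lambda>0$; if $u_0=0$ put $\bar\lambda=\infty$. For all $\lambda_0\in[0,\bar\lambda)$ and $t>0$, $$\|A^{5/4}e^{\lambda_0\sqrt tA}X(t)\|\le2C_1\|A^{1/2}u_0\|\langle\lambda_0\rangle^{3/4}e^{\lambda_0^2/4}t^{-3/8},$$ $$\|A^{1/2}e^{\lambda_0\sqrt tA}X(t)\|\le C\Big(e^{\lambda_0^2/4}\|A^{1/2}u_0\|+\langle\lambda_0\rangle^2e^{\lambda_0^2/2}\big(2C_1\|A^{1/2}u_0\|\big)^2\Big).$$ (ii) If in addition $u_0\in L^2$, then for all $\lambda_0\in[0,\bar\lambda)$ and $t>0$ $$\|e^{\lambda_0\sqrt tA}X(t)\|\le\tilde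 C\Big(e^{\lambda_0^2/4}\|u_0\|+\langle\lambda_0\rangle^{3/2}e^{\lambda_0^2/2}\big(2C_1\|A^{1/2}u_0\|\big)^2t^{1/4}\Big).$$ (iii) Consequently $\mathrm{rad}(X(t))\ge\bar\lambda\sqrt t$ for all $t>0$, in the $\dot H^{1/2}$ sense and, if $u_0\in L^2$, in the $H^r$ sense for every $r\in\mathbb R$. Here, for $H=H^r$ or $H=\dot H^{1/2}$, the analyticity radius of a scalar $f$ is the supremum of the $a>0$ such that $\eta\mapsto f(\cdot+\eta)\in H$, $\eta\in\mathbb R^3$, extends to a bounded analytic $H$-valued function on $\{\eta\in\mathbb C^3:|\operatorname{Im}\eta|<a\}$ (and $0$ if there is none), and the radius of a vector field is the minimum over its components. -/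

import Mathlib

open MeasureTheory Set
open scoped FourierTransform SchwartzMap LineDeriv ENNReal

noncomputable section

namespace MildNS

/-- Physical space (and frequency space) `ℝ³`. -/
abbrev R3 := EuclideanSpace ℝ (Fin 3)

/-- The value space `ℂ³` of (complex) vector fields; real fields are the `ℝ³`-valued ones. -/
abbrev C3 := EuclideanSpace ℂ (Fin 3)

section General

variable {F : Type*} [NormedAddCommGroup F] [InnerProductSpace ℂ F] [CompleteSpace F]

/-- The tempered distribution `f` is the function `g`. -/
def IsRepresentedBy (f : 𝓢'(R3, F)) (g : R3 → F) : Prop :=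
  ∀ φ : 𝓢(R3, ℂ), Integrable (fun x => φ x • g x) ∧ f φ = ∫ x, φ x • g x

open Classical in
/-- The (almost everywhere unique) function that represents `f`, and `0` if there is none. -/
def funRep (f : 𝓢'(R3, F)) : R3 → F :=
  if h : ∃ g, IsRepresentedBy f g then h.choose else 0

open Classical in
/-- The class in `L²` of a square integrable function (`0` for other functions). -/
def toL2 (g : R3 → F) : Lp F 2 (volume : Measure R3) :=
  if h : MemLp g 2 (volume : Measure R3) then h.toLp g else 0

/-- `w(D) f ∈ L²`: the Fourier transform of `f` is a function and its product with the weight `w`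
is square integrable. -/
def InDomain (w : R3 → ℝ) (f : 𝓢'(R3, F)) : Prop :=
  (∃ g, IsRepresentedBy (𝓕 f) g) ∧
    MemLp (fun ξ => (w ξ : ℂ) • funRep (𝓕 f) ξ) 2 (volume : Measure R3)

/-- The element `w(D) f` of `L²`, when `InDomain w f`. -/
def applyMul (w : R3 → ℝ) (f : 𝓢'(R3, F)) : Lp F 2 (volume : Measure R3) :=
  𝓕⁻ (toL2 fun ξ => (w ξ : ℂ) • funRep (𝓕 f) ξ)

/-- The symbol of `A = √(-Δ)`; Mathlib's Fourier transform has the kernel `e^{-2πi x·ξ}`. -/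
def symA (ξ : R3) : ℝ := 2 * Real.pi * ‖ξ‖

/-- The symbol of `e^{aA} A^s`. -/
def expPow (a s : ℝ) (ξ : R3) : ℝ := Real.exp (a * symA ξ) * symA ξ ^ s

/-- The symbol of `⟨A⟩^r`. -/
def japPow (r : ℝ) (ξ : R3) : ℝ := (1 + symA ξ ^ 2) ^ (r / 2)

/-- `f ∈ Ḣ^r`. -/
def MemHom (r : ℝ) (f : 𝓢'(R3, F)) : Prop := InDomain (expPow 0 r) f

/-- `‖e^{aA} A^s f‖` in `L²`. -/
def expNorm (a s : ℝ) (f : 𝓢'(R3, F)) : ℝ := ‖applyMul (expPow a s) f‖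

/-- The heat semigroup `e^{-tA²}` on tempered distributions, `t ≥ 0`. -/
def heat (t : ℝ) (f : 𝓢'(R3, F)) : 𝓢'(R3, F) :=
  TemperedDistribution.fourierMultiplierCLM F
    (fun ξ : R3 => ((Real.exp (-(t * symA ξ ^ 2)) : ℝ) : ℂ)) f

/-- The translate `f(· + η)`. -/
def translate (η : R3) (f : 𝓢'(R3, F)) : 𝓢'(R3, F) :=
  PointwiseConvergenceCLM.precomp F (SchwartzMap.compSubConstCLM ℂ η) f

/-- The point of `ℂ³` with the real coordinates of `η`. -/
def toComplex (η : R3) : C3 := WithLp.toLp 2 fun j => ((η j : ℝ) : ℂ)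

/-- The imaginary part of a point of `ℂ³`. -/
def imPart (z : C3) : R3 := WithLp.toLp 2 fun j => (z j).im

/-- For the Hilbert space `H = {f : w(D) f ∈ L²}` with the norm `‖w(D) f‖`: the translation orbit
`η ↦ f(· + η) ∈ H` extends to a bounded analytic function from the tube `{|Im z| < a}` to `H`.
The values in `H` are recorded through their images in `L²` under the isometry `w(D)`. -/
def UniformlyAnalytic (w : R3 → ℝ) (a : ℝ) (f : 𝓢'(R3, F)) : Prop :=
  ∃ G : C3 → Lp F 2 (volume : Measure R3),
    DifferentiableOn ℂ G {z | ‖imPart z‖ < a} ∧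
    (∃ K : ℝ, ∀ z, ‖imPart z‖ < a → ‖G z‖ ≤ K) ∧
    ∀ η : R3, InDomain w (translate η f) ∧ applyMul w (translate η f) = G (toComplex η)

/-- The analyticity radius of a scalar `f` with respect to `{f : w(D) f ∈ L²}`;
it is `0` if `f` is not uniformly analytic. -/
def scalarRad (w : R3 → ℝ) (f : 𝓢'(R3, ℂ)) : ℝ≥0∞ :=
  sSup {a | ∃ b : ℝ, 0 < b ∧ a = ENNReal.ofReal b ∧ UniformlyAnalytic w b f}

/-- The `j`-th component of a vector-valued distribution. -/
def component (j : Fin 3) (f : 𝓢'(R3, C3)) : 𝓢'(R3, ℂ) :=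
  PointwiseConvergenceCLM.postcomp _ (EuclideanSpace.proj j : C3 →L[ℂ] ℂ) f

/-- The analyticity radius of a vector field: the minimum over its components. -/
def rad (w : R3 → ℝ) (f : 𝓢'(R3, C3)) : ℝ≥0∞ := ⨅ j : Fin 3, scalarRad w (component j f)

end General

/-- An orthogonal projection on `(L²)³` fibered in Fourier space: `(Pf)^(ξ) = P(ξ) f^(ξ)`. -/
structure FiberedProjection where
  /-- The matrices `P(ξ)`. -/
  symbol : R3 → Matrix (Fin 3) (Fin 3) ℂ
  measurable_symbol : ∀ i j, Measurable fun ξ => symbol ξ i j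
  isHermitian_symbol : ∀ᵐ ξ, (symbol ξ).IsHermitian
  idempotent_symbol : ∀ᵐ ξ, symbol ξ * symbol ξ = symbol ξ

/-- `e^{-τA²} P f` for `f ∈ (L²)³`. -/
def heatProj (P : FiberedProjection) (τ : ℝ) (f : Lp C3 2 (volume : Measure R3)) :
    Lp C3 2 (volume : Measure R3) :=
  𝓕⁻ (toL2 fun ξ => ((Real.exp (-(τ * symA ξ ^ 2)) : ℝ) : ℂ) •
    (WithLp.toLp 2 ((P.symbol ξ).mulVec ((𝓕 f : Lp C3 2 (volume : Measure R3)) ξ).ofLp) : C3))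

/-- The function `(Mu · ∇) v = ∑ⱼ (Mu)ⱼ ∂ⱼ v`. -/
def convection (M : Matrix (Fin 3) (Fin 3) ℝ) (u v : 𝓢'(R3, C3)) : R3 → C3 := fun x =>
  ∑ j : Fin 3, (∑ k : Fin 3, ((M j k : ℝ) : ℂ) * funRep u x k) •
    funRep (∂_{(EuclideanSpace.single j (1 : ℝ) : R3)} v) x

/-- The integrand `e^{-(t-s)A²} P (Mu(s) · ∇) v(s)`. -/
def duhamelIntegrand (M : Matrix (Fin 3) (Fin 3) ℝ) (P : FiberedProjection)
    (u v : ℝ → 𝓢'(R3, C3)) (t s : ℝ) : Lp C3 2 (volume : Measure R3) :=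
  heatProj P (t - s) (toL2 (convection M (u s) (v s)))

/-- The integral defining `B(u,v)(t)` exists. -/
def DuhamelExists (M : Matrix (Fin 3) (Fin 3) ℝ) (P : FiberedProjection)
    (u v : ℝ → 𝓢'(R3, C3)) (t : ℝ) : Prop :=
  (∀ s ∈ Ioc 0 t, MemLp (convection M (u s) (v s)) 2 (volume : Measure R3)) ∧
    IntervalIntegrable (duhamelIntegrand M P u v t) volume 0 t

/-- `B(u,v)(t) = -∫₀ᵗ e^{-(t-s)A²} P (Mu(s) · ∇) v(s) ds`, an integral in `(L²)³`. -/
def bilin (M : Matrix (Fin 3) (Fin 3) ℝ) (P : FiberedProjection)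
    (u v : ℝ → 𝓢'(R3, C3)) (t : ℝ) : 𝓢'(R3, C3) :=
  Lp.toTemperedDistribution (-∫ s in (0 : ℝ)..t, duhamelIntegrand M P u v t s)

/-- Membership in the space `𝓑_{ζ,θ,I,3/8,5/4}`: `v(t) ∈ Ḣ^{5/4}` for `t ∈ I`, and
`e^{-ζ(t)} t^{3/8} e^{θ(t)A} A^{5/4} v(t)` is bounded and continuous from `I` to `(L²)³`. -/
structure MemB (ζ θ : ℝ → ℝ) (I : Set ℝ) (v : ℝ → 𝓢'(R3, C3)) : Prop where
  memHom : ∀ t ∈ I, MemHom (5 / 4) (v t)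
  inDomain : ∀ t ∈ I, InDomain (expPow (θ t) (5 / 4)) (v t)
  continuousOn : ContinuousOn (fun t =>
    (Real.exp (-ζ t) * t ^ (3 / 8 : ℝ)) • applyMul (expPow (θ t) (5 / 4)) (v t)) I
  bounded : BddAbove ((fun t =>
    Real.exp (-ζ t) * t ^ (3 / 8 : ℝ) * expNorm (θ t) (5 / 4) (v t)) '' I)

/-- The norm of `𝓑_{ζ,θ,I,3/8,5/4}`. -/
def normB (ζ θ : ℝ → ℝ) (I : Set ℝ) (v : ℝ → 𝓢'(R3, C3)) : ℝ :=
  sSup ((fun t => Real.exp (-ζ t) * t ^ (3 / 8 : ℝ) * expNorm (θ t) (5 / 4) (v t)) '' I)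

/-- `B` maps `𝓑 × 𝓑` to `𝓑` with bounding constant `γ`. -/
def IsBilinearBound (M : Matrix (Fin 3) (Fin 3) ℝ) (P : FiberedProjection)
    (ζ θ : ℝ → ℝ) (I : Set ℝ) (γ : ℝ) : Prop :=
  ∀ u v, MemB ζ θ I u → MemB ζ θ I v →
    (∀ t ∈ I, DuhamelExists M P u v t) ∧ MemB ζ θ I (bilin M P u v) ∧
    normB ζ θ I (bilin M P u v) ≤ γ * normB ζ θ I u * normB ζ θ I v

/-- `⟨x⟩ = √(1 + x²)`. -/
def jap (x : ℝ) : ℝ := √(1 + x ^ 2)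

/-- The time-dependent parameter `λ(t) = λ₀ √(t/T)`. -/
def lam (lam0 T t : ℝ) : ℝ := lam0 * √(t / T)

/-- `ζ = λ²/4 + (3/4) ln ⟨λ⟩` with `λ = λ₀ √(t/T)`. -/
def zeta (lam0 T t : ℝ) : ℝ := lam lam0 T t ^ 2 / 4 + 3 / 4 * Real.log (jap (lam lam0 T t))

/-- `θ = λ √t` with `λ = λ₀ √(t/T)`. -/
def theta (lam0 T t : ℝ) : ℝ := lam lam0 T t * √t

/-- `C₁` is a constant in `‖e^{-(·)A²} u₀‖_𝓑 ≤ C₁ ‖A^{1/2} u₀‖`, independent of `λ₀`, `T`, `u₀`. -/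
def IsLinearConstant (C₁ : ℝ) : Prop :=
  0 < C₁ ∧ ∀ lam0 T : ℝ, 0 ≤ lam0 → 0 < T → ∀ u₀ : 𝓢'(R3, C3), MemHom (1 / 2) u₀ →
    MemB (zeta lam0 T) (theta lam0 T) (Ioc 0 T) (fun t => heat t u₀) ∧
    normB (zeta lam0 T) (theta lam0 T) (Ioc 0 T) (fun t => heat t u₀) ≤
      C₁ * expNorm 0 (1 / 2) u₀

/-- `C₃` is a constant in `‖B(u,v)‖_𝓑 ≤ C₃ ⟨λ₀⟩² e^{λ₀²/4} ‖u‖_𝓑 ‖v‖_𝓑`, independent of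
`λ₀` and `T`. -/
def IsBilinearConstant (M : Matrix (Fin 3) (Fin 3) ℝ) (P : FiberedProjection) (C₃ : ℝ) : Prop :=
  0 < C₃ ∧ ∀ lam0 T : ℝ, 0 ≤ lam0 → 0 < T →
    IsBilinearBound M P (zeta lam0 T) (theta lam0 T) (Ioc 0 T)
      (C₃ * jap lam0 ^ 2 * Real.exp (lam0 ^ 2 / 4))

/-- `X` is the global small-data mild solution: `X = Y + B(X,X)` with `Y(t) = e^{-tA²} u₀`, and `X`
lies in the ball of radius `2R` of `𝓑 = 𝓑_{0,0,]0,∞[,3/8,5/4}` for some `R` satisfying the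
contraction condition `‖Y‖_𝓑 ≤ R`, `4γR < 1`, where `γ` is a bounding constant of `B` on `𝓑`. -/
def IsGlobalMildSolution (M : Matrix (Fin 3) (Fin 3) ℝ) (P : FiberedProjection)
    (u₀ : 𝓢'(R3, C3)) (X : ℝ → 𝓢'(R3, C3)) : Prop :=
  (∀ t, 0 ≤ t → DuhamelExists M P X X t ∧ X t = heat t u₀ + bilin M P X X t) ∧
  MemB 0 0 (Ioi 0) X ∧ MemB 0 0 (Ioi 0) (fun t => heat t u₀) ∧
  ∃ γ R : ℝ, 0 ≤ γ ∧ 0 ≤ R ∧ IsBilinearBound M P 0 0 (Ioi 0) γ ∧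
    normB 0 0 (Ioi 0) (fun t => heat t u₀) ≤ R ∧ 4 * γ * R < 1 ∧
    normB 0 0 (Ioi 0) X ≤ 2 * R

/-- `L = λ̄`: the positive solution of `4 C₁ C₃ ‖A^{1/2} u₀‖ ⟨λ̄⟩² e^{λ̄²/4} = 1` if `u₀ ≠ 0`, and
`∞` if `u₀ = 0`. -/
def IsCriticalLambda (C₁ C₃ : ℝ) (u₀ : 𝓢'(R3, C3)) (L : ℝ≥0∞) : Prop :=
  (u₀ = 0 ∧ L = ⊤) ∨
  (u₀ ≠ 0 ∧ ∃ l : ℝ, 0 < l ∧ L = ENNReal.ofReal l ∧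
    4 * C₁ * C₃ * expNorm 0 (1 / 2) u₀ * jap l ^ 2 * Real.exp (l ^ 2 / 4) = 1)

end MildNS

end

open MildNS

noncomputable section

namespace MildNS

set_option linter.unusedSectionVars false
set_option linter.style.haveILetI false

open Filter Topology
open scoped ContDiff

variable {F : Type*} [NormedAddCommGroup F] [InnerProductSpace ℂ F] [CompleteSpace F]

/-! ### Functions representing tempered distributions -/

/-! All estimates are made in Fourier space, where `e^{aA} A^s` is multiplication by a positive
weight. Since `λ(t) = λ₀ √(t/T)`, the exponent `θ(t) = κ t` with `κ = λ₀ / √T` is linear in `t`, so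
`e^{κtA}` factors as `e^{κ(t-s)A} e^{κsA}`. In the Duhamel integral the first factor is absorbed by
the heat semigroup and the second is carried by the nonlinear term. Completing the square in `κτ|ξ|
- τ|ξ|²` bounds `A^σ e^{κτA - τA²}` by `2 τ^{-σ/2} ⟨κ√τ⟩^σ e^{κ²τ/4}` (`rpow_mul_exp_le`,
`symbol_le`). With `s = 0` and `σ = 3/4` this is the linear estimate, and it dictates the form of
`ζ`.

The nonlinear input is `‖e^{aA} (Mu·∇)v‖ ≤ C ‖e^{aA}A^{5/4}u‖ ‖e^{aA}A^{5/4}v‖` with `C` independent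
of `a ≥ 0` (`norm_convHat_le`). The exponential passes through the convolution by the triangle
inequality for `|ξ|`, and what remains is the product estimate `Ḣ^{5/4} · Ḣ^{1/4} → L²`. The latter
follows from Cauchy-Schwarz after splitting according to which of the two frequencies is larger
(`trilinear_half`, `lintegral_conv_sq_le`). For the elements of the path spaces one must also know
that the pointwise product of the representing functions has the convolution as its Fourier
transform (`bilin_funRep_ae_eq`); this is reached by frequency cutoffs. Inserted in the Duhamel
integral, these bounds leave a Beta integral and powers of `t` that cancel in the scale invariant
norm (`norm_bilinHat_le`, `exists_isBilinearConstant`).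

The solution is the limit of the Picard iterates in the unweighted global space, where the
contraction condition is `4 C₁ C₃ ‖A^{1/2}u₀‖ < 1`. For `λ₀ < λ̄` the contraction condition holds in
the weighted space on `(0,T]` too, so the same iterates stay in the ball of radius `2 C₁
‖A^{1/2}u₀‖` there. Fatou's lemma hands this bound to the limit (`IsGlobalMildSolution.inDomain`),
so the weighted spaces need no fixed point of their own. The `Ḣ^{1/2}` and `L²` bounds come from
putting the `Ḣ^{5/4}` bound back into `X = Y + B(X,X)` (`IsGlobalMildSolution.inDomain_low`).

Finally, if `e^{bA} w(D) f` is in `L²`, then multiplying its transform by `e^{2πi z·ξ} e^{-bA}`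
extends the translation orbit of `f` analytically to `|Im z| < b` (`uniformlyAnalytic_of_inDomain`),
which turns the exponential bounds into a lower bound on the analyticity radius. -/

lemma IsRepresentedBy.locallyIntegrable {f : 𝓢'(R3, F)} {g : R3 → F} (h : IsRepresentedBy f g) :
    LocallyIntegrable g := by
  intro x
  let b : ContDiffBump x := ⟨1, 2, one_pos, one_lt_two⟩
  have hb₁ : HasCompactSupport (Complex.ofRealCLM ∘ b) := b.hasCompactSupport.comp_left rfl
  have hb₂ : ContDiff ℝ ∞ (Complex.ofRealCLM ∘ b) := Complex.ofRealCLM.contDiff.comp b.contDiff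
  refine ⟨Metric.closedBall x 1, Metric.closedBall_mem_nhds x one_pos, ?_⟩
  refine ((h (hb₁.toSchwartzMap hb₂)).1.integrableOn (s := Metric.closedBall x 1)).congr_fun ?_
    Metric.isClosed_closedBall.measurableSet
  intro y hy
  have : b y = 1 := b.one_of_mem_closedBall hy
  simp [this]

lemma IsRepresentedBy.aestronglyMeasurable {f : 𝓢'(R3, F)} {g : R3 → F}
    (h : IsRepresentedBy f g) : AEStronglyMeasurable g :=
  h.locallyIntegrable.aestronglyMeasurable

lemma IsRepresentedBy.congr {f : 𝓢'(R3, F)} {g g' : R3 → F} (h : IsRepresentedBy f g)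
    (hg : g =ᵐ[volume] g') : IsRepresentedBy f g' := by
  intro φ
  have : (fun x => φ x • g x) =ᵐ[volume] fun x => φ x • g' x := by
    filter_upwards [hg] with x hx using by rw [hx]
  exact ⟨(h φ).1.congr this, (h φ).2.trans (integral_congr_ae this)⟩

lemma IsRepresentedBy.add {f f' : 𝓢'(R3, F)} {g g' : R3 → F} (h : IsRepresentedBy f g)
    (h' : IsRepresentedBy f' g') : IsRepresentedBy (f + f') (g + g') := by
  intro φ
  simp only [Pi.add_apply, smul_add]
  refine ⟨(h φ).1.add (h' φ).1, ?_⟩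
  rw [integral_add (h φ).1 (h' φ).1, ← (h φ).2, ← (h' φ).2]; rfl

lemma IsRepresentedBy.smul {f : 𝓢'(R3, F)} {g : R3 → F} (c : ℂ) (h : IsRepresentedBy f g) :
    IsRepresentedBy (c • f) (c • g) := by
  intro φ
  simp only [Pi.smul_apply, smul_comm _ c]
  refine ⟨(h φ).1.smul c, ?_⟩
  rw [integral_smul, ← (h φ).2]; rfl

lemma IsRepresentedBy.sub {f f' : 𝓢'(R3, F)} {g g' : R3 → F} (h : IsRepresentedBy f g)
    (h' : IsRepresentedBy f' g') : IsRepresentedBy (f - f') (g - g') := by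
  have := h.add (h'.smul (-1))
  simpa [sub_eq_add_neg] using this

lemma isRepresentedBy_zero : IsRepresentedBy (0 : 𝓢'(R3, F)) 0 := by
  intro φ
  simp

/-- The fundamental lemma of the calculus of variations, applied to the difference. It makes
`funRep` independent of the choice in its definition, up to null sets. -/
lemma IsRepresentedBy.ae_eq {f : 𝓢'(R3, F)} {g g' : R3 → F} (h : IsRepresentedBy f g)
    (h' : IsRepresentedBy f g') : g =ᵐ[volume] g' := by
  have h0 := h.sub h'
  rw [sub_self] at h0
  have : ∀ᵐ x, (g - g') x = 0 := by
    refine ae_eq_zero_of_integral_contDiff_smul_eq_zero h0.locallyIntegrable fun b hb hc => ?_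
    have hg₁ : HasCompactSupport (Complex.ofRealCLM ∘ b) := hc.comp_left rfl
    have hg₂ : ContDiff ℝ ∞ (Complex.ofRealCLM ∘ b) := by fun_prop
    have := (h0 (hg₁.toSchwartzMap hg₂)).2
    simpa using this.symm
  filter_upwards [this] with x hx using sub_eq_zero.1 hx

lemma IsRepresentedBy.funRep_ae {f : 𝓢'(R3, F)} {g : R3 → F} (h : IsRepresentedBy f g) :
    funRep f =ᵐ[volume] g := by
  have hex : ∃ g, IsRepresentedBy f g := ⟨g, h⟩
  have : funRep f = hex.choose := by simp [funRep, hex]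
  rw [this]
  exact hex.choose_spec.ae_eq h

lemma isRepresentedBy_funRep {f : 𝓢'(R3, F)} (h : ∃ g, IsRepresentedBy f g) :
    IsRepresentedBy f (funRep f) := by
  obtain ⟨g, hg⟩ := h
  exact hg.congr hg.funRep_ae.symm

lemma IsRepresentedBy.eq {f f' : 𝓢'(R3, F)} {g : R3 → F} (h : IsRepresentedBy f g)
    (h' : IsRepresentedBy f' g) : f = f' := by
  ext φ
  rw [(h φ).2, (h' φ).2]

lemma isRepresentedBy_toTemperedDistribution {p : ℝ≥0∞} [hp : Fact (1 ≤ p)]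
    (g : Lp F p (volume : Measure R3)) : IsRepresentedBy (Lp.toTemperedDistribution g) g := by
  intro φ
  refine ⟨?_, Lp.toTemperedDistribution_apply g φ⟩
  have := ENNReal.HolderConjugate.inv_one_sub_inv' hp.out
  rw [← memLp_one_iff_integrable]
  exact MemLp.smul (p := (1 - p⁻¹)⁻¹) (q := p) (Lp.memLp g) (φ.memLp _ _)

lemma isRepresentedBy_of_memLp {p : ℝ≥0∞} [Fact (1 ≤ p)] {g : R3 → F} (hg : MemLp g p) :
    IsRepresentedBy (Lp.toTemperedDistribution (hg.toLp g)) g :=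
  (isRepresentedBy_toTemperedDistribution _).congr hg.coeFn_toLp

lemma IsRepresentedBy.smulLeft {f : 𝓢'(R3, F)} {g : R3 → F} (h : IsRepresentedBy f g)
    {m : R3 → ℂ} (hm : m.HasTemperateGrowth) :
    IsRepresentedBy (TemperedDistribution.smulLeftCLM F m f) (fun x => m x • g x) := by
  intro φ
  have := h (SchwartzMap.smulLeftCLM ℂ m φ)
  simp only [SchwartzMap.smulLeftCLM_apply_apply hm, smul_eq_mul] at this
  simp only [TemperedDistribution.smulLeftCLM_apply_apply]
  simpa only [smul_smul, mul_comm (m _)] using this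

/-! ### Classes in `L²` -/

lemma coeFn_toL2 {g : R3 → F} (h : MemLp g 2) : toL2 g =ᵐ[volume] g := by
  rw [toL2, dif_pos h]; exact h.coeFn_toLp

lemma toL2_congr {g g' : R3 → F} (h : g =ᵐ[volume] g') : toL2 g = toL2 g' := by
  by_cases hg : MemLp g 2
  · have hg' := hg.ae_eq h
    apply Lp.ext
    exact (coeFn_toL2 hg).trans (h.trans (coeFn_toL2 hg').symm)
  · have hg' : ¬ MemLp g' 2 := fun h' => hg (h'.ae_eq h.symm)
    simp [toL2, hg, hg']

lemma toL2_coeFn (g : Lp F 2 (volume : Measure R3)) : toL2 (g : R3 → F) = g :=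
  Lp.ext (coeFn_toL2 (Lp.memLp g))

lemma toL2_eq {g : R3 → F} {h : Lp F 2 (volume : Measure R3)} (hg : g =ᵐ[volume] h) :
    toL2 g = h := by rw [toL2_congr hg, toL2_coeFn]

lemma toL2_add {g g' : R3 → F} (h : MemLp g 2) (h' : MemLp g' 2) :
    toL2 (g + g') = toL2 g + toL2 g' := by
  apply toL2_eq
  filter_upwards [coeFn_toL2 h, coeFn_toL2 h', Lp.coeFn_add (toL2 g) (toL2 g')] with x h1 h2 h3
  rw [h3, Pi.add_apply, Pi.add_apply, h1, h2]

lemma toL2_smul {g : R3 → F} (c : ℂ) (h : MemLp g 2) : toL2 (c • g) = c • toL2 g := by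
  apply toL2_eq
  filter_upwards [coeFn_toL2 h, Lp.coeFn_smul c (toL2 g)] with x h1 h3
  rw [h3, Pi.smul_apply, Pi.smul_apply, h1]

lemma norm_toL2 {g : R3 → F} (h : MemLp g 2) : ‖toL2 g‖ = (eLpNorm g 2).toReal := by
  rw [Lp.norm_def, eLpNorm_congr_ae (coeFn_toL2 h)]

lemma enorm_toL2 {g : R3 → F} (h : MemLp g 2) : ‖toL2 g‖ₑ = eLpNorm g 2 := by
  rw [Lp.enorm_def, eLpNorm_congr_ae (coeFn_toL2 h)]

/-! ### The operators `w(D)` -/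

lemma fourier_toTD (g : Lp F 2 (volume : Measure R3)) :
    IsRepresentedBy (𝓕 (Lp.toTemperedDistribution g)) (𝓕 g : Lp F 2 (volume : Measure R3)) := by
  rw [Lp.fourier_toTemperedDistribution_eq]
  exact isRepresentedBy_toTemperedDistribution _

lemma eq_of_fourier_rep {f f' : 𝓢'(R3, F)} {g g' : R3 → F} (h : IsRepresentedBy (𝓕 f) g)
    (h' : IsRepresentedBy (𝓕 f') g') (hg : g =ᵐ[volume] g') : f = f' := by
  have := h.eq (h'.congr hg.symm)
  have h2 : (𝓕⁻ (𝓕 f : 𝓢'(R3, F)) : 𝓢'(R3, F)) = 𝓕⁻ (𝓕 f' : 𝓢'(R3, F)) := by rw [this]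
  simpa using h2

/-- The product of a complex weight with a vector-valued function. -/
def wmul (w : R3 → ℝ) (g : R3 → F) : R3 → F := fun ξ => (w ξ : ℂ) • g ξ

lemma wmul_congr (w : R3 → ℝ) {g g' : R3 → F} (h : g =ᵐ[volume] g') :
    wmul w g =ᵐ[volume] wmul w g' := by
  filter_upwards [h] with x hx using by simp [wmul, hx]

/-- The Fourier transform of `w(D) f`. -/
def hatMul (w : R3 → ℝ) (f : 𝓢'(R3, F)) : Lp F 2 (volume : Measure R3) :=
  toL2 (wmul w (funRep (𝓕 f)))

lemma applyMul_eq (w : R3 → ℝ) (f : 𝓢'(R3, F)) : applyMul w f = 𝓕⁻ (hatMul w f) := rfl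

lemma norm_fourierInv (g : Lp F 2 (volume : Measure R3)) : ‖𝓕⁻ g‖ = ‖g‖ :=
  (Lp.fourierTransformₗᵢ R3 F).symm.norm_map g

lemma expNorm_eq (a s : ℝ) (f : 𝓢'(R3, F)) : expNorm a s f = ‖hatMul (expPow a s) f‖ := by
  rw [expNorm, applyMul_eq, norm_fourierInv]

lemma InDomain.rep {w : R3 → ℝ} {f : 𝓢'(R3, F)} (h : InDomain w f) :
    IsRepresentedBy (𝓕 f) (funRep (𝓕 f)) := isRepresentedBy_funRep h.1

lemma InDomain.memLp {w : R3 → ℝ} {f : 𝓢'(R3, F)} (h : InDomain w f) :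
    MemLp (wmul w (funRep (𝓕 f))) 2 := h.2

lemma InDomain.coeFn_hatMul {w : R3 → ℝ} {f : 𝓢'(R3, F)} (h : InDomain w f) :
    hatMul w f =ᵐ[volume] wmul w (funRep (𝓕 f)) := coeFn_toL2 h.2

lemma IsRepresentedBy.inDomain {w : R3 → ℝ} {f : 𝓢'(R3, F)} {g : R3 → F}
    (h : IsRepresentedBy (𝓕 f) g) (hw : MemLp (wmul w g) 2) : InDomain w f :=
  ⟨⟨g, h⟩, hw.ae_eq (wmul_congr w h.funRep_ae.symm)⟩

lemma IsRepresentedBy.hatMul {f : 𝓢'(R3, F)} {g : R3 → F}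
    (h : IsRepresentedBy (𝓕 f) g) (w : R3 → ℝ) : hatMul w f = toL2 (wmul w g) :=
  toL2_congr (wmul_congr w h.funRep_ae)

lemma InDomain.add {w : R3 → ℝ} {f f' : 𝓢'(R3, F)} (h : InDomain w f) (h' : InDomain w f') :
    InDomain w (f + f') := by
  have hr : IsRepresentedBy (𝓕 (f + f')) (funRep (𝓕 f) + funRep (𝓕 f')) := by
    rw [FourierTransform.fourier_add]; exact h.rep.add h'.rep
  refine hr.inDomain ?_
  convert h.memLp.add h'.memLp using 1
  ext1 x; simp [wmul, smul_add]

lemma hatMul_add {w : R3 → ℝ} {f f' : 𝓢'(R3, F)} (h : InDomain w f) (h' : InDomain w f') :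
    hatMul w (f + f') = hatMul w f + hatMul w f' := by
  have hr : IsRepresentedBy (𝓕 (f + f')) (funRep (𝓕 f) + funRep (𝓕 f')) := by
    rw [FourierTransform.fourier_add]; exact h.rep.add h'.rep
  rw [hr.hatMul, hatMul, hatMul, ← toL2_add h.memLp h'.memLp]
  congr 1
  ext1 x; simp [wmul, smul_add]

lemma measurable_symA : Measurable symA := by unfold symA; fun_prop

lemma symA_nonneg (ξ : R3) : 0 ≤ symA ξ := by unfold symA; positivity

lemma measurable_expPow (a s : ℝ) : Measurable (expPow a s) := by
  unfold expPow
  have := measurable_symA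
  fun_prop

lemma expPow_nonneg (a s : ℝ) (ξ : R3) : 0 ≤ expPow a s ξ :=
  mul_nonneg (Real.exp_nonneg _) (Real.rpow_nonneg (symA_nonneg ξ) _)

lemma ae_symA_pos : ∀ᵐ ξ : R3, 0 < symA ξ := by
  have : ∀ᵐ ξ : R3, ξ ≠ 0 := by simp [ae_iff]
  filter_upwards [this] with ξ hξ
  unfold symA
  have := norm_pos_iff.2 hξ
  positivity

end MildNS
end

noncomputable section

namespace MildNS

/-! ### A bilinear convolution estimate -/

lemma lintegral_mul_sq_le {α : Type*} [MeasurableSpace α] {μ : Measure α} {f g : α → ℝ≥0∞}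
    (hf : AEMeasurable f μ) (hg : AEMeasurable g μ) :
    (∫⁻ a, f a * g a ∂μ) ^ 2 ≤ (∫⁻ a, f a ^ 2 ∂μ) * ∫⁻ a, g a ^ 2 ∂μ := by
  have h := ENNReal.lintegral_mul_le_Lp_mul_Lq μ Real.HolderConjugate.two_two hf hg
  simp only [Pi.mul_apply, ENNReal.rpow_two] at h
  calc _ ≤ _ := pow_le_pow_left₀ (zero_le) h 2
    _ = _ := by
      rw [mul_pow, ← ENNReal.rpow_natCast, ← ENNReal.rpow_natCast, ← ENNReal.rpow_mul,
        ← ENNReal.rpow_mul]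
      norm_num

/-- The power `A^p` of the symbol of `A`, as an extended nonnegative real. -/
def symPow (p : ℝ) (x : R3) : ℝ≥0∞ := ENNReal.ofReal (symA x ^ p)

lemma measurable_symPow (p : ℝ) : Measurable (symPow p) := by
  unfold symPow
  have := measurable_symA
  fun_prop

lemma symPow_mul {x : R3} (hx : 0 < symA x) (p q : ℝ) :
    symPow p x * symPow q x = symPow (p + q) x := by
  rw [symPow, symPow, symPow, ← ENNReal.ofReal_mul (by positivity), ← Real.rpow_add hx]

lemma symPow_zero (x : R3) : symPow 0 x = 1 := by simp [symPow]

lemma measurableSet_symA_le (r : ℝ) : MeasurableSet {x : R3 | symA x ≤ r} :=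
  measurable_symA measurableSet_Iic

/-- The integral of `A^{-α}` over the unit ball. -/
def unitIntegral (α : ℝ) : ℝ≥0∞ := ∫⁻ x in {x : R3 | symA x ≤ 1}, symPow (-α) x

lemma unitIntegral_lt_top {α : ℝ} (hα : α < 3) : unitIntegral α < ∞ := by
  have hf : Module.finrank ℝ R3 = 3 := by simp
  have hm : Measurable fun x : R3 => symA x ^ (-α) := by
    have := measurable_symA
    fun_prop
  have h := integrableOn_ball_of_norm_le_rpow (μ := (volume : Measure R3)) (E := R3)
    (f := fun x => symA x ^ (-α)) (C := (2 * Real.pi) ^ (-α)) (α := α) (r := 1)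
    (by simp) (by rw [hf]; exact_mod_cast hα)
    (by
      filter_upwards with x
      rw [Real.norm_of_nonneg (Real.rpow_nonneg (symA_nonneg x) _), symA,
        Real.mul_rpow (by positivity) (norm_nonneg _)])
    hm.aestronglyMeasurable
  have hsub : {x : R3 | symA x ≤ 1} ⊆ Metric.ball 0 1 := by
    intro x hx
    have hx : 2 * Real.pi * ‖x‖ ≤ 1 := hx
    rw [mem_ball_zero_iff]
    nlinarith [Real.pi_gt_three, norm_nonneg x]
  have h2 := (h.mono_set hsub).lintegral_lt_top
  exact h2

/-- Scaling `x ↦ r x` contributes `r³` from the measure and `r^{-α}` from the integrand. The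
identity lives in `[0, ∞]`, so no bound on `α` is needed here. -/
lemma lintegral_symA_le {α r : ℝ} (hr : 0 < r) :
    ∫⁻ x in {x : R3 | symA x ≤ r}, symPow (-α) x = ENNReal.ofReal (r ^ (3 - α)) * unitIntegral α := by
  have hmap := Measure.map_addHaar_smul (volume : Measure R3) hr.ne'
  have hf : Module.finrank ℝ R3 = 3 := by simp
  rw [hf] at hmap
  have hv : (volume : Measure R3) =
      ENNReal.ofReal (r ^ 3) • Measure.map (fun x : R3 => r • x) volume := by
    rw [hmap, smul_smul, ← ENNReal.ofReal_mul (by positivity), abs_of_pos (by positivity),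
      mul_inv_cancel₀ (by positivity)]
    simp
  have hs (x : R3) : symA (r • x) = r * symA x := by
    simp only [symA, norm_smul, Real.norm_of_nonneg hr.le]; ring
  have hmeas : Measurable ({x : R3 | symA x ≤ r}.indicator (symPow (-α))) :=
    (measurable_symPow _).indicator (measurableSet_symA_le r)
  rw [← lintegral_indicator (measurableSet_symA_le r)]
  nth_rewrite 1 [hv]
  rw [lintegral_smul_measure, lintegral_map hmeas (by fun_prop), unitIntegral,
    ← lintegral_indicator (measurableSet_symA_le 1)]
  have : ∀ x : R3, {x : R3 | symA x ≤ r}.indicator (symPow (-α)) (r • x) =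
      ENNReal.ofReal (r ^ (-α)) * {x : R3 | symA x ≤ 1}.indicator (symPow (-α)) x := by
    intro x
    have hiff : symA (r • x) ≤ r ↔ symA x ≤ 1 := by
      rw [hs]; exact mul_le_iff_le_one_right hr
    by_cases hx : symA x ≤ 1
    · rw [indicator_of_mem (show r • x ∈ {x : R3 | symA x ≤ r} from hiff.2 hx),
        indicator_of_mem (show x ∈ {x : R3 | symA x ≤ 1} from hx), symPow, symPow, hs,
        Real.mul_rpow hr.le (symA_nonneg x), ENNReal.ofReal_mul (by positivity)]
    · rw [indicator_of_notMem (show r • x ∉ {x : R3 | symA x ≤ r} from fun h => hx (hiff.1 h)),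
        indicator_of_notMem (show x ∉ {x : R3 | symA x ≤ 1} from hx), mul_zero]
  simp_rw [this]
  rw [lintegral_const_mul _ ((measurable_symPow _).indicator (measurableSet_symA_le 1)),
    smul_eq_mul, ← mul_assoc, ← ENNReal.ofReal_mul (by positivity)]
  congr 2
  rw [← Real.rpow_natCast, ← Real.rpow_add hr]
  norm_num [sub_eq_add_neg]

/-- Cauchy-Schwarz on the product space. One factor is `A^α f(a) h(a+b)`, whose square integrates to
a product by translation invariance. The other is the cutoff of `A^{-α}(a) A^{-β}(b) · A^β g(b)`,
where the restriction `|a| ≤ |b|` makes the integral over `a` a pure power of `|b|`. -/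
lemma trilinear_half {α β : ℝ} (hαβ : α + β = 3 / 2) {f g h : R3 → ℝ≥0∞} (hf : Measurable f)
    (hg : Measurable g) (hh : Measurable h) :
    (∫⁻ b, ∫⁻ a, {a : R3 | symA a ≤ symA b}.indicator (fun a => f a * g b * h (a + b)) a) ^ 2 ≤
      unitIntegral (2 * α) * (∫⁻ a, (symPow α a * f a) ^ 2) * (∫⁻ b, (symPow β b * g b) ^ 2) *
        ∫⁻ x, h x ^ 2 := by
  have hsα := measurable_symPow α
  have hsβ := measurable_symPow β
  have hsα' := measurable_symPow (-α)
  have hsβ' := measurable_symPow (-β)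
  have hsA := measurable_symA
  let A : Set (R3 × R3) := {z | symA z.2 ≤ symA z.1}
  have hA : MeasurableSet A := measurableSet_le (hsA.comp measurable_snd) (hsA.comp measurable_fst)
  let φ : R3 × R3 → ℝ≥0∞ := fun z => symPow α z.2 * f z.2 * h (z.2 + z.1)
  let ψ : R3 × R3 → ℝ≥0∞ := A.indicator fun z =>
    symPow (-α) z.2 * symPow (-β) z.1 * (symPow β z.1 * g z.1)
  have hφ : Measurable φ := by fun_prop
  have hψ : Measurable ψ := Measurable.indicator (by fun_prop) hA
  have key : ∫⁻ b, ∫⁻ a, {a : R3 | symA a ≤ symA b}.indicator (fun a => f a * g b * h (a + b)) a =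
      ∫⁻ z, φ z * ψ z ∂(volume.prod volume) := by
    rw [lintegral_prod (fun z => φ z * ψ z) (hφ.mul hψ).aemeasurable]
    refine lintegral_congr_ae ?_
    filter_upwards [ae_symA_pos] with b hb
    refine lintegral_congr_ae ?_
    filter_upwards [ae_symA_pos] with a ha
    by_cases hab : symA a ≤ symA b
    · rw [indicator_of_mem (show a ∈ {a : R3 | symA a ≤ symA b} from hab)]
      simp only [φ, ψ]
      rw [indicator_of_mem (show (b, a) ∈ A from hab)]
      have h1 : symPow α a * symPow (-α) a = 1 := by rw [symPow_mul ha]; simp [symPow_zero]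
      have h2 : symPow (-β) b * symPow β b = 1 := by rw [symPow_mul hb]; simp [symPow_zero]
      calc f a * g b * h (a + b) = (symPow α a * symPow (-α) a) * (symPow (-β) b * symPow β b) *
            (f a * g b * h (a + b)) := by rw [h1, h2]; ring
        _ = _ := by ring
    · rw [indicator_of_notMem (show a ∉ {a : R3 | symA a ≤ symA b} from hab)]
      simp only [φ, ψ]
      rw [indicator_of_notMem (show (b, a) ∉ A from hab), mul_zero]
  rw [key]
  refine (lintegral_mul_sq_le hφ.aemeasurable hψ.aemeasurable).trans ?_
  have e1 : ∫⁻ z, φ z ^ 2 ∂(volume.prod volume) =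
      (∫⁻ a, (symPow α a * f a) ^ 2) * ∫⁻ x, h x ^ 2 := by
    rw [lintegral_prod_symm _ (hφ.pow_const 2).aemeasurable]
    simp only [φ, mul_pow (symPow α _ * f _)]
    rw [← lintegral_mul_const _ (by fun_prop)]
    refine lintegral_congr fun a => ?_
    rw [lintegral_const_mul _ (by fun_prop), lintegral_add_left_eq_self (fun x => h x ^ 2) a]
  have e2 : ∫⁻ z, ψ z ^ 2 ∂(volume.prod volume) =
      unitIntegral (2 * α) * ∫⁻ b, (symPow β b * g b) ^ 2 := by
    rw [lintegral_prod _ (hψ.pow_const 2).aemeasurable, ← lintegral_const_mul _ (by fun_prop)]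
    refine lintegral_congr_ae ?_
    filter_upwards [ae_symA_pos] with b hb
    have : ∀ᵐ a, ψ (b, a) ^ 2 = (symPow (-(2 * β)) b * (symPow β b * g b) ^ 2) *
        {a : R3 | symA a ≤ symA b}.indicator (symPow (-(2 * α))) a := by
      filter_upwards [ae_symA_pos] with a ha
      simp only [ψ]
      by_cases hab : symA a ≤ symA b
      · rw [indicator_of_mem (show a ∈ {a : R3 | symA a ≤ symA b} from hab),
          indicator_of_mem (show (b, a) ∈ A from hab)]
        have h1 : symPow (-α) a ^ 2 = symPow (-(2 * α)) a := by
          rw [sq, symPow_mul ha]; congr 1; ring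
        have h2 : symPow (-β) b ^ 2 = symPow (-(2 * β)) b := by
          rw [sq, symPow_mul hb]; congr 1; ring
        rw [mul_pow, mul_pow, h1, h2]; ring
      · rw [indicator_of_notMem (show a ∉ {a : R3 | symA a ≤ symA b} from hab),
          indicator_of_notMem (show (b, a) ∉ A from hab)]
        simp
    rw [lintegral_congr_ae this, lintegral_const_mul _
      ((measurable_symPow _).indicator (measurableSet_symA_le _)),
      lintegral_indicator (measurableSet_symA_le _), lintegral_symA_le hb]
    -- The only use of `α + β = 3/2`: the integral over `a` scales as `|b|^{3-2α}`, which exactly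
    -- cancels `|b|^{-2β}`.
    have h3 : symPow (-(2 * β)) b * ENNReal.ofReal (symA b ^ (3 - 2 * α)) = 1 := by
      have := symPow_mul hb (-(2 * β)) (3 - 2 * α)
      rw [show -(2 * β) + (3 - 2 * α) = 0 by linarith, symPow_zero] at this
      exact this
    calc _ = (symPow (-(2 * β)) b * ENNReal.ofReal (symA b ^ (3 - 2 * α))) *
          (unitIntegral (2 * α) * (symPow β b * g b) ^ 2) := by ring
      _ = _ := by rw [h3, one_mul]
  rw [e1, e2]
  exact le_of_eq (by ring)

lemma sq_add_le_four_mul (x y : ℝ≥0∞) : (x + y) ^ 2 ≤ 4 * (x ^ 2 + y ^ 2) := by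
  wlog hxy : x ≤ y generalizing x y
  · rw [add_comm x, add_comm (x ^ 2)]; exact this y x (le_of_not_ge hxy)
  calc (x + y) ^ 2 ≤ (y + y) ^ 2 := by gcongr
    _ = 4 * y ^ 2 := by ring
    _ ≤ _ := by gcongr; exact le_add_self

/-- The constant in the convolution estimate. -/
def convConst : ℝ≥0∞ := 4 * (unitIntegral (5 / 2) + unitIntegral (1 / 2))

lemma convConst_lt_top : convConst < ∞ := by
  unfold convConst
  refine ENNReal.mul_lt_top (by simp) (ENNReal.add_lt_top.2 ⟨?_, ?_⟩) <;>
    exact unitIntegral_lt_top (by norm_num)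

/-- Where `|a| ≤ |b|` the low frequency factor is `f`, with exponent `5/4`; in the other region it
is `g`, with exponent `1/4`. The resulting integrals of `A^{-5/2}` and `A^{-1/2}` over the unit ball
are both finite in dimension three. -/
lemma trilinear {f g h : R3 → ℝ≥0∞} (hf : Measurable f) (hg : Measurable g) (hh : Measurable h) :
    (∫⁻ b, ∫⁻ a, f a * g b * h (a + b)) ^ 2 ≤
      convConst * (∫⁻ a, (symPow (5 / 4) a * f a) ^ 2) * (∫⁻ b, (symPow (1 / 4) b * g b) ^ 2) *
        ∫⁻ x, h x ^ 2 := by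
  have hsA := measurable_symA
  let A : Set (R3 × R3) := {z | symA z.2 ≤ symA z.1}
  have hA : MeasurableSet A := measurableSet_le (hsA.comp measurable_snd) (hsA.comp measurable_fst)
  let B : Set (R3 × R3) := {z | symA z.1 ≤ symA z.2}
  have hB : MeasurableSet B := measurableSet_le (hsA.comp measurable_fst) (hsA.comp measurable_snd)
  have mm : Measurable (fun z : R3 × R3 => f z.2 * g z.1 * h (z.2 + z.1)) := by fun_prop
  have h1 := trilinear_half (α := 5 / 4) (β := 1 / 4) (by norm_num) hf hg hh
  have h2 := trilinear_half (α := 1 / 4) (β := 5 / 4) (by norm_num) hg hf hh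
  have hswap : ∫⁻ b, ∫⁻ a, {a : R3 | symA a ≤ symA b}.indicator
      (fun a => g a * f b * h (a + b)) a =
      ∫⁻ b, ∫⁻ a, {a : R3 | symA b ≤ symA a}.indicator (fun a => f a * g b * h (a + b)) a := by
    rw [lintegral_lintegral_swap]
    · refine lintegral_congr fun b => lintegral_congr fun a => ?_
      simp only [indicator_apply, mem_ofPred_eq]
      split_ifs
      · rw [add_comm a b]; ring
      · rfl
    · have : Measurable (A.indicator (fun z : R3 × R3 => g z.2 * f z.1 * h (z.2 + z.1))) :=
        Measurable.indicator (by fun_prop) hA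
      exact this.aemeasurable
  rw [hswap] at h2
  have hle : ∫⁻ b, ∫⁻ a, f a * g b * h (a + b) ≤
      (∫⁻ b, ∫⁻ a, {a : R3 | symA a ≤ symA b}.indicator (fun a => f a * g b * h (a + b)) a) +
      ∫⁻ b, ∫⁻ a, {a : R3 | symA b ≤ symA a}.indicator (fun a => f a * g b * h (a + b)) a := by
    have mA : Measurable (A.indicator (fun z : R3 × R3 => f z.2 * g z.1 * h (z.2 + z.1))) :=
      mm.indicator hA
    have mA' : Measurable fun b : R3 => ∫⁻ a, {a : R3 | symA a ≤ symA b}.indicator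
        (fun a => f a * g b * h (a + b)) a := mA.lintegral_prod_right'
    rw [← lintegral_add_left mA']
    refine lintegral_mono fun b => ?_
    have mAb : Measurable ({a : R3 | symA a ≤ symA b}.indicator
        (fun a => f a * g b * h (a + b))) :=
      Measurable.indicator (by fun_prop) (measurableSet_symA_le _)
    rw [← lintegral_add_left mAb]
    refine lintegral_mono fun a => ?_
    rcases le_total (symA a) (symA b) with hab | hab
    · rw [indicator_of_mem (show a ∈ {a : R3 | symA a ≤ symA b} from hab)]; exact le_self_add
    · rw [indicator_of_mem (show a ∈ {a : R3 | symA b ≤ symA a} from hab)]; exact le_add_self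
  refine (pow_le_pow_left₀ zero_le hle 2).trans ((sq_add_le_four_mul _ _).trans ?_)
  refine (mul_le_mul (le_refl 4) (add_le_add h1 h2) zero_le zero_le).trans ?_
  refine le_of_eq ?_
  have n1 : (2 : ℝ) * (5 / 4) = 5 / 2 := by norm_num
  have n2 : (2 : ℝ) * (1 / 4) = 1 / 2 := by norm_num
  rw [convConst, n1, n2]
  generalize (∫⁻ a, (symPow (5 / 4) a * f a) ^ 2) = x
  generalize (∫⁻ a, (symPow (1 / 4) a * g a) ^ 2) = y
  generalize (∫⁻ x, h x ^ 2) = z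
  ring

/-- Duality in `L²` without knowing beforehand that `S` is square integrable. The truncations of `S`
in height and to balls have finite `L²` norm, so testing against them allows division; Fatou's lemma
then removes the truncation. -/
lemma lintegral_sq_le_of_dual {S : R3 → ℝ≥0∞} (hS : Measurable S) {D : ℝ≥0∞}
    (H : ∀ h : R3 → ℝ≥0∞, Measurable h → (∫⁻ x, S x * h x) ^ 2 ≤ D * ∫⁻ x, h x ^ 2) :
    ∫⁻ x, S x ^ 2 ≤ D := by
  let h : ℕ → R3 → ℝ≥0∞ := fun n => (Metric.ball (0 : R3) n).indicator fun x => min (S x) n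
  have hm (n : ℕ) : Measurable (h n) :=
    (hS.min measurable_const).indicator Metric.isOpen_ball.measurableSet
  have hle (n : ℕ) (x : R3) : h n x ≤ S x := by
    by_cases hx : x ∈ Metric.ball (0 : R3) n
    · simp only [h, indicator_of_mem hx]; exact min_le_left _ _
    · simp only [h, indicator_of_notMem hx]; exact zero_le
  have hfin (n : ℕ) : ∫⁻ x, h n x ^ 2 < ∞ := by
    calc ∫⁻ x, h n x ^ 2 ≤ ∫⁻ x in Metric.ball (0 : R3) n, (n : ℝ≥0∞) ^ 2 := by
          rw [← lintegral_indicator Metric.isOpen_ball.measurableSet]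
          refine lintegral_mono fun x => ?_
          by_cases hx : x ∈ Metric.ball (0 : R3) n
          · simp only [h, indicator_of_mem hx]; gcongr; exact min_le_right _ _
          · simp [h, indicator_of_notMem hx]
      _ < ∞ := by
          rw [setLIntegral_const]
          exact ENNReal.mul_lt_top (by simp) measure_ball_lt_top
  have hbd (n : ℕ) : ∫⁻ x, h n x ^ 2 ≤ D := by
    by_cases h0 : ∫⁻ x, h n x ^ 2 = 0
    · rw [h0]; exact zero_le
    have h1 : (∫⁻ x, h n x ^ 2) ^ 2 ≤ D * ∫⁻ x, h n x ^ 2 := by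
      refine le_trans (pow_le_pow_left₀ zero_le (lintegral_mono fun x => ?_) 2) (H (h n) (hm n))
      rw [sq]; gcongr; exact hle n x
    rw [sq, mul_comm D] at h1
    exact (ENNReal.mul_le_mul_iff_right h0 (hfin n).ne).1 h1
  have hlim (x : R3) : Filter.Tendsto (fun n => h n x ^ 2) Filter.atTop (nhds (S x ^ 2)) := by
    refine ((ENNReal.continuous_pow 2).tendsto _).comp ?_
    have h1 : Filter.Tendsto (fun n : ℕ => min (S x) n) Filter.atTop (nhds (min (S x) ∞)) :=
      tendsto_const_nhds.min ENNReal.tendsto_nat_nhds_top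
    rw [min_eq_left le_top] at h1
    refine h1.congr' ?_
    obtain ⟨N, hN⟩ := exists_nat_gt ‖x‖
    filter_upwards [Filter.eventually_ge_atTop N] with n hn
    have : x ∈ Metric.ball (0 : R3) n := by
      rw [mem_ball_zero_iff]; exact hN.trans_le (by exact_mod_cast hn)
    simp only [h]
    rw [indicator_of_mem this]
  calc ∫⁻ x, S x ^ 2 = ∫⁻ x, Filter.liminf (fun n => h n x ^ 2) Filter.atTop :=
        lintegral_congr fun x => (hlim x).liminf_eq.symm
    _ ≤ Filter.liminf (fun n => ∫⁻ x, h n x ^ 2) Filter.atTop :=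
        lintegral_liminf_le fun n => (hm n).pow_const 2
    _ ≤ D := Filter.liminf_le_of_le (by isBoundedDefault) fun b hb => by
        obtain ⟨n, hn⟩ := hb.exists
        exact hn.trans (hbd n)

/-- `‖f * g‖ ≤ C ‖A^{5/4} f‖ ‖A^{1/4} g‖` in `L²` for the convolution of nonnegative functions. -/
lemma lintegral_conv_sq_le {f g : R3 → ℝ≥0∞} (hf : Measurable f) (hg : Measurable g) :
    ∫⁻ ξ, (∫⁻ η, f η * g (ξ - η)) ^ 2 ≤
      convConst * (∫⁻ a, (symPow (5 / 4) a * f a) ^ 2) * ∫⁻ b, (symPow (1 / 4) b * g b) ^ 2 := by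
  have hm : Measurable fun z : R3 × R3 => f z.2 * g (z.1 - z.2) := by fun_prop
  refine lintegral_sq_le_of_dual hm.lintegral_prod_right' fun h hh => ?_
  -- Pairing with `h` and substituting `ξ = a + b` turns the convolution into the trilinear form.
  refine le_trans (le_of_eq ?_) (trilinear hf hg hh)
  congr 1
  calc ∫⁻ ξ, (∫⁻ η, f η * g (ξ - η)) * h ξ = ∫⁻ ξ, ∫⁻ η, f η * g (ξ - η) * h ξ := by
        refine lintegral_congr fun ξ => ?_
        rw [lintegral_mul_const _ (by fun_prop)]
    _ = ∫⁻ η, ∫⁻ ξ, f η * g (ξ - η) * h ξ := by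
        apply lintegral_lintegral_swap
        fun_prop
    _ = ∫⁻ a, ∫⁻ b, f a * g b * h (a + b) := by
        refine lintegral_congr fun a => ?_
        rw [← lintegral_add_left_eq_self _ a]
        simp
    _ = _ := by
        apply lintegral_lintegral_swap
        fun_prop

end MildNS
end

noncomputable section

namespace MildNS

set_option linter.unusedSectionVars false

open Filter Topology

variable {F : Type*} [NormedAddCommGroup F] [InnerProductSpace ℂ F] [CompleteSpace F]

/-! ### Fourier multipliers on `L²` -/

lemma eLpNorm_two_sq {α : Type*} [MeasurableSpace α] {μ : Measure α} {E : Type*}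
    [NormedAddCommGroup E] (f : α → E) : eLpNorm f 2 μ ^ 2 = ∫⁻ x, ‖f x‖ₑ ^ 2 ∂μ := by
  rw [eLpNorm_eq_lintegral_rpow_enorm_toReal (by simp) (by simp), ← ENNReal.rpow_natCast,
    ← ENNReal.rpow_mul]
  simp

lemma tendsto_zero_of_sq_tendsto_zero {ι : Type*} {l : Filter ι} {u : ι → ℝ≥0∞}
    (h : Tendsto (fun n => u n ^ 2) l (𝓝 0)) : Tendsto u l (𝓝 0) := by
  have h3 : Tendsto (fun n => (u n ^ 2) ^ (1 / 2 : ℝ)) l (𝓝 (0 ^ (1 / 2 : ℝ))) :=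
    ((ENNReal.continuous_rpow_const (y := (1 / 2 : ℝ))).tendsto 0).comp h
  have h4 : (0 : ℝ≥0∞) ^ (1 / 2 : ℝ) = 0 := by simp
  rw [h4] at h3
  refine h3.congr fun n => ?_
  rw [← ENNReal.rpow_natCast, ← ENNReal.rpow_mul]
  simp

lemma memLp_two_of_lintegral {f : R3 → F} (hf : AEStronglyMeasurable f)
    (h : ∫⁻ x, ‖f x‖ₑ ^ 2 < ∞) : MemLp f 2 := by
  refine ⟨hf, ?_⟩
  rw [← eLpNorm_two_sq] at h
  exact lt_of_not_ge fun h' => by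
    rw [top_le_iff.1 h'] at h
    simp at h

lemma tendsto_eLpNorm_two_of_dominated {ι : Type*} {l : Filter ι} [l.IsCountablyGenerated]
    {g : ι → R3 → F} {g₀ : R3 → F} {b : R3 → ℝ≥0∞} (hm : ∀ᶠ n in l, AEStronglyMeasurable (g n))
    (hm₀ : AEStronglyMeasurable g₀) (hb : ∫⁻ x, b x ^ 2 < ∞)
    (hbd : ∀ᶠ n in l, ∀ᵐ x, ‖g n x - g₀ x‖ₑ ≤ b x)
    (hlim : ∀ᵐ x, Tendsto (fun n => g n x) l (𝓝 (g₀ x))) :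
    Tendsto (fun n => eLpNorm (g n - g₀) 2) l (𝓝 0) := by
  have h := tendsto_lintegral_filter_of_dominated_convergence' (μ := (volume : Measure R3)) (l := l)
    (F := fun n x => ‖g n x - g₀ x‖ₑ ^ 2) (f := fun _ => 0) (fun x => b x ^ 2)
    (by
      filter_upwards [hm] with n hn
      exact (hn.sub hm₀).enorm.pow_const 2)
    (by
      filter_upwards [hbd] with n hn
      filter_upwards [hn] with x hx
      gcongr)
    hb.ne
    (by
      filter_upwards [hlim] with x hx
      have h1 : Tendsto (fun n => ‖g n x - g₀ x‖ₑ) l (𝓝 ‖g₀ x - g₀ x‖ₑ) :=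
        (hx.sub_const _).enorm
      rw [sub_self, enorm_zero] at h1
      have h2 : Tendsto (fun n => ‖g n x - g₀ x‖ₑ ^ 2) l (𝓝 (0 ^ 2)) :=
        ((ENNReal.continuous_pow 2).tendsto 0).comp h1
      simpa using h2)
  simp only [lintegral_zero] at h
  have e : ∀ n, eLpNorm (g n - g₀) 2 ^ 2 = ∫⁻ x, ‖g n x - g₀ x‖ₑ ^ 2 := fun n =>
    eLpNorm_two_sq (g n - g₀)
  simp_rw [← e] at h
  exact tendsto_zero_of_sq_tendsto_zero h

lemma aestronglyMeasurable_wmul {w : R3 → ℝ} (hw : Measurable w) {g : R3 → F}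
    (hg : AEStronglyMeasurable g) : AEStronglyMeasurable (wmul w g) :=
  (Complex.measurable_ofReal.comp hw).aestronglyMeasurable.smul hg

lemma norm_wmul (w : R3 → ℝ) (g : R3 → F) (ξ : R3) : ‖wmul w g ξ‖ = |w ξ| * ‖g ξ‖ := by
  simp [wmul, norm_smul]

lemma memLp_wmul {w : R3 → ℝ} (hw : Measurable w) {K : ℝ} (hK : ∀ᵐ ξ, |w ξ| ≤ K) {g : R3 → F}
    (hg : MemLp g 2) : MemLp (wmul w g) 2 := by
  refine hg.of_le_mul (c := K) (aestronglyMeasurable_wmul hw hg.1) ?_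
  filter_upwards [hK] with ξ hξ
  rw [norm_wmul]
  gcongr

lemma norm_toL2_le {g : R3 → F} {h : R3 → F} {K : ℝ} (hg : MemLp g 2)
    (hh : MemLp h 2) (hb : ∀ᵐ ξ, ‖g ξ‖ ≤ K * ‖h ξ‖) : ‖toL2 g‖ ≤ K * ‖toL2 h‖ := by
  refine Lp.norm_le_mul_norm_of_ae_le_mul ?_
  filter_upwards [hb, coeFn_toL2 hg, coeFn_toL2 hh] with ξ h1 h2 h3
  rwa [h2, h3]

/-- Multiplication by a bounded weight, as a bounded operator on `L²`. -/
def mulOp {w : R3 → ℝ} (hw : Measurable w) {K : ℝ} (hK : ∀ ξ, |w ξ| ≤ K) :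
    Lp F 2 (volume : Measure R3) →L[ℂ] Lp F 2 (volume : Measure R3) :=
  LinearMap.mkContinuous
    { toFun := fun g => toL2 (wmul w g)
      map_add' := fun g g' => by
        have h : wmul w (g + g' : Lp F 2 (volume : Measure R3)) =ᵐ[volume]
            wmul w g + wmul w g' := by
          filter_upwards [Lp.coeFn_add g g'] with ξ hξ
          simp only [wmul, hξ, Pi.add_apply, smul_add]
        rw [toL2_congr h, toL2_add (memLp_wmul hw (ae_of_all _ hK) (Lp.memLp g))
          (memLp_wmul hw (ae_of_all _ hK) (Lp.memLp g'))]
      map_smul' := fun c g => by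
        have h : wmul w (c • g : Lp F 2 (volume : Measure R3)) =ᵐ[volume] c • wmul w g := by
          filter_upwards [Lp.coeFn_smul c g] with ξ hξ
          simp [wmul, hξ, smul_comm c]
        rw [toL2_congr h, toL2_smul c (memLp_wmul hw (ae_of_all _ hK) (Lp.memLp g))]
        rfl } K
    fun g => by
      have := norm_toL2_le (K := K) (memLp_wmul hw (ae_of_all _ hK) (Lp.memLp g)) (Lp.memLp g)
        (ae_of_all _ fun ξ => by
          rw [norm_wmul]; exact mul_le_mul_of_nonneg_right (hK ξ) (norm_nonneg _))
      rwa [toL2_coeFn] at this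

lemma coeFn_mulOp {w : R3 → ℝ} (hw : Measurable w) {K : ℝ} (hK : ∀ ξ, |w ξ| ≤ K)
    (g : Lp F 2 (volume : Measure R3)) : mulOp hw hK g =ᵐ[volume] wmul w g :=
  coeFn_toL2 (memLp_wmul hw (ae_of_all _ hK) (Lp.memLp g))

lemma toL2_sub {g g' : R3 → F} (h : MemLp g 2) (h' : MemLp g' 2) :
    toL2 (g - g') = toL2 g - toL2 g' := by
  apply toL2_eq
  filter_upwards [coeFn_toL2 h, coeFn_toL2 h', Lp.coeFn_sub (toL2 g) (toL2 g')] with x h1 h2 h3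
  rw [h3, Pi.sub_apply, Pi.sub_apply, h1, h2]

lemma tendsto_toL2_iff {ι : Type*} {l : Filter ι} {g : ι → R3 → F} {g₀ : R3 → F}
    (hg : ∀ i, MemLp (g i) 2) (hg₀ : MemLp g₀ 2) :
    Tendsto (fun i => toL2 (g i)) l (𝓝 (toL2 g₀)) ↔
      Tendsto (fun i => eLpNorm (g i - g₀) 2) l (𝓝 0) := by
  rw [tendsto_iff_edist_tendsto_0]
  refine tendsto_congr fun i => ?_
  rw [edist_eq_enorm_sub, ← toL2_sub (hg i) hg₀, enorm_toL2 ((hg i).sub hg₀)]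

/-- Strong continuity of multiplication by pointwise convergent, uniformly bounded weights. -/
lemma tendsto_toL2_wmul {ι : Type*} {l : Filter ι} [l.IsCountablyGenerated] {w : ι → R3 → ℝ}
    {w₀ : R3 → ℝ} {K : ℝ} (hw : ∀ i, Measurable (w i)) (hK : ∀ i ξ, |w i ξ| ≤ K)
    (hw₀ : Measurable w₀) (hK₀ : ∀ ξ, |w₀ ξ| ≤ K)
    (hlim : ∀ᵐ ξ, Tendsto (fun i => w i ξ) l (𝓝 (w₀ ξ)))
    {g : ι → Lp F 2 (volume : Measure R3)} {g₀ : Lp F 2 (volume : Measure R3)}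
    (hg : Tendsto g l (𝓝 g₀)) :
    Tendsto (fun i => toL2 (wmul (w i) (g i))) l (𝓝 (toL2 (wmul w₀ g₀))) := by
  have hK0 : 0 ≤ K := (abs_nonneg _).trans (hK₀ 0)
  have h1 : Tendsto (fun i => toL2 (wmul (w i) g₀)) l (𝓝 (toL2 (wmul w₀ g₀))) := by
    rw [tendsto_toL2_iff (fun i => memLp_wmul (hw i) (ae_of_all _ (hK i)) (Lp.memLp g₀))
      (memLp_wmul hw₀ (ae_of_all _ hK₀) (Lp.memLp g₀))]
    refine tendsto_eLpNorm_two_of_dominated (b := fun x => ENNReal.ofReal (2 * K) * ‖g₀ x‖ₑ)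
      (.of_forall fun i => aestronglyMeasurable_wmul (hw i) (Lp.memLp g₀).1)
      (aestronglyMeasurable_wmul hw₀ (Lp.memLp g₀).1) ?_ (.of_forall fun i => ae_of_all _ ?_) ?_
    · simp_rw [mul_pow]
      rw [lintegral_const_mul' _ _ (by finiteness), ← eLpNorm_two_sq]
      exact ENNReal.mul_lt_top (by finiteness) (ENNReal.pow_lt_top (Lp.memLp g₀).2)
    · intro ξ
      have : wmul (w i) g₀ ξ - wmul w₀ g₀ ξ = ((w i ξ - w₀ ξ : ℝ) : ℂ) • g₀ ξ := by
        simp [wmul, sub_smul]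
      rw [this, enorm_smul]
      gcongr
      rw [← ofReal_norm]
      apply ENNReal.ofReal_le_ofReal
      rw [Complex.norm_real, Real.norm_eq_abs]
      have := abs_sub (w i ξ) (w₀ ξ)
      linarith [hK i ξ, hK₀ ξ]
    · filter_upwards [hlim] with ξ hξ
      exact ((Complex.continuous_ofReal.tendsto _).comp hξ).smul_const _
  -- The multipliers converge only strongly, so the variation of `g` is controlled separately,
  -- through their uniform operator bound `K`.
  have h2 : Tendsto (fun i => toL2 (wmul (w i) (g i)) - toL2 (wmul (w i) g₀)) l (𝓝 0) := by
    have h3 (i : ι) : toL2 (wmul (w i) (g i)) - toL2 (wmul (w i) g₀) =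
        mulOp (hw i) (hK i) (g i - g₀) := by
      rw [map_sub]; rfl
    simp_rw [h3]
    have h4 : Tendsto (fun i => K * ‖g i - g₀‖) l (𝓝 0) := by
      have := ((hg.sub_const g₀).norm).const_mul K
      simpa using this
    refine squeeze_zero_norm (fun i => ?_) h4
    exact (ContinuousLinearMap.le_of_opNorm_le _ (LinearMap.mkContinuous_norm_le _ hK0 _) _)
  simpa using h2.add h1

/-- Closedness of multiplication operators: multiplication by a nonnegative weight commutes with
integrals. -/
lemma integral_wmul {α : Type*} [MeasurableSpace α] {μ : Measure α} {w : R3 → ℝ}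
    (hw : Measurable w) (hw0 : ∀ ξ, 0 ≤ w ξ) {f h : α → Lp F 2 (volume : Measure R3)}
    (hf : Integrable f μ) (hh : Integrable h μ)
    (hfh : ∀ᵐ s ∂μ, h s =ᵐ[volume] wmul w (f s)) :
    (∫ s, h s ∂μ : Lp F 2 (volume : Measure R3)) =ᵐ[volume]
      wmul w (∫ s, f s ∂μ : Lp F 2 (volume : Measure R3)) := by
  -- The weight may be unbounded, so multiplication by it cannot simply be moved through the
  -- integral. The identity `(1+w)⁻¹ h = w (1+w)⁻¹ f` involves bounded multipliers only; it is
  -- integrated first and multiplied by `1 + w` pointwise afterwards.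
  have m1 : Measurable fun ξ => (1 + w ξ)⁻¹ := by fun_prop
  have m2 : Measurable fun ξ => w ξ * (1 + w ξ)⁻¹ := by fun_prop
  have b1 : ∀ ξ, |(1 + w ξ)⁻¹| ≤ 1 := fun ξ => by
    have := hw0 ξ
    rw [abs_of_nonneg (by positivity)]
    exact inv_le_one_of_one_le₀ (by linarith)
  have b2 : ∀ ξ, |w ξ * (1 + w ξ)⁻¹| ≤ 1 := fun ξ => by
    have := hw0 ξ
    rw [abs_of_nonneg (by positivity), ← div_eq_mul_inv, div_le_one (by positivity)]
    linarith
  have e : mulOp m1 b1 (∫ s, h s ∂μ) = mulOp m2 b2 (∫ s, f s ∂μ) := by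
    rw [← ContinuousLinearMap.integral_comp_comm _ hf, ← ContinuousLinearMap.integral_comp_comm _ hh]
    refine integral_congr_ae ?_
    filter_upwards [hfh] with s hs
    refine toL2_congr ?_
    filter_upwards [hs] with ξ hξ
    simp only [wmul, hξ, smul_smul]
    congr 1
    push_cast; ring
  filter_upwards [coeFn_mulOp m1 b1 (∫ s, h s ∂μ), coeFn_mulOp m2 b2 (∫ s, f s ∂μ)] with ξ h1 h2
  rw [e, h2] at h1
  have h0 := hw0 ξ
  have h3 : ((1 + w ξ : ℝ) : ℂ) ≠ 0 := by
    exact_mod_cast (by positivity : (1 + w ξ) ≠ 0)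
  have h4 := congrArg (fun v => ((1 + w ξ : ℝ) : ℂ) • v) h1
  simp only [wmul, smul_smul] at h4 ⊢
  push_cast at h3 h4
  rw [mul_inv_cancel₀ h3, one_smul] at h4
  rw [← h4]
  congr 1
  field_simp

end MildNS
end

noncomputable section

namespace MildNS

set_option linter.unusedSectionVars false

open Filter Topology
open scoped Convolution

variable {F : Type*} [NormedAddCommGroup F] [InnerProductSpace ℂ F] [CompleteSpace F]

/-! ### Functions whose Fourier transform is weighted square integrable -/

lemma expPow_zero_left (σ : ℝ) (ξ : R3) : expPow 0 σ ξ = symA ξ ^ σ := by simp [expPow]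

lemma enorm_wmul_expPow_zero (σ : ℝ) (p : R3 → F) (ξ : R3) :
    ‖wmul (expPow 0 σ) p ξ‖ₑ = symPow σ ξ * ‖p ξ‖ₑ := by
  rw [wmul, enorm_smul, expPow_zero_left, symPow]
  congr 1
  rw [← ofReal_norm, Complex.norm_real, Real.norm_of_nonneg (Real.rpow_nonneg (symA_nonneg ξ) _)]

lemma aestronglyMeasurable_of_wmul {σ : ℝ} {p : R3 → F}
    (hp : MemLp (wmul (expPow 0 σ) p) 2) : AEStronglyMeasurable p := by
  have h := aestronglyMeasurable_wmul (measurable_expPow 0 (-σ)) hp.1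
  refine h.congr ?_
  filter_upwards [ae_symA_pos] with ξ hξ
  simp only [wmul, smul_smul, expPow_zero_left, ← Complex.ofReal_mul, ← Real.rpow_add hξ]
  simp

/-- The low frequency part of a function. -/
def low (r : ℝ) (p : R3 → F) : R3 → F := {ξ : R3 | symA ξ ≤ r}.indicator p

lemma norm_low_le (r : ℝ) (p : R3 → F) (ξ : R3) : ‖low r p ξ‖ ≤ ‖p ξ‖ :=
  norm_indicator_le_norm_self _ _

lemma enorm_low_le (r : ℝ) (p : R3 → F) (ξ : R3) : ‖low r p ξ‖ₑ ≤ ‖p ξ‖ₑ :=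
  enorm_indicator_le_enorm_self _ _

lemma tendsto_low (p : R3 → F) (ξ : R3) :
    Tendsto (fun n : ℕ => low (n + 1) p ξ) atTop (𝓝 (p ξ)) := by
  refine tendsto_const_nhds.congr' ?_
  obtain ⟨N, hN⟩ := exists_nat_gt (symA ξ)
  filter_upwards [eventually_ge_atTop N] with n hn
  have h1 : (N : ℝ) ≤ n := by exact_mod_cast hn
  have : ξ ∈ {ξ : R3 | symA ξ ≤ (n + 1 : ℝ)} := by
    change symA ξ ≤ (n + 1 : ℝ); linarith
  rw [low, indicator_of_mem this]

/-- Cauchy-Schwarz against `A^{-σ}`, which is square integrable over `{A ≤ r}` because `2σ < 3`. -/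
lemma integrable_low {σ : ℝ} (hσ : σ < 3 / 2) {p : R3 → F}
    (hp : MemLp (wmul (expPow 0 σ) p) 2) {r : ℝ} (hr : 0 < r) : Integrable (low r p) := by
  have hm := aestronglyMeasurable_of_wmul hp
  have hs := measurableSet_symA_le r
  refine ⟨hm.indicator hs, ?_⟩
  rw [hasFiniteIntegral_iff_enorm]
  have e : ∫⁻ ξ, ‖low r p ξ‖ₑ =
      ∫⁻ ξ, {ξ : R3 | symA ξ ≤ r}.indicator (symPow (-σ)) ξ * ‖wmul (expPow 0 σ) p ξ‖ₑ := by
    refine lintegral_congr_ae ?_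
    filter_upwards [ae_symA_pos] with ξ hξ
    rw [enorm_wmul_expPow_zero]
    by_cases h : ξ ∈ {ξ : R3 | symA ξ ≤ r}
    · rw [low, indicator_of_mem h, indicator_of_mem h, ← mul_assoc, symPow_mul hξ]
      simp [symPow_zero]
    · rw [low, indicator_of_notMem h, indicator_of_notMem h]; simp
  have h2 := lintegral_mul_sq_le (μ := (volume : Measure R3))
    ((measurable_symPow (-σ)).indicator hs).aemeasurable hp.1.enorm
  rw [← e, ← eLpNorm_two_sq] at h2
  have h3 : ∫⁻ a, {ξ : R3 | symA ξ ≤ r}.indicator (symPow (-σ)) a ^ 2 < ∞ := by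
    have : ∫⁻ a, {ξ : R3 | symA ξ ≤ r}.indicator (symPow (-σ)) a ^ 2 =
        ∫⁻ a in {ξ : R3 | symA ξ ≤ r}, symPow (-(2 * σ)) a := by
      rw [← lintegral_indicator hs]
      refine lintegral_congr_ae ?_
      filter_upwards [ae_symA_pos] with ξ hξ
      by_cases h : ξ ∈ {ξ : R3 | symA ξ ≤ r}
      · rw [indicator_of_mem h, indicator_of_mem h, sq, symPow_mul hξ]
        congr 1; ring
      · rw [indicator_of_notMem h, indicator_of_notMem h]; simp
    rw [this, lintegral_symA_le hr]
    exact ENNReal.mul_lt_top (by simp) (unitIntegral_lt_top (by linarith))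
  by_contra h
  rw [not_lt, top_le_iff] at h
  rw [h] at h2
  have := h2.trans_lt (ENNReal.mul_lt_top h3 (ENNReal.pow_lt_top hp.2))
  simp at this

/-- On the high frequencies `A^σ ≥ 1`. Together with `integrable_low` this decomposes `p` into an
integrable and a square integrable function, both of which have a usable inverse Fourier transform.
-/
lemma memLp_sub_low {σ : ℝ} (hσ : 0 ≤ σ) {p : R3 → F}
    (hp : MemLp (wmul (expPow 0 σ) p) 2) {r : ℝ} (hr : 1 ≤ r) : MemLp (p - low r p) 2 := by
  have hm := aestronglyMeasurable_of_wmul hp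
  refine hp.mono (hm.sub (hm.indicator (measurableSet_symA_le r))) (ae_of_all _ fun ξ => ?_)
  by_cases h : ξ ∈ {ξ : R3 | symA ξ ≤ r}
  · simp only [Pi.sub_apply, low, indicator_of_mem h]; simp
  · simp only [Pi.sub_apply, low, indicator_of_notMem h, sub_zero]
    rw [norm_wmul, expPow_zero_left]
    have h1 : r < symA ξ := not_le.1 h
    have : 1 ≤ symA ξ ^ σ := Real.one_le_rpow (by linarith) hσ
    rw [abs_of_nonneg (by linarith)]
    nlinarith [norm_nonneg (p ξ)]

lemma tendsto_eLpNorm_sub_low {σ : ℝ} (hσ : 0 ≤ σ) {p : R3 → F}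
    (hp : MemLp (wmul (expPow 0 σ) p) 2) :
    Tendsto (fun n : ℕ => eLpNorm (p - low (n + 1) p) 2) atTop (𝓝 0) := by
  have hm := aestronglyMeasurable_of_wmul hp
  have h := tendsto_eLpNorm_two_of_dominated (l := atTop)
    (g := fun n : ℕ => p - low (n + 1) p) (g₀ := 0) (b := fun ξ => ‖wmul (expPow 0 σ) p ξ‖ₑ)
    (.of_forall fun n => hm.sub (hm.indicator (measurableSet_symA_le _)))
    aestronglyMeasurable_zero (by rw [← eLpNorm_two_sq]; exact ENNReal.pow_lt_top hp.2)
    (.of_forall fun n => ae_of_all _ fun ξ => ?_) (ae_of_all _ fun ξ => ?_)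
  · simpa using h
  · simp only [Pi.sub_apply, Pi.zero_apply, sub_zero]
    rw [enorm_wmul_expPow_zero]
    by_cases h : ξ ∈ {ξ : R3 | symA ξ ≤ (n + 1 : ℝ)}
    · simp only [low, indicator_of_mem h]; simp
    · simp only [low, indicator_of_notMem h, sub_zero]
      have h1 : (n + 1 : ℝ) < symA ξ := not_le.1 h
      have : 1 ≤ symA ξ ^ σ := Real.one_le_rpow (by have := n.cast_nonneg (α := ℝ); linarith) hσ
      calc ‖p ξ‖ₑ = 1 * ‖p ξ‖ₑ := (one_mul _).symm
        _ ≤ _ := by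
          gcongr
          rw [symPow, ← ENNReal.ofReal_one]
          exact ENNReal.ofReal_le_ofReal this
  · have := (tendsto_low p ξ).const_sub (p ξ)
    simpa using this

lemma continuous_fourierInv {p : R3 → F} (hp : Integrable p) : Continuous (𝓕⁻ p) :=
  VectorFourier.fourierIntegral_continuous (L := -innerₗ R3) Real.continuous_fourierChar
    (by simp only [LinearMap.neg_apply, innerₗ_apply_apply]; fun_prop) hp

lemma norm_fourierInv_le {p : R3 → F} (x : R3) : ‖𝓕⁻ p x‖ ≤ ∫ ξ, ‖p ξ‖ :=
  VectorFourier.norm_fourierIntegral_le_integral_norm _ _ _ _ _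

lemma integral_fourierInv_smul {φ : R3 → ℂ} {p : R3 → F} (hφ : Integrable φ) (hp : Integrable p) :
    ∫ ξ, 𝓕⁻ φ ξ • p ξ = ∫ x, φ x • 𝓕⁻ p x := by
  have h := VectorFourier.integral_fourierIntegral_smul_eq_flip (μ := (volume : Measure R3))
    (ν := (volume : Measure R3)) (L := -innerₗ R3) Real.continuous_fourierChar
    (by simp only [LinearMap.neg_apply, innerₗ_apply_apply]; fun_prop) hφ hp
  have hL : (-innerₗ R3).flip = -innerₗ R3 := by
    ext x y; simp [real_inner_comm]
  rw [hL] at h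
  exact h

lemma isRepresentedBy_fourierInv_of_integrable {f : 𝓢'(R3, F)} {p : R3 → F} (hp : Integrable p)
    (h : IsRepresentedBy (𝓕 f) p) : IsRepresentedBy f (𝓕⁻ p) := by
  intro φ
  constructor
  · refine (φ.integrable (μ := volume)).smul_bdd (∫ ξ, ‖p ξ‖)
      (continuous_fourierInv hp).aestronglyMeasurable ?_
    exact ae_of_all _ fun x => norm_fourierInv_le x
  · have h1 : f φ = (𝓕 f : 𝓢'(R3, F)) (𝓕⁻ φ : 𝓢(R3, ℂ)) := by
      rw [TemperedDistribution.fourier_apply, FourierTransform.fourier_fourierInv_eq]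
    rw [h1, (h _).2, SchwartzMap.fourierInv_coe, integral_fourierInv_smul φ.integrable hp]

lemma fourier_rep_of_integrable {p : R3 → F} (hp : Integrable p) :
    ∃ f : 𝓢'(R3, F), IsRepresentedBy (𝓕 f) p := by
  refine ⟨𝓕⁻ (Lp.toTemperedDistribution ((memLp_one_iff_integrable.2 hp).toLp p)), ?_⟩
  rw [FourierTransform.fourier_fourierInv_eq]
  exact isRepresentedBy_of_memLp (memLp_one_iff_integrable.2 hp)

lemma fourier_rep_of_memLp {p : R3 → F} (hp : MemLp p 2) :
    IsRepresentedBy (𝓕 (Lp.toTemperedDistribution (𝓕⁻ (toL2 p) : Lp F 2 (volume : Measure R3)))) p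
    := by
  refine (fourier_toTD _).congr ?_
  rw [FourierTransform.fourier_fourierInv_eq]
  exact coeFn_toL2 hp

lemma exists_fourier_rep_add {p₁ p₂ : R3 → F} (h₁ : Integrable p₁) (h₂ : MemLp p₂ 2) :
    ∃ f : 𝓢'(R3, F), IsRepresentedBy (𝓕 f) (p₁ + p₂) := by
  obtain ⟨f, hf⟩ := fourier_rep_of_integrable h₁
  refine ⟨f + Lp.toTemperedDistribution (𝓕⁻ (toL2 p₂) : Lp F 2 (volume : Measure R3)), ?_⟩
  rw [FourierTransform.fourier_add]
  exact hf.add (fourier_rep_of_memLp h₂)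

lemma isRepresentedBy_fourierInv_add {f : 𝓢'(R3, F)} {p₁ p₂ : R3 → F} (h₁ : Integrable p₁)
    (h₂ : MemLp p₂ 2) (h : IsRepresentedBy (𝓕 f) (p₁ + p₂)) :
    IsRepresentedBy f (𝓕⁻ p₁ + (𝓕⁻ (toL2 p₂) : Lp F 2 (volume : Measure R3))) := by
  obtain ⟨f₁, hf₁⟩ := fourier_rep_of_integrable h₁
  have e : f = f₁ + Lp.toTemperedDistribution (𝓕⁻ (toL2 p₂) : Lp F 2 (volume : Measure R3)) := by
    refine eq_of_fourier_rep h ?_ (EventuallyEq.refl _ _)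
    rw [FourierTransform.fourier_add]
    exact hf₁.add (fourier_rep_of_memLp h₂)
  rw [e]
  exact (isRepresentedBy_fourierInv_of_integrable h₁ hf₁).add
    (isRepresentedBy_toTemperedDistribution _)

/-- The integral inverse transform and the one defined on `L²` represent the same tempered
distribution, hence agree almost everywhere. -/
lemma fourierInv_ae_eq {p : R3 → F} (h₁ : Integrable p) (h₂ : MemLp p 2) :
    𝓕⁻ p =ᵐ[volume] (𝓕⁻ (toL2 p) : Lp F 2 (volume : Measure R3)) :=
  (isRepresentedBy_fourierInv_of_integrable h₁ (fourier_rep_of_memLp h₂)).ae_eq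
    (isRepresentedBy_toTemperedDistribution _)

lemma low_add_sub (r : ℝ) (p : R3 → F) : low r p + (p - low r p) = p := by abel

/-- A function `p` with `A^σ p ∈ L²`, `0 ≤ σ < 3/2`, is the Fourier transform of a tempered
distribution. -/
lemma exists_fourier_rep {σ : ℝ} (hσ₀ : 0 ≤ σ) (hσ : σ < 3 / 2) {p : R3 → F}
    (hp : MemLp (wmul (expPow 0 σ) p) 2) : ∃ f : 𝓢'(R3, F), IsRepresentedBy (𝓕 f) p := by
  have := exists_fourier_rep_add (integrable_low hσ hp one_pos) (memLp_sub_low hσ₀ hp le_rfl)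
  rwa [low_add_sub] at this

section physical

variable {f : 𝓢'(R3, F)} {σ : ℝ} {p : R3 → F}

lemma exists_rep_of_fourier_rep (hσ₀ : 0 ≤ σ) (hσ : σ < 3 / 2)
    (hp : MemLp (wmul (expPow 0 σ) p) 2) (h : IsRepresentedBy (𝓕 f) p) :
    ∃ g, IsRepresentedBy f g := by
  rw [← low_add_sub 1 p] at h
  exact ⟨_, isRepresentedBy_fourierInv_add (integrable_low hσ hp one_pos)
    (memLp_sub_low hσ₀ hp le_rfl) h⟩

/-- The error is the `L²` inverse transform of the high frequency part, whose norm tends to zero.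
Neither the cutoffs nor the limit need lie in `L²`; convergence in measure is enough to extract
almost everywhere convergent subsequences. -/
lemma tendstoInMeasure_fourierInv_low (hσ₀ : 0 ≤ σ) (hσ : σ < 3 / 2)
    (hp : MemLp (wmul (expPow 0 σ) p) 2) (h : IsRepresentedBy (𝓕 f) p) :
    TendstoInMeasure volume (fun n : ℕ => 𝓕⁻ (low (n + 1) p)) atTop (funRep f) := by
  have hpos (n : ℕ) : (0 : ℝ) < n + 1 := by positivity
  have hone (n : ℕ) : (1 : ℝ) ≤ n + 1 := by linarith [n.cast_nonneg (α := ℝ)]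
  have hr := isRepresentedBy_funRep (exists_rep_of_fourier_rep hσ₀ hσ hp h)
  refine tendstoInMeasure_of_tendsto_eLpNorm (p := 2) (by simp)
    (fun n => (continuous_fourierInv (integrable_low hσ hp (hpos n))).aestronglyMeasurable)
    hr.aestronglyMeasurable ?_
  refine (tendsto_eLpNorm_sub_low hσ₀ hp).congr fun n => ?_
  have h' := h
  rw [← low_add_sub (n + 1) p] at h'
  have h1 := hr.ae_eq (isRepresentedBy_fourierInv_add (integrable_low hσ hp (hpos n))
    (memLp_sub_low hσ₀ hp (hone n)) h')
  have h2 : 𝓕⁻ (low (n + 1) p) - funRep f =ᵐ[volume]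
      -((𝓕⁻ (toL2 (p - low (n + 1) p)) : Lp F 2 (volume : Measure R3)) : R3 → F) := by
    filter_upwards [h1] with x hx
    simp [hx]
  rw [eLpNorm_congr_ae h2, eLpNorm_neg, ← Lp.enorm_def, ← enorm_toL2 (memLp_sub_low hσ₀ hp (hone n)),
    ← ofReal_norm, ← ofReal_norm, norm_fourierInv]

end physical

/-! ### The Fourier transform of a product -/

variable {F₁ F₂ : Type*} [NormedAddCommGroup F₁] [InnerProductSpace ℂ F₁] [CompleteSpace F₁]
  [NormedAddCommGroup F₂] [InnerProductSpace ℂ F₂] [CompleteSpace F₂]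

/-- The convolution of the norms of two functions. -/
def normConv (p : R3 → F₁) (q : R3 → F₂) (ξ : R3) : ℝ≥0∞ := ∫⁻ η, ‖p η‖ₑ * ‖q (ξ - η)‖ₑ

lemma aestronglyMeasurable_comp_sub {E : Type*} [TopologicalSpace E] {g : R3 → E}
    (hg : AEStronglyMeasurable g) (ξ : R3) : AEStronglyMeasurable fun η => g (ξ - η) :=
  hg.comp_quasiMeasurePreserving (quasiMeasurePreserving_sub_left volume ξ)

lemma lintegral_conv_sq_le' {f g : R3 → ℝ≥0∞} (hf : AEMeasurable f) (hg : AEMeasurable g) :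
    ∫⁻ ξ, (∫⁻ η, f η * g (ξ - η)) ^ 2 ≤
      convConst * (∫⁻ a, (symPow (5 / 4) a * f a) ^ 2) * ∫⁻ b, (symPow (1 / 4) b * g b) ^ 2 := by
  have h := lintegral_conv_sq_le hf.measurable_mk hg.measurable_mk
  have e1 : ∫⁻ ξ, (∫⁻ η, f η * g (ξ - η)) ^ 2 = ∫⁻ ξ, (∫⁻ η, hf.mk f η * hg.mk g (ξ - η)) ^ 2 := by
    refine lintegral_congr fun ξ => ?_
    congr 1
    refine lintegral_congr_ae ?_
    filter_upwards [hf.ae_eq_mk,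
      (quasiMeasurePreserving_sub_left volume ξ).ae hg.ae_eq_mk] with η h1 h2
    rw [h1, h2]
  have e2 : ∫⁻ a, (symPow (5 / 4) a * f a) ^ 2 = ∫⁻ a, (symPow (5 / 4) a * hf.mk f a) ^ 2 :=
    lintegral_congr_ae (by filter_upwards [hf.ae_eq_mk] with η h1; rw [h1])
  have e3 : ∫⁻ a, (symPow (1 / 4) a * g a) ^ 2 = ∫⁻ a, (symPow (1 / 4) a * hg.mk g a) ^ 2 :=
    lintegral_congr_ae (by filter_upwards [hg.ae_eq_mk] with η h1; rw [h1])
  rw [e1, e2, e3]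
  exact h

lemma lintegral_normConv_sq_lt_top {p : R3 → F₁} {q : R3 → F₂}
    (hp : MemLp (wmul (expPow 0 (5 / 4)) p) 2) (hq : MemLp (wmul (expPow 0 (1 / 4)) q) 2) :
    ∫⁻ ξ, normConv p q ξ ^ 2 < ∞ := by
  refine (lintegral_conv_sq_le' (aestronglyMeasurable_of_wmul hp).enorm
    (aestronglyMeasurable_of_wmul hq).enorm).trans_lt ?_
  simp_rw [← enorm_wmul_expPow_zero]
  rw [← eLpNorm_two_sq, ← eLpNorm_two_sq]
  exact ENNReal.mul_lt_top (ENNReal.mul_lt_top convConst_lt_top (ENNReal.pow_lt_top hp.2))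
    (ENNReal.pow_lt_top hq.2)

lemma aestronglyMeasurable_conv (B : F₁ →L[ℂ] F₂ →L[ℂ] F) {p : R3 → F₁} {q : R3 → F₂}
    (hp : AEStronglyMeasurable p) (hq : AEStronglyMeasurable q) :
    AEStronglyMeasurable (p ⋆[B] q) :=
  (hp.convolution_integrand B hq (μ := volume)).integral_prod_right'

lemma enorm_conv_le (B : F₁ →L[ℂ] F₂ →L[ℂ] F) {p : R3 → F₁} {q : R3 → F₂} (ξ : R3) :
    ‖(p ⋆[B] q) ξ‖ₑ ≤ ‖B‖ₑ * normConv p q ξ := by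
  refine (enorm_integral_le_lintegral_enorm _).trans ?_
  rw [normConv, ← lintegral_const_mul' _ _ enorm_ne_top]
  refine lintegral_mono fun η => ?_
  simp only [← ofReal_norm]
  rw [← ENNReal.ofReal_mul (norm_nonneg _), ← ENNReal.ofReal_mul (norm_nonneg _)]
  apply ENNReal.ofReal_le_ofReal
  rw [← mul_assoc]
  exact B.le_opNorm₂ _ _

lemma memLp_conv (B : F₁ →L[ℂ] F₂ →L[ℂ] F) {p : R3 → F₁} {q : R3 → F₂}
    (hp : MemLp (wmul (expPow 0 (5 / 4)) p) 2) (hq : MemLp (wmul (expPow 0 (1 / 4)) q) 2) :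
    MemLp (p ⋆[B] q) 2 := by
  refine memLp_two_of_lintegral (aestronglyMeasurable_conv B (aestronglyMeasurable_of_wmul hp)
    (aestronglyMeasurable_of_wmul hq)) ?_
  calc ∫⁻ ξ, ‖(p ⋆[B] q) ξ‖ₑ ^ 2 ≤ ∫⁻ ξ, ‖B‖ₑ ^ 2 * normConv p q ξ ^ 2 := by
        refine lintegral_mono fun ξ => ?_
        rw [← mul_pow]
        exact pow_le_pow_left₀ zero_le (enorm_conv_le B ξ) 2
    _ < ∞ := by
        rw [lintegral_const_mul' _ _ (by finiteness)]
        exact ENNReal.mul_lt_top (by finiteness) (lintegral_normConv_sq_lt_top hp hq)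

lemma normConv_low_le (r : ℝ) (p : R3 → F₁) (q : R3 → F₂) (ξ : R3) :
    normConv (low r p) (low r q) ξ ≤ normConv p q ξ :=
  lintegral_mono fun _ => mul_le_mul' (enorm_low_le _ _ _) (enorm_low_le _ _ _)

lemma tendsto_conv_low (B : F₁ →L[ℂ] F₂ →L[ℂ] F) {p : R3 → F₁} {q : R3 → F₂}
    (hp : AEStronglyMeasurable p) (hq : AEStronglyMeasurable q) {ξ : R3}
    (hξ : normConv p q ξ < ∞) :
    Tendsto (fun n : ℕ => (low (n + 1) p ⋆[B] low (n + 1) q) ξ) atTop (𝓝 ((p ⋆[B] q) ξ)) := by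
  refine tendsto_integral_of_dominated_convergence (fun η => ‖B‖ * (‖p η‖ * ‖q (ξ - η)‖))
    (fun n => ?_) ?_ (fun n => ae_of_all _ fun η => ?_) (ae_of_all _ fun η => ?_)
  · exact B.aestronglyMeasurable_comp₂ (hp.indicator (measurableSet_symA_le _))
      (aestronglyMeasurable_comp_sub (hq.indicator (measurableSet_symA_le _)) ξ)
  · refine Integrable.const_mul ⟨hp.norm.mul (aestronglyMeasurable_comp_sub hq ξ).norm, ?_⟩ _
    rw [hasFiniteIntegral_iff_enorm]
    simpa [enorm_mul, normConv] using hξ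
  · refine (B.le_opNorm₂ _ _).trans ?_
    rw [mul_assoc]
    gcongr
    · exact norm_low_le _ _ _
    · exact norm_low_le _ _ _
  · exact (B.continuous₂.tendsto (p η, q (ξ - η))).comp
      ((tendsto_low p η).prodMk_nhds (tendsto_low q (ξ - η)))

lemma integrable_conv_low (B : F₁ →L[ℂ] F₂ →L[ℂ] F) {p : R3 → F₁} {q : R3 → F₂}
    (hp : MemLp (wmul (expPow 0 (5 / 4)) p) 2) (hq : MemLp (wmul (expPow 0 (1 / 4)) q) 2) {r : ℝ}
    (hr : 0 < r) : Integrable (low r p ⋆[B] low r q) :=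
  (integrable_low (by norm_num) hp hr).integrable_convolution B
    (integrable_low (by norm_num) hq hr)

lemma memLp_wmul_low {σ r : ℝ} {p : R3 → F} (hp : MemLp (wmul (expPow 0 σ) p) 2) :
    MemLp (wmul (expPow 0 σ) (low r p)) 2 := by
  have e : wmul (expPow 0 σ) (low r p) = {ξ : R3 | symA ξ ≤ r}.indicator (wmul (expPow 0 σ) p) := by
    ext1 ξ
    by_cases h : ξ ∈ {ξ : R3 | symA ξ ≤ r}
    · simp only [wmul, low, indicator_of_mem h]
    · simp only [wmul, low, indicator_of_notMem h, smul_zero]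
  rw [e]
  exact hp.indicator (measurableSet_symA_le r)

lemma memLp_conv_low (B : F₁ →L[ℂ] F₂ →L[ℂ] F) {p : R3 → F₁} {q : R3 → F₂}
    (hp : MemLp (wmul (expPow 0 (5 / 4)) p) 2) (hq : MemLp (wmul (expPow 0 (1 / 4)) q) 2) {r : ℝ} :
    MemLp (low r p ⋆[B] low r q) 2 := by
  exact memLp_conv B (memLp_wmul_low hp) (memLp_wmul_low hq)

lemma tendsto_eLpNorm_conv_low (B : F₁ →L[ℂ] F₂ →L[ℂ] F) {p : R3 → F₁} {q : R3 → F₂}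
    (hp : MemLp (wmul (expPow 0 (5 / 4)) p) 2) (hq : MemLp (wmul (expPow 0 (1 / 4)) q) 2) :
    Tendsto (fun n : ℕ => eLpNorm ((low (n + 1) p ⋆[B] low (n + 1) q) - (p ⋆[B] q)) 2) atTop
      (𝓝 0) := by
  have hpm := aestronglyMeasurable_of_wmul hp
  have hqm := aestronglyMeasurable_of_wmul hq
  have hfin := lintegral_normConv_sq_lt_top hp hq
  have hnm : AEMeasurable (normConv p q) := by
    have := (hpm.norm.convolution_integrand (ContinuousLinearMap.mul ℝ ℝ) hqm.norm
      (μ := volume)).enorm.lintegral_prod_right'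
    change AEMeasurable (fun ξ => ∫⁻ η, ‖p η‖ₑ * ‖q (ξ - η)‖ₑ) volume
    simpa [enorm_mul] using this
  refine tendsto_eLpNorm_two_of_dominated (b := fun ξ => 2 * ‖B‖ₑ * normConv p q ξ)
    (.of_forall fun n => (memLp_conv_low B hp hq).1) (memLp_conv B hp hq).1 ?_
    (.of_forall fun n => ae_of_all _ fun ξ => ?_) ?_
  · simp_rw [mul_pow _ (normConv p q _)]
    rw [lintegral_const_mul' _ _ (by finiteness)]
    exact ENNReal.mul_lt_top (by finiteness) hfin
  · refine (enorm_sub_le).trans ?_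
    rw [mul_assoc, two_mul]
    refine add_le_add ((enorm_conv_le B ξ).trans ?_) (enorm_conv_le B ξ)
    gcongr
    exact normConv_low_le _ _ _ _
  · have h1 : ∀ᵐ ξ, normConv p q ξ ^ 2 < ∞ := ae_lt_top' (hnm.pow_const 2) hfin.ne
    filter_upwards [h1] with ξ hξ
    exact tendsto_conv_low B hpm hqm (by
      by_contra h
      rw [not_lt, top_le_iff] at h
      simp [h] at hξ)

/-- The product of functions with Fourier transforms `p` and `q` is square integrable, with Fourier
transform the convolution of `p` and `q`. -/
theorem bilin_funRep_ae_eq (B : F₁ →L[ℂ] F₂ →L[ℂ] F) {f₁ : 𝓢'(R3, F₁)} {f₂ : 𝓢'(R3, F₂)}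
    {p : R3 → F₁} {q : R3 → F₂} (h₁ : IsRepresentedBy (𝓕 f₁) p) (h₂ : IsRepresentedBy (𝓕 f₂) q)
    (hp : MemLp (wmul (expPow 0 (5 / 4)) p) 2) (hq : MemLp (wmul (expPow 0 (1 / 4)) q) 2) :
    (fun x => B (funRep f₁ x) (funRep f₂ x)) =ᵐ[volume]
      (𝓕⁻ (toL2 (p ⋆[B] q)) : Lp F 2 (volume : Measure R3)) := by
  have hpos (n : ℕ) : (0 : ℝ) < n + 1 := by positivity
  -- Three nested subsequences give almost everywhere convergence of both factors and of the inverse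
  -- transform of the convolution along one sequence of cutoffs. At each cutoff the functions are
  -- integrable and the classical convolution theorem applies.
  obtain ⟨s₁, hs₁, l₁⟩ := (tendstoInMeasure_fourierInv_low (by norm_num) (by norm_num) hp
    h₁).exists_seq_tendsto_ae
  have t₂ := (tendstoInMeasure_fourierInv_low (by norm_num) (by norm_num) hq h₂)
  obtain ⟨s₂, hs₂, l₂⟩ := TendstoInMeasure.exists_seq_tendsto_ae
    (f := fun n : ℕ => 𝓕⁻ (low ((s₁ n : ℕ) + 1 : ℝ) q)) (fun ε hε => (t₂ ε hε).comp hs₁.tendsto_atTop)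
  have t₃ : TendstoInMeasure volume (fun n : ℕ => ((𝓕⁻ (toL2 (low (n + 1) p ⋆[B] low (n + 1) q)) :
      Lp F 2 (volume : Measure R3)) : R3 → F)) atTop
      (𝓕⁻ (toL2 (p ⋆[B] q)) : Lp F 2 (volume : Measure R3)) := by
    refine tendstoInMeasure_of_tendsto_Lp (p := 2) ?_
    have h := (tendsto_toL2_iff (fun n : ℕ => memLp_conv_low B hp hq (r := n + 1))
      (memLp_conv B hp hq)).2 (tendsto_eLpNorm_conv_low B hp hq)
    exact ((Lp.fourierTransformₗᵢ R3 F).symm.continuous.tendsto _).comp h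
  obtain ⟨s₃, hs₃, l₃⟩ := TendstoInMeasure.exists_seq_tendsto_ae
    (f := fun n : ℕ => ((𝓕⁻ (toL2 (low ((s₁ (s₂ n) : ℕ) + 1 : ℝ) p ⋆[B]
      low ((s₁ (s₂ n) : ℕ) + 1 : ℝ) q)) : Lp F 2 (volume : Measure R3)) : R3 → F))
    (fun ε hε => (t₃ ε hε).comp (hs₁.comp hs₂).tendsto_atTop)
  have e : ∀ᵐ x, ∀ n : ℕ, ((𝓕⁻ (toL2 (low (n + 1) p ⋆[B] low (n + 1) q)) :
      Lp F 2 (volume : Measure R3)) : R3 → F) x =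
      B (𝓕⁻ (low (n + 1) p) x) (𝓕⁻ (low (n + 1) q) x) := by
    rw [ae_all_iff]
    intro n
    filter_upwards [fourierInv_ae_eq (integrable_conv_low B hp hq (hpos n))
      (memLp_conv_low B hp hq)] with x hx
    rw [← hx, Real.fourierInv_eq_fourier_neg, Real.fourierInv_eq_fourier_neg,
      Real.fourierInv_eq_fourier_neg, Real.fourier_bilin_convolution_eq B
      (integrable_low (by norm_num) hp (hpos n)) (integrable_low (by norm_num) hq (hpos n))]
  filter_upwards [l₁, l₂, l₃, e] with x h1 h2 h3 h4
  have h5 := (B.continuous₂.tendsto (funRep f₁ x, funRep f₂ x)).comp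
    ((h1.comp (hs₂.comp hs₃).tendsto_atTop).prodMk_nhds (h2.comp hs₃.tendsto_atTop))
  refine tendsto_nhds_unique (h5.congr fun n => ?_) h3
  rw [h4]
  rfl

end MildNS
end

noncomputable section

namespace MildNS

set_option linter.unusedSectionVars false

open Filter Topology
open scoped Convolution

variable {F : Type*} [NormedAddCommGroup F] [InnerProductSpace ℂ F] [CompleteSpace F]
variable {F₁ F₂ : Type*} [NormedAddCommGroup F₁] [InnerProductSpace ℂ F₁] [CompleteSpace F₁]
  [NormedAddCommGroup F₂] [InnerProductSpace ℂ F₂] [CompleteSpace F₂]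

/-! ### The convection term -/

lemma convolutionExistsAt_of_normConv (B : F₁ →L[ℂ] F₂ →L[ℂ] F) {p : R3 → F₁} {q : R3 → F₂}
    (hp : AEStronglyMeasurable p) (hq : AEStronglyMeasurable q) {ξ : R3}
    (hξ : normConv p q ξ < ∞) : ConvolutionExistsAt p q ξ B volume := by
  refine ⟨B.aestronglyMeasurable_comp₂ hp (aestronglyMeasurable_comp_sub hq ξ), ?_⟩
  rw [hasFiniteIntegral_iff_enorm]
  refine lt_of_le_of_lt (b := ‖B‖ₑ * normConv p q ξ) ?_ (ENNReal.mul_lt_top enorm_lt_top hξ)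
  rw [normConv, ← lintegral_const_mul' _ _ enorm_ne_top]
  refine lintegral_mono fun η => ?_
  simp only [← ofReal_norm]
  rw [← ENNReal.ofReal_mul (norm_nonneg _), ← ENNReal.ofReal_mul (norm_nonneg _)]
  apply ENNReal.ofReal_le_ofReal
  rw [← mul_assoc]
  exact B.le_opNorm₂ _ _

lemma aemeasurable_normConv {p : R3 → F₁} {q : R3 → F₂} (hp : AEStronglyMeasurable p)
    (hq : AEStronglyMeasurable q) : AEMeasurable (normConv p q) := by
  have := (hp.norm.convolution_integrand (ContinuousLinearMap.mul ℝ ℝ) hq.norm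
    (μ := volume)).enorm.lintegral_prod_right'
  change AEMeasurable (fun ξ => ∫⁻ η, ‖p η‖ₑ * ‖q (ξ - η)‖ₑ) volume
  simpa [enorm_mul] using this

/-- A Bochner convolution takes the value zero at points where its integrand is not integrable, so
additivity is available only where both integrals exist; the convolution of the norms is square
integrable, hence finite almost everywhere. -/
lemma ae_convolutionExistsAt (B : F₁ →L[ℂ] F₂ →L[ℂ] F) {p : R3 → F₁} {q : R3 → F₂}
    (hp : MemLp (wmul (expPow 0 (5 / 4)) p) 2) (hq : MemLp (wmul (expPow 0 (1 / 4)) q) 2) :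
    ∀ᵐ ξ, ConvolutionExistsAt p q ξ B volume := by
  have hpm := aestronglyMeasurable_of_wmul hp
  have hqm := aestronglyMeasurable_of_wmul hq
  filter_upwards [ae_lt_top' ((aemeasurable_normConv hpm hqm).pow_const 2)
    (lintegral_normConv_sq_lt_top hp hq).ne] with ξ hξ
  refine convolutionExistsAt_of_normConv B hpm hqm ?_
  by_contra h
  rw [not_lt, top_le_iff] at h
  simp [h] at hξ

/-- The bilinear map `(a, b) ↦ (M a)ⱼ b`. -/
def convBilin (M : Matrix (Fin 3) (Fin 3) ℝ) (j : Fin 3) : C3 →L[ℂ] C3 →L[ℂ] C3 :=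
  (ContinuousLinearMap.lsmul ℂ ℂ).comp
    (∑ k : Fin 3, ((M j k : ℝ) : ℂ) • (EuclideanSpace.proj k : C3 →L[ℂ] ℂ))

lemma convBilin_apply (M : Matrix (Fin 3) (Fin 3) ℝ) (j : Fin 3) (a b : C3) :
    convBilin M j a b = (∑ k : Fin 3, ((M j k : ℝ) : ℂ) * a k) • b := by
  simp [convBilin, Finset.sum_smul]

/-- The Fourier transform of the `j`-th derivative. -/
def derivHat (j : Fin 3) (q : R3 → F) (ξ : R3) : F := (2 * Real.pi * Complex.I * (ξ j : ℂ)) • q ξ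

lemma norm_derivHat_le (j : Fin 3) (q : R3 → F) (ξ : R3) :
    ‖derivHat j q ξ‖ ≤ symA ξ * ‖q ξ‖ := by
  rw [derivHat, norm_smul]
  gcongr
  simp only [norm_mul, Complex.norm_ofNat, Complex.norm_real, Complex.norm_I, mul_one, symA,
    Real.norm_of_nonneg Real.pi_pos.le]
  gcongr
  exact PiLp.norm_apply_le ξ j

lemma aestronglyMeasurable_derivHat (j : Fin 3) {q : R3 → F} (hq : AEStronglyMeasurable q) :
    AEStronglyMeasurable (derivHat j q) := by
  refine AEStronglyMeasurable.smul ?_ hq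
  have : Continuous fun ξ : R3 => (2 * Real.pi * Complex.I * (ξ j : ℂ)) := by fun_prop
  exact this.aestronglyMeasurable

lemma fourier_lineDeriv_rep (j : Fin 3) {v : 𝓢'(R3, F)} {q : R3 → F}
    (h : IsRepresentedBy (𝓕 v) q) :
    IsRepresentedBy (𝓕 (∂_{(EuclideanSpace.single j (1 : ℝ) : R3)} v)) (derivHat j q) := by
  rw [TemperedDistribution.fourier_lineDerivOp_eq]
  have hg : (fun ξ : R3 => ((inner ℝ ξ (EuclideanSpace.single j (1 : ℝ)) : ℝ) :
      ℂ)).HasTemperateGrowth := by fun_prop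
  refine ((h.smulLeft hg).smul (2 * Real.pi * Complex.I)).congr (ae_of_all _ fun ξ => ?_)
  simp only [Pi.smul_apply, derivHat, smul_smul]
  congr 2
  simp [EuclideanSpace.inner_single_right]

/-- One derivative costs one power of `A`; this is why the second factor enters the product estimate
with exponent `1/4`. -/
lemma memLp_derivHat (j : Fin 3) {q : R3 → F} (hq : MemLp (wmul (expPow 0 (5 / 4)) q) 2) :
    MemLp (wmul (expPow 0 (1 / 4)) (derivHat j q)) 2 := by
  refine hq.mono (aestronglyMeasurable_wmul (measurable_expPow _ _)
    (aestronglyMeasurable_derivHat j (aestronglyMeasurable_of_wmul hq))) ?_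
  filter_upwards [ae_symA_pos] with ξ hξ
  rw [norm_wmul, norm_wmul, expPow_zero_left, expPow_zero_left,
    abs_of_nonneg (by positivity), abs_of_nonneg (by positivity)]
  calc symA ξ ^ (1 / 4 : ℝ) * ‖derivHat j q ξ‖ ≤ symA ξ ^ (1 / 4 : ℝ) * (symA ξ * ‖q ξ‖) := by
        gcongr; exact norm_derivHat_le j q ξ
    _ = _ := by
        rw [← mul_assoc, show (5 / 4 : ℝ) = 1 / 4 + 1 by norm_num, Real.rpow_add hξ, Real.rpow_one]

/-- The Fourier transform of `(Mu · ∇) v` in terms of those of `u` and `v`. -/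
def convHat (M : Matrix (Fin 3) (Fin 3) ℝ) (p q : R3 → C3) : R3 → C3 :=
  ∑ j : Fin 3, (p ⋆[convBilin M j] derivHat j q)

variable {M : Matrix (Fin 3) (Fin 3) ℝ} {p q p' q' : R3 → C3}

lemma convHat_congr (hp : p =ᵐ[volume] p') (hq : q =ᵐ[volume] q') :
    convHat M p q = convHat M p' q' := by
  unfold convHat
  congr 1
  ext1 j
  refine convolution_congr _ hp ?_
  filter_upwards [hq] with ξ hξ
  simp [derivHat, hξ]

lemma memLp_convHat (hp : MemLp (wmul (expPow 0 (5 / 4)) p) 2)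
    (hq : MemLp (wmul (expPow 0 (5 / 4)) q) 2) : MemLp (convHat M p q) 2 :=
  memLp_finsetSum' _ fun j _ => memLp_conv (convBilin M j) hp (memLp_derivHat j hq)

lemma convHat_add_left (hp : MemLp (wmul (expPow 0 (5 / 4)) p) 2)
    (hp' : MemLp (wmul (expPow 0 (5 / 4)) p') 2) (hq : MemLp (wmul (expPow 0 (5 / 4)) q) 2) :
    convHat M (p + p') q =ᵐ[volume] convHat M p q + convHat M p' q := by
  have h : ∀ᵐ ξ, ∀ j, ConvolutionExistsAt p (derivHat j q) ξ (convBilin M j) volume ∧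
      ConvolutionExistsAt p' (derivHat j q) ξ (convBilin M j) volume := by
    rw [ae_all_iff]
    exact fun j => (ae_convolutionExistsAt _ hp (memLp_derivHat j hq)).and
      (ae_convolutionExistsAt _ hp' (memLp_derivHat j hq))
  filter_upwards [h] with ξ hξ
  simp only [convHat, Pi.add_apply, Finset.sum_apply, ← Finset.sum_add_distrib]
  exact Finset.sum_congr rfl fun j _ => (hξ j).1.add_distrib (hξ j).2

lemma derivHat_add (j : Fin 3) (q q' : R3 → C3) :
    derivHat j (q + q') = derivHat j q + derivHat j q' := by
  ext1 ξ; simp [derivHat, smul_add]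

lemma convHat_add_right (hp : MemLp (wmul (expPow 0 (5 / 4)) p) 2)
    (hq : MemLp (wmul (expPow 0 (5 / 4)) q) 2) (hq' : MemLp (wmul (expPow 0 (5 / 4)) q') 2) :
    convHat M p (q + q') =ᵐ[volume] convHat M p q + convHat M p q' := by
  have h : ∀ᵐ ξ, ∀ j, ConvolutionExistsAt p (derivHat j q) ξ (convBilin M j) volume ∧
      ConvolutionExistsAt p (derivHat j q') ξ (convBilin M j) volume := by
    rw [ae_all_iff]
    exact fun j => (ae_convolutionExistsAt _ hp (memLp_derivHat j hq)).and
      (ae_convolutionExistsAt _ hp (memLp_derivHat j hq'))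
  filter_upwards [h] with ξ hξ
  simp only [convHat, Pi.add_apply, Finset.sum_apply, ← Finset.sum_add_distrib, derivHat_add]
  exact Finset.sum_congr rfl fun j _ => (hξ j).1.distrib_add (hξ j).2

lemma convHat_smul_left (c : ℂ) : convHat M (c • p) q = c • convHat M p q := by
  simp only [convHat, Finset.smul_sum, smul_convolution]

lemma convHat_smul_right (c : ℂ) : convHat M p (c • q) = c • convHat M p q := by
  have h (j : Fin 3) : derivHat j (c • q) = c • derivHat j q := by
    ext1 ξ; simp only [derivHat, Pi.smul_apply, smul_comm c]
  simp only [convHat, Finset.smul_sum, convolution_smul, h]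

lemma convection_ae_eq {u v : 𝓢'(R3, C3)} (hu : IsRepresentedBy (𝓕 u) p)
    (hv : IsRepresentedBy (𝓕 v) q) (hp : MemLp (wmul (expPow 0 (5 / 4)) p) 2)
    (hq : MemLp (wmul (expPow 0 (5 / 4)) q) 2) :
    convection M u v =ᵐ[volume]
      (𝓕⁻ (toL2 (convHat M p q)) : Lp C3 2 (volume : Measure R3)) := by
  have h : ∀ᵐ x, ∀ j : Fin 3, convBilin M j (funRep u x)
      (funRep (∂_{(EuclideanSpace.single j (1 : ℝ) : R3)} v) x) =
      (𝓕⁻ (toL2 (p ⋆[convBilin M j] derivHat j q)) : Lp C3 2 (volume : Measure R3)) x := by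
    rw [ae_all_iff]
    exact fun j => bilin_funRep_ae_eq (convBilin M j) hu (fourier_lineDeriv_rep j hv) hp
      (memLp_derivHat j hq)
  have hm (j : Fin 3) := memLp_conv (convBilin M j) hp (memLp_derivHat j hq)
  have hs : toL2 (convHat M p q) =
      ∑ j : Fin 3, toL2 (p ⋆[convBilin M j] derivHat j q) := by
    simp only [convHat, Fin.sum_univ_three]
    rw [toL2_add ((hm 0).add (hm 1)) (hm 2), toL2_add (hm 0) (hm 1)]
  have hs' : (𝓕⁻ (toL2 (convHat M p q)) : Lp C3 2 (volume : Measure R3)) =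
      ∑ j : Fin 3, (𝓕⁻ (toL2 (p ⋆[convBilin M j] derivHat j q)) :
        Lp C3 2 (volume : Measure R3)) := by
    rw [hs]
    exact map_sum (Lp.fourierTransformₗᵢ R3 C3).symm _ _
  rw [hs']
  simp only [Fin.sum_univ_three]
  filter_upwards [h, Lp.coeFn_add ((𝓕⁻ (toL2 (p ⋆[convBilin M 0] derivHat 0 q)) :
      Lp C3 2 (volume : Measure R3)) + 𝓕⁻ (toL2 (p ⋆[convBilin M 1] derivHat 1 q)))
      (𝓕⁻ (toL2 (p ⋆[convBilin M 2] derivHat 2 q))),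
    Lp.coeFn_add (𝓕⁻ (toL2 (p ⋆[convBilin M 0] derivHat 0 q)) :
      Lp C3 2 (volume : Measure R3)) (𝓕⁻ (toL2 (p ⋆[convBilin M 1] derivHat 1 q)))] with x h1 h2 h3
  rw [h2, Pi.add_apply, h3, Pi.add_apply, ← h1, ← h1, ← h1]
  simp only [convection, Fin.sum_univ_three, convBilin_apply]

/-- The constant in the convection estimate, depending only on `M`. -/
def convectionConst (M : Matrix (Fin 3) (Fin 3) ℝ) : ℝ≥0∞ :=
  (∑ j : Fin 3, ‖convBilin M j‖ₑ) ^ 2 * convConst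

lemma convectionConst_lt_top : convectionConst M < ∞ := by
  refine ENNReal.mul_lt_top (ENNReal.pow_lt_top ?_) convConst_lt_top
  exact ENNReal.sum_lt_top.2 fun j _ => enorm_lt_top

lemma enorm_wmul_expPow (a σ : ℝ) (p : R3 → F) (ξ : R3) :
    ‖wmul (expPow a σ) p ξ‖ₑ = symPow σ ξ * (ENNReal.ofReal (Real.exp (a * symA ξ)) * ‖p ξ‖ₑ) := by
  rw [wmul, enorm_smul, expPow, symPow, ← mul_assoc, ← ENNReal.ofReal_mul
    (Real.rpow_nonneg (symA_nonneg ξ) _)]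
  congr 1
  rw [← ofReal_norm, Complex.norm_real, Real.norm_of_nonneg
    (mul_nonneg (Real.exp_nonneg _) (Real.rpow_nonneg (symA_nonneg ξ) _)), mul_comm]

lemma symA_le_add (ξ η : R3) : symA ξ ≤ symA η + symA (ξ - η) := by
  simp only [symA, ← mul_add]
  gcongr
  simpa using norm_add_le η (ξ - η)

/-- From `|ξ| ≤ |η| + |ξ - η|` and `a ≥ 0`, the weight `e^{a|ξ|}` is at most `e^{a|η|} e^{a|ξ-η|}`
and distributes over the two factors of the convolution. -/
lemma enorm_convHat_le {a : ℝ} (ha : 0 ≤ a) (ξ : R3) :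
    ENNReal.ofReal (Real.exp (a * symA ξ)) * ‖convHat M p q ξ‖ₑ ≤ (∑ j : Fin 3, ‖convBilin M j‖ₑ) *
      ∫⁻ η, (ENNReal.ofReal (Real.exp (a * symA η)) * ‖p η‖ₑ) *
        (ENNReal.ofReal (Real.exp (a * symA (ξ - η))) *
          (ENNReal.ofReal (symA (ξ - η)) * ‖q (ξ - η)‖ₑ)) := by
  have h1 : ‖convHat M p q ξ‖ₑ ≤
      ∑ j : Fin 3, ‖convBilin M j‖ₑ * normConv p (derivHat j q) ξ := by
    rw [convHat, Finset.sum_apply]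
    exact (enorm_sum_le _ _).trans (Finset.sum_le_sum fun j _ => enorm_conv_le _ ξ)
  refine (mul_le_mul' le_rfl h1).trans ?_
  rw [Finset.mul_sum, Finset.sum_mul]
  refine Finset.sum_le_sum fun j _ => ?_
  rw [mul_left_comm]
  gcongr
  rw [normConv, ← lintegral_const_mul' _ _ (by finiteness)]
  refine lintegral_mono fun η => ?_
  have h2 : ENNReal.ofReal (Real.exp (a * symA ξ)) ≤ ENNReal.ofReal (Real.exp (a * symA η)) *
      ENNReal.ofReal (Real.exp (a * symA (ξ - η))) := by
    rw [← ENNReal.ofReal_mul (Real.exp_nonneg _), ← Real.exp_add, ← mul_add]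
    gcongr
    exact symA_le_add ξ η
  have h3 : ‖derivHat j q (ξ - η)‖ₑ ≤ ENNReal.ofReal (symA (ξ - η)) * ‖q (ξ - η)‖ₑ := by
    rw [← ofReal_norm, ← ofReal_norm, ← ENNReal.ofReal_mul (symA_nonneg _)]
    exact ENNReal.ofReal_le_ofReal (norm_derivHat_le j q _)
  calc _ ≤ (ENNReal.ofReal (Real.exp (a * symA η)) *
        ENNReal.ofReal (Real.exp (a * symA (ξ - η)))) * (‖p η‖ₑ *
          (ENNReal.ofReal (symA (ξ - η)) * ‖q (ξ - η)‖ₑ)) :=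
        mul_le_mul' h2 (mul_le_mul' le_rfl h3)
    _ = _ := by ring

/-- The convolution estimate for the nonnegative functions `e^{aA}|p|` and `e^{aA}A|q|`. Its
constant does not see the exponential, so the bound is uniform in `a`. -/
lemma eLpNorm_convHat_sq_le {a : ℝ} (ha : 0 ≤ a) (hp : AEStronglyMeasurable p)
    (hq : AEStronglyMeasurable q) :
    eLpNorm (wmul (expPow a 0) (convHat M p q)) 2 ^ 2 ≤ convectionConst M *
      eLpNorm (wmul (expPow a (5 / 4)) p) 2 ^ 2 * eLpNorm (wmul (expPow a (5 / 4)) q) 2 ^ 2 := by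
  have hsA := measurable_symA
  have h := lintegral_conv_sq_le' (f := fun η => ENNReal.ofReal (Real.exp (a * symA η)) * ‖p η‖ₑ)
    (g := fun η => ENNReal.ofReal (Real.exp (a * symA η)) * (ENNReal.ofReal (symA η) * ‖q η‖ₑ))
    (AEMeasurable.mul (by fun_prop) hp.enorm)
    (AEMeasurable.mul (by fun_prop) (AEMeasurable.mul (by fun_prop) hq.enorm))
  simp only [eLpNorm_two_sq]
  calc ∫⁻ ξ, ‖wmul (expPow a 0) (convHat M p q) ξ‖ₑ ^ 2 ≤
      ∫⁻ ξ, (∑ j : Fin 3, ‖convBilin M j‖ₑ) ^ 2 *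
        (∫⁻ η, (ENNReal.ofReal (Real.exp (a * symA η)) * ‖p η‖ₑ) *
        (ENNReal.ofReal (Real.exp (a * symA (ξ - η))) *
          (ENNReal.ofReal (symA (ξ - η)) * ‖q (ξ - η)‖ₑ))) ^ 2 := by
        refine lintegral_mono fun ξ => ?_
        rw [← mul_pow, enorm_wmul_expPow, symPow_zero, one_mul]
        exact pow_le_pow_left₀ zero_le (enorm_convHat_le ha ξ) 2
    _ ≤ _ := by
        rw [lintegral_const_mul' _ _ (ENNReal.pow_ne_top
          (ENNReal.sum_lt_top.2 fun j _ => enorm_lt_top).ne), convectionConst, mul_assoc, mul_assoc]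
        gcongr
        refine h.trans (le_of_eq ?_)
        rw [mul_assoc]
        congr 2
        · simp only [enorm_wmul_expPow]
        · refine lintegral_congr_ae ?_
          filter_upwards [ae_symA_pos] with ξ hξ
          rw [enorm_wmul_expPow]
          have : symPow (5 / 4) ξ = symPow (1 / 4) ξ * ENNReal.ofReal (symA ξ) := by
            have := symPow_mul hξ (1 / 4) 1
            rw [show (1 / 4 : ℝ) + 1 = 5 / 4 by norm_num] at this
            rw [← this, symPow, symPow, Real.rpow_one]
          rw [this]
          congr 1
          ring

lemma expPow_zero_zero : expPow 0 0 = fun _ => 1 := by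
  ext ξ; simp [expPow]

lemma wmul_one (p : R3 → F) : wmul (fun _ => 1) p = p := by
  ext1 ξ; simp [wmul]

lemma memLp_of_wmul_expPow {a σ : ℝ} {p : R3 → F} (ha : 0 ≤ a) (hp : AEStronglyMeasurable p)
    (h : MemLp (wmul (expPow a σ) p) 2) : MemLp (wmul (expPow 0 σ) p) 2 := by
  refine h.mono (aestronglyMeasurable_wmul (measurable_expPow _ _) hp) (ae_of_all _ fun ξ => ?_)
  rw [norm_wmul, norm_wmul, abs_of_nonneg (expPow_nonneg _ _ _),
    abs_of_nonneg (expPow_nonneg _ _ _)]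
  gcongr
  unfold expPow
  have := symA_nonneg ξ
  gcongr

/-- The exponentially weighted estimate `‖e^{aA} (Mu·∇)v‖ ≤ C ‖e^{aA}A^{5/4}u‖ ‖e^{aA}A^{5/4}v‖`. -/
lemma norm_convHat_le {a : ℝ} (ha : 0 ≤ a) (hp : AEStronglyMeasurable p)
    (hq : AEStronglyMeasurable q) (hp' : MemLp (wmul (expPow a (5 / 4)) p) 2)
    (hq' : MemLp (wmul (expPow a (5 / 4)) q) 2) :
    MemLp (wmul (expPow a 0) (convHat M p q)) 2 ∧
      ‖toL2 (wmul (expPow a 0) (convHat M p q))‖ ≤ √(convectionConst M).toReal *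
        ‖toL2 (wmul (expPow a (5 / 4)) p)‖ * ‖toL2 (wmul (expPow a (5 / 4)) q)‖ := by
  have h := eLpNorm_convHat_sq_le (M := M) ha hp hq
  have hfin : convectionConst M * eLpNorm (wmul (expPow a (5 / 4)) p) 2 ^ 2 *
      eLpNorm (wmul (expPow a (5 / 4)) q) 2 ^ 2 < ∞ :=
    ENNReal.mul_lt_top (ENNReal.mul_lt_top convectionConst_lt_top (ENNReal.pow_lt_top hp'.2))
      (ENNReal.pow_lt_top hq'.2)
  have hm : MemLp (wmul (expPow a 0) (convHat M p q)) 2 := by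
    refine memLp_two_of_lintegral (aestronglyMeasurable_wmul (measurable_expPow _ _)
      (memLp_convHat (memLp_of_wmul_expPow ha hp hp') (memLp_of_wmul_expPow ha hq hq')).1) ?_
    rw [← eLpNorm_two_sq]
    exact h.trans_lt hfin
  refine ⟨hm, ?_⟩
  rw [norm_toL2 hm, norm_toL2 hp', norm_toL2 hq']
  refine abs_le_of_sq_le_sq' ?_ (by positivity) |>.2
  have h2 := ENNReal.toReal_mono hfin.ne h
  simpa [mul_pow, Real.sq_sqrt ENNReal.toReal_nonneg] using h2

end MildNS
end

noncomputable section

namespace MildNS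

set_option linter.unusedSectionVars false

open Filter Topology
open scoped Convolution

variable {F : Type*} [NormedAddCommGroup F] [InnerProductSpace ℂ F] [CompleteSpace F]
variable {M : Matrix (Fin 3) (Fin 3) ℝ} {P : FiberedProjection}

/-! ### The bilinear operator in Fourier space -/

/-- The function `A^{-5/4} g` in Fourier space. -/
def invW (g : R3 → F) : R3 → F := wmul (expPow 0 (-(5 / 4))) g

lemma wmul_expPow_invW (a : ℝ) (g : R3 → F) :
    wmul (expPow a (5 / 4)) (invW g) =ᵐ[volume] wmul (expPow a 0) g := by
  filter_upwards [ae_symA_pos] with ξ hξ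
  simp only [wmul, invW, smul_smul, expPow, ← Complex.ofReal_mul]
  congr 2
  rw [zero_mul, Real.exp_zero, one_mul, mul_assoc, ← Real.rpow_add hξ]
  norm_num

lemma wmul_invW (g : R3 → F) : wmul (expPow 0 (5 / 4)) (invW g) =ᵐ[volume] g := by
  have := wmul_expPow_invW 0 g
  rwa [expPow_zero_zero, show wmul (fun _ => 1) g = g by ext1 ξ; simp [wmul]] at this

lemma memLp_invW {g : R3 → F} (hg : MemLp g 2) : MemLp (wmul (expPow 0 (5 / 4)) (invW g)) 2 :=
  hg.ae_eq (wmul_invW g).symm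

lemma aestronglyMeasurable_invW {g : R3 → F} (hg : AEStronglyMeasurable g) :
    AEStronglyMeasurable (invW g) := aestronglyMeasurable_wmul (measurable_expPow _ _) hg

lemma invW_add (g h : R3 → F) : invW (g + h) = invW g + invW h := by
  ext1 ξ; simp only [invW, wmul, Pi.add_apply, smul_add]

lemma invW_smul (c : ℂ) (g : R3 → F) : invW (c • g) = c • invW g := by
  ext1 ξ; simp only [invW, wmul, Pi.smul_apply, smul_comm c]

lemma invW_congr {g h : R3 → F} (e : g =ᵐ[volume] h) : invW g =ᵐ[volume] invW h :=
  wmul_congr _ e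

/-- The space `L²` of vector fields. -/
abbrev L2V := Lp C3 2 (volume : Measure R3)

/-- The bilinear map `(A^{5/4} u, A^{5/4} v) ↦ (Mu · ∇) v` in Fourier space. -/
def convOp (M : Matrix (Fin 3) (Fin 3) ℝ) : L2V →L[ℂ] L2V →L[ℂ] L2V :=
  LinearMap.mkContinuous₂
    (LinearMap.mk₂ ℂ (fun g h : L2V => toL2 (convHat M (invW g) (invW h)))
      (fun g g' h => by
        rw [← toL2_add (memLp_convHat (memLp_invW (Lp.memLp g)) (memLp_invW (Lp.memLp h)))
          (memLp_convHat (memLp_invW (Lp.memLp g')) (memLp_invW (Lp.memLp h)))]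
        rw [convHat_congr (invW_congr (Lp.coeFn_add g g')) (EventuallyEq.refl _ _), invW_add]
        exact toL2_congr (convHat_add_left (memLp_invW (Lp.memLp g)) (memLp_invW (Lp.memLp g'))
          (memLp_invW (Lp.memLp h))))
      (fun c g h => by
        rw [convHat_congr (invW_congr (Lp.coeFn_smul c g)) (EventuallyEq.refl _ _), invW_smul,
          convHat_smul_left, toL2_smul c
          (memLp_convHat (memLp_invW (Lp.memLp g)) (memLp_invW (Lp.memLp h)))])
      (fun g h h' => by
        rw [← toL2_add (memLp_convHat (memLp_invW (Lp.memLp g)) (memLp_invW (Lp.memLp h)))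
          (memLp_convHat (memLp_invW (Lp.memLp g)) (memLp_invW (Lp.memLp h')))]
        rw [convHat_congr (EventuallyEq.refl _ _) (invW_congr (Lp.coeFn_add h h')), invW_add]
        exact toL2_congr (convHat_add_right (memLp_invW (Lp.memLp g)) (memLp_invW (Lp.memLp h))
          (memLp_invW (Lp.memLp h'))))
      (fun c g h => by
        rw [convHat_congr (EventuallyEq.refl _ _) (invW_congr (Lp.coeFn_smul c h)), invW_smul,
          convHat_smul_right, toL2_smul c
          (memLp_convHat (memLp_invW (Lp.memLp g)) (memLp_invW (Lp.memLp h)))]))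
    √(convectionConst M).toReal
    (fun g h => by
      have := (norm_convHat_le (M := M) le_rfl (aestronglyMeasurable_invW (Lp.memLp g).1)
        (aestronglyMeasurable_invW (Lp.memLp h).1) (memLp_invW (Lp.memLp g))
        (memLp_invW (Lp.memLp h))).2
      rwa [expPow_zero_zero, wmul_one, toL2_eq (wmul_invW g), toL2_eq (wmul_invW h)] at this)

lemma convOp_apply (g h : L2V) : convOp M g h = toL2 (convHat M (invW g) (invW h)) := rfl

lemma InDomain.funRep_ae_eq_invW {v : 𝓢'(R3, F)} (h : InDomain (expPow 0 (5 / 4)) v) :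
    funRep (𝓕 v) =ᵐ[volume] invW (hatMul (expPow 0 (5 / 4)) v) := by
  filter_upwards [ae_symA_pos, h.coeFn_hatMul] with ξ hξ h1
  simp only [invW, wmul, h1, smul_smul, expPow_zero_left, ← Complex.ofReal_mul, ← Real.rpow_add hξ]
  simp

/-- Since the transform of `(Mu·∇)v` is a bounded bilinear function of the `L²` elements `A^{5/4}u`
and `A^{5/4}v`, continuity in time of the nonlinear term follows at once from continuity of the two
paths. -/
lemma convection_spec {u v : 𝓢'(R3, C3)} (hu : MemHom (5 / 4) u) (hv : MemHom (5 / 4) v) :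
    MemLp (convection M u v) 2 ∧ (𝓕 (toL2 (convection M u v)) : L2V) =
      convOp M (hatMul (expPow 0 (5 / 4)) u) (hatMul (expPow 0 (5 / 4)) v) := by
  have h := convection_ae_eq (M := M) (InDomain.rep hu) (InDomain.rep hv) (InDomain.memLp hu)
    (InDomain.memLp hv)
  refine ⟨(Lp.memLp _).ae_eq h.symm, ?_⟩
  rw [toL2_eq h, FourierTransform.fourier_fourierInv_eq, convOp_apply,
    convHat_congr (InDomain.funRep_ae_eq_invW hu) (InDomain.funRep_ae_eq_invW hv)]

/-- Multiplication by the matrices of a fibered projection. -/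
def projFun (P : FiberedProjection) (g : R3 → C3) (ξ : R3) : C3 :=
  WithLp.toLp 2 ((P.symbol ξ).mulVec (g ξ).ofLp)

/-- A Hermitian idempotent matrix is a star projection, so its operator norm is at most one. The
exceptional null set does not depend on `v`, so the bound may be applied with `v` depending on `ξ`.
-/
lemma norm_projFun_le (P : FiberedProjection) : ∀ᵐ ξ, ∀ v : C3,
    ‖(WithLp.toLp 2 ((P.symbol ξ).mulVec v.ofLp) : C3)‖ ≤ ‖v‖ := by
  filter_upwards [P.isHermitian_symbol, P.idempotent_symbol] with ξ h1 h2 v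
  have h3 : IsStarProjection (P.symbol ξ) := ⟨h2, h1⟩
  have h4 : IsStarProjection (Matrix.toEuclideanCLM (n := Fin 3) (𝕜 := ℂ) (P.symbol ξ)) :=
    h3.map _
  have h5 := (Matrix.toEuclideanCLM (n := Fin 3) (𝕜 := ℂ) (P.symbol ξ)).le_opNorm v
  have h6 : ‖Matrix.toEuclideanCLM (n := Fin 3) (𝕜 := ℂ) (P.symbol ξ)‖ ≤ 1 :=
    IsStarProjection.norm_le _ h4
  calc _ ≤ ‖Matrix.toEuclideanCLM (n := Fin 3) (𝕜 := ℂ) (P.symbol ξ)‖ * ‖v‖ := h5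
    _ ≤ 1 * ‖v‖ := by gcongr
    _ = _ := one_mul _

lemma aestronglyMeasurable_projFun {g : R3 → C3} (hg : AEStronglyMeasurable g) :
    AEStronglyMeasurable (projFun P g) := by
  have h1 : ∀ i, AEMeasurable fun ξ => (P.symbol ξ).mulVec (g ξ).ofLp i := by
    intro i
    simp only [Matrix.mulVec, dotProduct]
    refine Finset.aemeasurable_fun_sum _ fun k _ => ?_
    refine (P.measurable_symbol i k).aemeasurable.mul ?_
    exact (EuclideanSpace.proj k : C3 →L[ℂ] ℂ).continuous.measurable.comp_aemeasurable hg.aemeasurable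
  have h2 : AEMeasurable fun ξ => (P.symbol ξ).mulVec (g ξ).ofLp := aemeasurable_pi_iff.2 h1
  exact ((PiLp.continuous_toLp 2 _).measurable.comp_aemeasurable h2).aestronglyMeasurable

lemma memLp_projFun {g : R3 → C3} (hg : MemLp g 2) : MemLp (projFun P g) 2 := by
  refine hg.mono (aestronglyMeasurable_projFun hg.1) ?_
  filter_upwards [norm_projFun_le P] with ξ hξ using hξ _

lemma projFun_congr {g h : R3 → C3} (e : g =ᵐ[volume] h) : projFun P g =ᵐ[volume] projFun P h := by
  filter_upwards [e] with ξ hξ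
  simp [projFun, hξ]

lemma projFun_wmul (w : R3 → ℝ) (g : R3 → C3) : projFun P (wmul w g) = wmul w (projFun P g) := by
  ext1 ξ
  simp only [projFun, wmul, WithLp.ofLp_smul, Matrix.mulVec_smul, WithLp.toLp_smul]

/-- The projection `P` in Fourier space. -/
def projOp (P : FiberedProjection) : L2V →L[ℂ] L2V :=
  LinearMap.mkContinuous
    { toFun := fun g => toL2 (projFun P g)
      map_add' := fun g h => by
        rw [← toL2_add (memLp_projFun (Lp.memLp g)) (memLp_projFun (Lp.memLp h)),
          toL2_congr (projFun_congr (Lp.coeFn_add g h))]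
        congr 1
        ext1 ξ
        simp only [projFun, Pi.add_apply, WithLp.ofLp_add, Matrix.mulVec_add, WithLp.toLp_add]
      map_smul' := fun c g => by
        rw [RingHom.id_apply, ← toL2_smul c (memLp_projFun (Lp.memLp g)),
          toL2_congr (projFun_congr (Lp.coeFn_smul c g))]
        congr 1
        ext1 ξ
        simp only [projFun, Pi.smul_apply, WithLp.ofLp_smul, Matrix.mulVec_smul,
          WithLp.toLp_smul] } 1
    fun g => by
      have := norm_toL2_le (K := 1) (memLp_projFun (P := P) (Lp.memLp g)) (Lp.memLp g) (by
        filter_upwards [norm_projFun_le P] with ξ hξ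
        rw [one_mul]; exact hξ _)
      rwa [toL2_coeFn] at this

lemma coeFn_projOp (g : L2V) : projOp P g =ᵐ[volume] projFun P g :=
  coeFn_toL2 (memLp_projFun (Lp.memLp g))

/-- The symbol of `e^{-τA²}`. -/
def heatW (τ : ℝ) (ξ : R3) : ℝ := Real.exp (-(τ * symA ξ ^ 2))

lemma measurable_heatW (τ : ℝ) : Measurable (heatW τ) := by
  have := measurable_symA
  unfold heatW
  fun_prop

/-- The bilinear term `P (Mu · ∇) v` in Fourier space, in terms of `A^{5/4} u` and `A^{5/4} v`. -/
def nonlin (M : Matrix (Fin 3) (Fin 3) ℝ) (P : FiberedProjection) (g h : L2V) : L2V :=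
  projOp P (convOp M g h)

lemma continuous_nonlin : Continuous fun z : L2V × L2V => nonlin M P z.1 z.2 :=
  (projOp P).continuous.comp (convOp M).continuous₂

/-- The Fourier transform of `A^{5/4} v`. -/
def hat54 (v : 𝓢'(R3, C3)) : L2V := hatMul (expPow 0 (5 / 4)) v

lemma duhamelIntegrand_eq {u v : ℝ → 𝓢'(R3, C3)} {t s : ℝ} (hu : MemHom (5 / 4) (u s))
    (hv : MemHom (5 / 4) (v s)) : duhamelIntegrand M P u v t s =
      𝓕⁻ (toL2 (wmul (heatW (t - s)) (nonlin M P (hat54 (u s)) (hat54 (v s))))) := by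
  rw [duhamelIntegrand, heatProj, (convection_spec hu hv).2]
  congr 1
  refine toL2_congr ?_
  filter_upwards [coeFn_projOp (P := P) (convOp M (hat54 (u s)) (hat54 (v s)))] with ξ hξ
  simp only [wmul, nonlin, hξ, projFun]
  rfl

/-- The matrices `P(ξ)` commute with the scalar weight `e^{aA}` and are contractions, so the
projection costs nothing in the convection estimate. -/
lemma norm_nonlin_le {u v : 𝓢'(R3, C3)} {a : ℝ} (ha : 0 ≤ a) (hu : InDomain (expPow 0 (5 / 4)) u)
    (hv : InDomain (expPow 0 (5 / 4)) v) (hua : InDomain (expPow a (5 / 4)) u)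
    (hva : InDomain (expPow a (5 / 4)) v) :
    MemLp (wmul (expPow a 0) (nonlin M P (hat54 u) (hat54 v))) 2 ∧
      ‖toL2 (wmul (expPow a 0) (nonlin M P (hat54 u) (hat54 v)))‖ ≤ √(convectionConst M).toReal *
        ‖hatMul (expPow a (5 / 4)) u‖ * ‖hatMul (expPow a (5 / 4)) v‖ := by
  have h := norm_convHat_le (M := M) ha hu.rep.aestronglyMeasurable hv.rep.aestronglyMeasurable
    hua.memLp hva.memLp
  have e : wmul (expPow a 0) (nonlin M P (hat54 u) (hat54 v)) =ᵐ[volume]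
      projFun P (wmul (expPow a 0) (convHat M (funRep (𝓕 u)) (funRep (𝓕 v)))) := by
    rw [projFun_wmul]
    refine wmul_congr _ ((coeFn_projOp _).trans (projFun_congr ?_))
    rw [convOp_apply, convHat_congr hu.funRep_ae_eq_invW hv.funRep_ae_eq_invW]
    exact coeFn_toL2 (memLp_convHat (memLp_invW (Lp.memLp _)) (memLp_invW (Lp.memLp _)))
  refine ⟨(memLp_projFun h.1).ae_eq e.symm, ?_⟩
  rw [toL2_congr e]
  refine le_trans ?_ h.2
  have := norm_toL2_le (K := 1) (memLp_projFun (P := P) h.1) h.1 (by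
    filter_upwards [norm_projFun_le P] with ξ hξ
    rw [one_mul]; exact hξ _)
  rwa [one_mul] at this

end MildNS
end

noncomputable section

namespace MildNS

set_option linter.unusedSectionVars false

open Filter Topology

variable {F : Type*} [NormedAddCommGroup F] [InnerProductSpace ℂ F] [CompleteSpace F]

/-! ### The kernel of the Duhamel integral -/

lemma one_le_jap (x : ℝ) : 1 ≤ jap x := by
  rw [jap, Real.one_le_sqrt]; nlinarith [sq_nonneg x]

lemma jap_pos (x : ℝ) : 0 < jap x := lt_of_lt_of_le one_pos (one_le_jap x)

lemma le_jap (x : ℝ) : x ≤ jap x :=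
  Real.le_sqrt_of_sq_le (by linarith)

lemma jap_mono {x y : ℝ} (hx : 0 ≤ x) (h : x ≤ y) : jap x ≤ jap y := by
  unfold jap; gcongr

lemma continuous_jap : Continuous jap := by unfold jap; fun_prop

/-- Completing the square, `μx - x² = μ²/4 - y²` with `y = |x - μ/2|`. Then `x ≤ (1+y)⟨μ⟩`, and the
surplus `(1+y)^σ ≤ (1+y)²` is absorbed by the Gaussian because `(1+y)² ≤ 2(1+y²) ≤ 2e^{y²}`. -/
lemma rpow_mul_exp_le {x μ σ : ℝ} (hx : 0 ≤ x) (hσ₀ : 0 ≤ σ) (hσ : σ ≤ 2) :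
    x ^ σ * Real.exp (μ * x - x ^ 2) ≤ 2 * jap μ ^ σ * Real.exp (μ ^ 2 / 4) := by
  set y := |x - μ / 2| with hy
  have hy0 : 0 ≤ y := abs_nonneg _
  have hj := one_le_jap μ
  have hjp := jap_pos μ
  have h1 : x ≤ (1 + y) * jap μ := by
    have := le_abs_self (x - μ / 2)
    have h2 := le_jap μ
    nlinarith
  have h2 : x ^ σ ≤ (1 + y) ^ 2 * jap μ ^ σ := by
    calc x ^ σ ≤ ((1 + y) * jap μ) ^ σ := Real.rpow_le_rpow hx h1 hσ₀
      _ = (1 + y) ^ σ * jap μ ^ σ := Real.mul_rpow (by positivity) hjp.le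
      _ ≤ (1 + y) ^ (2 : ℝ) * jap μ ^ σ := by
          gcongr
          linarith
      _ = _ := by rw [Real.rpow_two]
  have h3 : (1 + y) ^ 2 * Real.exp (-y ^ 2) ≤ 2 := by
    have h4 : 1 + y ^ 2 ≤ Real.exp (y ^ 2) := by
      linarith [Real.add_one_le_exp (y ^ 2)]
    rw [Real.exp_neg, ← div_eq_mul_inv, div_le_iff₀ (Real.exp_pos _)]
    nlinarith [sq_nonneg (1 - y)]
  have h5 : Real.exp (μ * x - x ^ 2) = Real.exp (-y ^ 2) * Real.exp (μ ^ 2 / 4) := by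
    rw [← Real.exp_add, hy, sq_abs]; congr 1; ring
  rw [h5]
  calc x ^ σ * (Real.exp (-y ^ 2) * Real.exp (μ ^ 2 / 4)) ≤
      ((1 + y) ^ 2 * jap μ ^ σ) * (Real.exp (-y ^ 2) * Real.exp (μ ^ 2 / 4)) := by gcongr
    _ = ((1 + y) ^ 2 * Real.exp (-y ^ 2)) * jap μ ^ σ * Real.exp (μ ^ 2 / 4) := by ring
    _ ≤ _ := by gcongr

/-- The factor in the bound of `A^σ e^{κτA - τA²}`. -/
def kerBound (κ σ τ : ℝ) : ℝ :=
  2 * τ ^ (-(σ / 2)) * jap (κ * √τ) ^ σ * Real.exp (κ ^ 2 * τ / 4)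

lemma kerBound_nonneg {κ σ τ : ℝ} (hτ : 0 ≤ τ) : 0 ≤ kerBound κ σ τ := by
  have := jap_pos (κ * √τ)
  unfold kerBound; positivity

/-- The rescaling `x = √τ a`, `μ = κ√τ` of `rpow_mul_exp_le`. -/
lemma symbol_le {κ τ σ a : ℝ} (ha : 0 ≤ a) (hτ : 0 < τ) (hσ₀ : 0 ≤ σ) (hσ : σ ≤ 2) :
    a ^ σ * Real.exp (κ * τ * a - τ * a ^ 2) ≤ kerBound κ σ τ := by
  have hs : 0 < √τ := Real.sqrt_pos.2 hτ
  have hsq : √τ ^ 2 = τ := Real.sq_sqrt hτ.le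
  have h := rpow_mul_exp_le (x := √τ * a) (μ := κ * √τ) (σ := σ) (by positivity) hσ₀ hσ
  have e1 : κ * √τ * (√τ * a) - (√τ * a) ^ 2 = κ * τ * a - τ * a ^ 2 := by
    rw [mul_pow, hsq]; linear_combination κ * a * hsq
  have e2 : (κ * √τ) ^ 2 / 4 = κ ^ 2 * τ / 4 := by rw [mul_pow, hsq]
  have e3 : (√τ * a) ^ σ = τ ^ (σ / 2) * a ^ σ := by
    rw [Real.mul_rpow hs.le ha, Real.sqrt_eq_rpow, ← Real.rpow_mul hτ.le]
    congr 2; ring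
  have e4 : τ ^ (-(σ / 2)) * τ ^ (σ / 2) = 1 := by
    rw [← Real.rpow_add hτ]; simp
  rw [e1, e2, e3] at h
  have hpos : 0 ≤ τ ^ (-(σ / 2)) := by positivity
  calc a ^ σ * Real.exp (κ * τ * a - τ * a ^ 2) = τ ^ (-(σ / 2)) *
        (τ ^ (σ / 2) * a ^ σ * Real.exp (κ * τ * a - τ * a ^ 2)) := by
        rw [← mul_assoc, ← mul_assoc, e4, one_mul]
    _ ≤ τ ^ (-(σ / 2)) * (2 * jap (κ * √τ) ^ σ * Real.exp (κ ^ 2 * τ / 4)) := by gcongr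
    _ = _ := by rw [kerBound]; ring

/-- The symbol of `e^{κtA} A^σ e^{-(t-s)A²}`. -/
def kerW (κ σ t s : ℝ) (ξ : R3) : ℝ := expPow (κ * t) σ ξ * heatW (t - s) ξ

lemma measurable_kerW (κ σ t s : ℝ) : Measurable (kerW κ σ t s) :=
  (measurable_expPow _ _).mul (measurable_heatW _)

lemma kerW_nonneg (κ σ t s : ℝ) (ξ : R3) : 0 ≤ kerW κ σ t s ξ :=
  mul_nonneg (expPow_nonneg _ _ _) (Real.exp_nonneg _)

/-- The splitting `e^{κtA} = e^{κ(t-s)A} e^{κsA}`: the heat factor over the time `t - s` pays for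
the first exponential, and the second is left for the nonlinear term at time `s`. -/
lemma kerW_le {κ σ t s : ℝ} (hs : s < t) (hσ₀ : 0 ≤ σ) (hσ : σ ≤ 2) (ξ : R3) :
    kerW κ σ t s ξ ≤ kerBound κ σ (t - s) * expPow (κ * s) 0 ξ := by
  have h := symbol_le (κ := κ) (symA_nonneg ξ) (sub_pos.2 hs) hσ₀ hσ
  have e : kerW κ σ t s ξ = (symA ξ ^ σ * Real.exp (κ * (t - s) * symA ξ - (t - s) * symA ξ ^ 2)) *
      expPow (κ * s) 0 ξ := by
    rw [kerW, expPow, expPow, heatW, Real.rpow_zero, mul_one, mul_assoc _ (Real.exp _),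
      ← Real.exp_add, mul_right_comm, ← Real.exp_add, mul_comm]
    congr 2
    ring
  rw [e]
  exact mul_le_mul_of_nonneg_right h (expPow_nonneg _ _ _)

/-- Away from the diagonal `s = t` the heat factor absorbs the whole of `e^{κtA}`; writing `κT =
(κT/δ)δ` brings it into the form of `symbol_le`. The bound is crude but uniform, which is what the
continuity arguments need. -/
lemma kerW_le_const {κ σ t s δ T : ℝ} (hκ : 0 ≤ κ) (hδ : 0 < δ) (hts : δ ≤ t - s) (ht : t ≤ T)
    (hσ₀ : 0 ≤ σ) (hσ : σ ≤ 2) (ξ : R3) : kerW κ σ t s ξ ≤ kerBound (κ * T / δ) σ δ := by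
  have h := symbol_le (κ := κ * T / δ) (symA_nonneg ξ) hδ hσ₀ hσ
  refine le_trans ?_ h
  have hA := symA_nonneg ξ
  rw [kerW, expPow, heatW, mul_comm (Real.exp _), mul_assoc, ← Real.exp_add]
  have h1 : κ * t ≤ κ * T := by gcongr
  have h2 : κ * T / δ * δ = κ * T := by field_simp
  have h3 : κ * t * symA ξ + -((t - s) * symA ξ ^ 2) ≤
      κ * T / δ * δ * symA ξ - δ * symA ξ ^ 2 := by
    rw [h2]
    nlinarith [mul_le_mul_of_nonneg_right h1 hA, mul_le_mul_of_nonneg_right hts (sq_nonneg (symA ξ))]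
  gcongr

/-- The hypotheses on the nonlinear term in the Duhamel integral: continuity in `L²` and the bound
`‖e^{κsA} Q(s)‖ ≤ D s^{-3/4} ⟨κ√s⟩^{3/2} e^{κ²s/2}`. -/
structure DuhamelBound (κ D T : ℝ) (Q : ℝ → Lp F 2 (volume : Measure R3)) : Prop where
  continuousOn : ContinuousOn Q (Ioc 0 T)
  memLp : ∀ s ∈ Ioc 0 T, MemLp (wmul (expPow (κ * s) 0) (Q s)) 2
  norm_le : ∀ s ∈ Ioc 0 T, ‖toL2 (wmul (expPow (κ * s) 0) (Q s))‖ ≤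
    D * s ^ (-(3 / 4) : ℝ) * jap (κ * √s) ^ (3 / 2 : ℝ) * Real.exp (κ ^ 2 * s / 2)

/-- The function `e^{κtA} A^σ e^{-(t-s)A²} Q(s)` in Fourier space. -/
def duhamelTerm (κ σ : ℝ) (Q : ℝ → Lp F 2 (volume : Measure R3)) (t s : ℝ) :
    Lp F 2 (volume : Measure R3) := toL2 (wmul (kerW κ σ t s) (Q s))

variable {κ D T σ : ℝ} {Q : ℝ → Lp F 2 (volume : Measure R3)}

lemma memLp_duhamelTerm (hκ : 0 ≤ κ) (hσ₀ : 0 ≤ σ) (hσ : σ ≤ 2) {t s : ℝ} (hs : s < t) :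
    MemLp (wmul (kerW κ σ t s) (Q s)) 2 :=
  memLp_wmul (measurable_kerW _ _ _ _) (ae_of_all _ fun ξ => by
    rw [abs_of_nonneg (kerW_nonneg _ _ _ _ _)]
    exact kerW_le_const hκ (sub_pos.2 hs) le_rfl le_rfl hσ₀ hσ ξ) (Lp.memLp _)

/-- The constant in the bound of the Duhamel integral. -/
def timeBound (κ D σ t : ℝ) : ℝ :=
  2 * D * jap (κ * √t) ^ (σ + 3 / 2) * Real.exp (κ ^ 2 * t / 2)

/-- The exponents `κ²(t-s)/4` from the kernel and `κ²s/2` from the nonlinear term add up to at most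
`κ²t/2`. Likewise the powers `σ` and `3/2` of the brackets combine at time `t`. Only the singular
powers of `t - s` and `s` remain to be integrated. -/
lemma norm_duhamelTerm_le (hκ : 0 ≤ κ) (hD : 0 ≤ D) (hσ₀ : 0 ≤ σ) (hσ : σ ≤ 2)
    (hQ : DuhamelBound κ D T Q) {t s : ℝ} (hs : 0 < s) (hst : s < t) (ht : t ≤ T) :
    ‖duhamelTerm κ σ Q t s‖ ≤
      timeBound κ D σ t * ((t - s) ^ (-(σ / 2)) * s ^ (-(3 / 4) : ℝ)) := by
  have hsT : s ∈ Ioc 0 T := ⟨hs, hst.le.trans ht⟩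
  have hτ := sub_pos.2 hst
  have h1 : ‖duhamelTerm κ σ Q t s‖ ≤
      kerBound κ σ (t - s) * ‖toL2 (wmul (expPow (κ * s) 0) (Q s))‖ := by
    refine norm_toL2_le (memLp_duhamelTerm hκ hσ₀ hσ hst) (hQ.memLp s hsT) (ae_of_all _ fun ξ => ?_)
    rw [norm_wmul, norm_wmul, abs_of_nonneg (kerW_nonneg _ _ _ _ _),
      abs_of_nonneg (expPow_nonneg _ _ _), ← mul_assoc]
    gcongr
    exact kerW_le hst hσ₀ hσ ξ
  have j1 : jap (κ * √(t - s)) ≤ jap (κ * √t) := jap_mono (by positivity) (by gcongr; linarith)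
  have j2 : jap (κ * √s) ≤ jap (κ * √t) := jap_mono (by positivity) (by gcongr)
  have p1 := jap_pos (κ * √(t - s))
  have p2 := jap_pos (κ * √s)
  have p3 := jap_pos (κ * √t)
  have e1 : Real.exp (κ ^ 2 * (t - s) / 4) * Real.exp (κ ^ 2 * s / 2) ≤
      Real.exp (κ ^ 2 * t / 2) := by
    rw [← Real.exp_add]
    apply Real.exp_le_exp.2
    nlinarith [mul_nonneg (sq_nonneg κ) hτ.le]
  have e2 : jap (κ * √(t - s)) ^ σ * jap (κ * √s) ^ (3 / 2 : ℝ) ≤ jap (κ * √t) ^ (σ + 3 / 2) := by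
    rw [Real.rpow_add p3]
    gcongr
  calc ‖duhamelTerm κ σ Q t s‖ ≤ kerBound κ σ (t - s) * (D * s ^ (-(3 / 4) : ℝ) *
        jap (κ * √s) ^ (3 / 2 : ℝ) * Real.exp (κ ^ 2 * s / 2)) :=
        h1.trans (mul_le_mul_of_nonneg_left (hQ.norm_le s hsT) (kerBound_nonneg hτ.le))
    _ = 2 * D * (jap (κ * √(t - s)) ^ σ * jap (κ * √s) ^ (3 / 2 : ℝ)) *
        (Real.exp (κ ^ 2 * (t - s) / 4) * Real.exp (κ ^ 2 * s / 2)) *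
        ((t - s) ^ (-(σ / 2)) * s ^ (-(3 / 4) : ℝ)) := by rw [kerBound]; ring
    _ ≤ 2 * D * jap (κ * √t) ^ (σ + 3 / 2) * Real.exp (κ ^ 2 * t / 2) *
        ((t - s) ^ (-(σ / 2)) * s ^ (-(3 / 4) : ℝ)) := by gcongr
    _ = _ := by rw [timeBound]

lemma tendsto_toL2_wmul_eventually {ι : Type*} {l : Filter ι} [l.IsCountablyGenerated]
    {w : ι → R3 → ℝ} {w₀ : R3 → ℝ} {K : ℝ} (hw : ∀ i, Measurable (w i))
    (hK : ∀ᶠ i in l, ∀ ξ, |w i ξ| ≤ K) (hw₀ : Measurable w₀) (hK₀ : ∀ ξ, |w₀ ξ| ≤ K)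
    (hlim : ∀ ξ, Tendsto (fun i => w i ξ) l (𝓝 (w₀ ξ)))
    {g : ι → Lp F 2 (volume : Measure R3)} {g₀ : Lp F 2 (volume : Measure R3)}
    (hg : Tendsto g l (𝓝 g₀)) :
    Tendsto (fun i => toL2 (wmul (w i) (g i))) l (𝓝 (toL2 (wmul w₀ g₀))) := by
  classical
  let w' : ι → R3 → ℝ := fun i => if ∀ ξ, |w i ξ| ≤ K then w i else w₀
  have hev : ∀ᶠ i in l, w' i = w i := by
    filter_upwards [hK] with i hi
    simp only [w', if_pos hi]
  have h := tendsto_toL2_wmul (l := l) (w := w') (w₀ := w₀) (K := K) (fun i => by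
      by_cases hi : ∀ ξ, |w i ξ| ≤ K
      · simpa only [w', if_pos hi] using hw i
      · simpa only [w', if_neg hi] using hw₀) (fun i ξ => by
      by_cases hi : ∀ ξ, |w i ξ| ≤ K
      · simpa only [w', if_pos hi] using hi ξ
      · simpa only [w', if_neg hi] using hK₀ ξ) hw₀ hK₀ (ae_of_all _ fun ξ => by
      refine (hlim ξ).congr' ?_
      filter_upwards [hev] with i hi
      rw [hi]) hg
  refine h.congr' ?_
  filter_upwards [hev] with i hi
  rw [hi]

/-- The domain of the Duhamel kernel. -/
def kerDomain (T : ℝ) : Set (ℝ × ℝ) := {z | 0 < z.2 ∧ z.2 < z.1 ∧ z.1 ≤ T}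

/-- Near a point with `s < t` the kernels are uniformly bounded and converge pointwise, hence
strongly as multipliers; `Q` itself converges in `L²`. -/
lemma continuousOn_duhamelTerm (hκ : 0 ≤ κ) (hσ₀ : 0 ≤ σ) (hσ : σ ≤ 2)
    (hQ : ContinuousOn Q (Ioc 0 T)) :
    ContinuousOn (fun z : ℝ × ℝ => duhamelTerm κ σ Q z.1 z.2) (kerDomain T) := by
  intro z₀ hz₀
  obtain ⟨h1, h2, h3⟩ := hz₀
  obtain ⟨δ, hδ0, hδ⟩ : ∃ δ : ℝ, 0 < δ ∧ δ < z₀.1 - z₀.2 := exists_between (sub_pos.2 h2)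
  have hcont : Continuous fun z : ℝ × ℝ => z.1 - z.2 := by fun_prop
  have hev : ∀ᶠ z : ℝ × ℝ in 𝓝[kerDomain T] z₀, δ ≤ z.1 - z.2 ∧ z.1 ≤ T := by
    refine Filter.Eventually.and ?_ (eventually_mem_nhdsWithin.mono fun z hz => hz.2.2)
    exact nhdsWithin_le_nhds ((hcont.tendsto z₀).eventually (eventually_ge_nhds hδ))
  have hker (ξ : R3) : Continuous fun z : ℝ × ℝ => kerW κ σ z.1 z.2 ξ := by
    unfold kerW expPow heatW; fun_prop
  have h4 : Tendsto Q (𝓝[Ioc 0 T] z₀.2) (𝓝 (Q z₀.2)) := hQ z₀.2 ⟨h1, h2.le.trans h3⟩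
  have h5 : Tendsto (fun z : ℝ × ℝ => z.2) (𝓝[kerDomain T] z₀) (𝓝[Ioc 0 T] z₀.2) := by
    refine tendsto_nhdsWithin_iff.2 ⟨(continuous_snd.tendsto z₀).mono_left nhdsWithin_le_nhds, ?_⟩
    exact eventually_mem_nhdsWithin.mono fun z hz => ⟨hz.1, hz.2.1.le.trans hz.2.2⟩
  have hb (z : ℝ × ℝ) (hz : δ ≤ z.1 - z.2 ∧ z.1 ≤ T) (ξ : R3) :
      |kerW κ σ z.1 z.2 ξ| ≤ kerBound (κ * T / δ) σ δ := by
    rw [abs_of_nonneg (kerW_nonneg _ _ _ _ _)]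
    exact kerW_le_const hκ hδ0 hz.1 hz.2 hσ₀ hσ ξ
  exact tendsto_toL2_wmul_eventually (w := fun z : ℝ × ℝ => kerW κ σ z.1 z.2)
    (w₀ := kerW κ σ z₀.1 z₀.2) (K := kerBound (κ * T / δ) σ δ)
    (g := fun z : ℝ × ℝ => Q z.2) (g₀ := Q z₀.2)
    (fun z => measurable_kerW κ σ z.1 z.2) (hev.mono hb) (measurable_kerW _ _ _ _)
    (hb z₀ ⟨hδ.le, h3⟩) (fun ξ => ((hker ξ).tendsto z₀).mono_left nhdsWithin_le_nhds)
    (h4.comp h5)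

/-! ### The Duhamel integral -/

lemma integrableOn_beta {a b : ℝ} (ha : a < 1) (hb : b < 1) :
    IntegrableOn (fun r : ℝ => (1 - r) ^ (-a) * r ^ (-b)) (Ioo 0 1) := by
  have h := Complex.betaIntegral_convergent (u := ((1 - b : ℝ) : ℂ)) (v := ((1 - a : ℝ) : ℂ))
    (by simpa using hb) (by simpa using ha)
  rw [intervalIntegrable_iff_integrableOn_Ioo_of_le zero_le_one] at h
  have h' : IntegrableOn (fun r : ℝ => ‖(r : ℂ) ^ (((1 - b : ℝ) : ℂ) - 1) *
      (1 - (r : ℂ)) ^ (((1 - a : ℝ) : ℂ) - 1)‖) (Ioo 0 1) := h.norm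
  refine h'.congr_fun ?_ measurableSet_Ioo
  intro r hr
  have h1 : 0 < 1 - r := sub_pos.2 hr.2
  simp only
  rw [norm_mul, Complex.norm_cpow_eq_rpow_re_of_pos hr.1, show (1 - (r : ℂ)) = ((1 - r : ℝ) : ℂ) by
    push_cast; ring, Complex.norm_cpow_eq_rpow_re_of_pos h1, mul_comm]
  simp

/-- The integral `∫₀¹ (1-r)^{-σ/2} r^{-3/4} dr`. -/
def betaConst (σ : ℝ) : ℝ := ∫ r in Ioo (0 : ℝ) 1, (1 - r) ^ (-(σ / 2)) * r ^ (-(3 / 4) : ℝ)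

lemma betaConst_nonneg (σ : ℝ) : 0 ≤ betaConst σ := by
  refine setIntegral_nonneg measurableSet_Ioo fun r hr => ?_
  have h1 : 0 ≤ 1 - r := sub_nonneg.2 hr.2.le
  have h2 := hr.1.le
  positivity

/-- After the substitution `s = t r` all dependence on `t` sits in a prefactor, and the majorant in
`r` is a fixed Beta density. -/
lemma norm_duhamelTerm_mul_le (hκ : 0 ≤ κ) (hD : 0 ≤ D) (hσ₀ : 0 ≤ σ) (hσ : σ ≤ 2)
    (hQ : DuhamelBound κ D T Q) {t r : ℝ} (ht : t ∈ Ioc 0 T) (hr : r ∈ Ioo (0 : ℝ) 1) :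
    ‖duhamelTerm κ σ Q t (t * r)‖ ≤ timeBound κ D σ t * t ^ (-(σ / 2) - 3 / 4) *
      ((1 - r) ^ (-(σ / 2)) * r ^ (-(3 / 4) : ℝ)) := by
  have h1 : 0 < 1 - r := sub_pos.2 hr.2
  have htp := ht.1
  refine (norm_duhamelTerm_le hκ hD hσ₀ hσ hQ (mul_pos htp hr.1)
    (by nlinarith) ht.2).trans (le_of_eq ?_)
  rw [show t - t * r = t * (1 - r) by ring, Real.mul_rpow htp.le h1.le,
    Real.mul_rpow htp.le hr.1.le, Real.rpow_sub htp, Real.rpow_neg htp.le (3 / 4)]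
  ring

lemma continuousOn_duhamelTerm_mul (hκ : 0 ≤ κ) (hσ₀ : 0 ≤ σ) (hσ : σ ≤ 2)
    (hQ : ContinuousOn Q (Ioc 0 T)) {t : ℝ} (ht : t ∈ Ioc 0 T) :
    ContinuousOn (fun r => duhamelTerm κ σ Q t (t * r)) (Ioo 0 1) := by
  refine (continuousOn_duhamelTerm hκ hσ₀ hσ hQ).comp (f := fun r : ℝ => (t, t * r))
    (by fun_prop) fun r hr => ?_
  have := ht.1
  exact ⟨mul_pos this hr.1, by simp only; nlinarith [hr.2], ht.2⟩

lemma integrableOn_duhamelTerm_mul (hκ : 0 ≤ κ) (hD : 0 ≤ D) (hσ₀ : 0 ≤ σ) (hσ : σ < 2)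
    (hQ : DuhamelBound κ D T Q) {t : ℝ} (ht : t ∈ Ioc 0 T) :
    IntegrableOn (fun r => duhamelTerm κ σ Q t (t * r)) (Ioo 0 1) := by
  refine Integrable.mono' ((integrableOn_beta (a := σ / 2) (b := 3 / 4) (by linarith)
    (by norm_num)).const_mul (timeBound κ D σ t * t ^ (-(σ / 2) - 3 / 4)))
    ((continuousOn_duhamelTerm_mul hκ hσ₀ hσ.le hQ.continuousOn ht).aestronglyMeasurable
      measurableSet_Ioo) ?_
  filter_upwards [ae_restrict_mem measurableSet_Ioo] with r hr
  exact norm_duhamelTerm_mul_le hκ hD hσ₀ hσ.le hQ ht hr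

/-- The rescaled Duhamel integral `t⁻¹ e^{κtA} A^σ ∫₀ᵗ e^{-(t-s)A²} Q(s) ds`. -/
def duhamelMean (κ σ : ℝ) (Q : ℝ → Lp F 2 (volume : Measure R3)) (t : ℝ) :
    Lp F 2 (volume : Measure R3) := ∫ r in Ioo (0 : ℝ) 1, duhamelTerm κ σ Q t (t * r)

lemma norm_duhamelMean_le (hκ : 0 ≤ κ) (hD : 0 ≤ D) (hσ₀ : 0 ≤ σ) (hσ : σ < 2)
    (hQ : DuhamelBound κ D T Q) {t : ℝ} (ht : t ∈ Ioc 0 T) :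
    ‖duhamelMean κ σ Q t‖ ≤ timeBound κ D σ t * t ^ (-(σ / 2) - 3 / 4) * betaConst σ := by
  rw [betaConst, ← integral_const_mul]
  refine norm_integral_le_of_norm_le ((integrableOn_beta (a := σ / 2) (b := 3 / 4) (by linarith)
    (by norm_num)).const_mul _) ?_
  filter_upwards [ae_restrict_mem measurableSet_Ioo] with r hr
  exact norm_duhamelTerm_mul_le hκ hD hσ₀ hσ.le hQ ht hr

/-- On the fixed interval `(0,1)` dominated convergence applies: the prefactor is continuous in `t >
0`, hence locally bounded, and the Beta density is integrable. -/
lemma continuousOn_duhamelMean (hκ : 0 ≤ κ) (hD : 0 ≤ D) (hσ₀ : 0 ≤ σ) (hσ : σ < 2)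
    (hQ : DuhamelBound κ D T Q) : ContinuousOn (duhamelMean κ σ Q) (Ioc 0 T) := by
  intro t₀ ht₀
  have hc : ContinuousAt (fun t => timeBound κ D σ t * t ^ (-(σ / 2) - 3 / 4)) t₀ := by
    have h1 : ContinuousAt (fun t => timeBound κ D σ t) t₀ := by
      have h2 : Continuous fun t => jap (κ * √t) := continuous_jap.comp (by fun_prop)
      have h3 : Continuous fun t => jap (κ * √t) ^ (σ + 3 / 2) :=
        h2.rpow_const fun t => Or.inl (jap_pos _).ne'
      unfold timeBound
      fun_prop
    exact h1.fun_mul (ContinuousAt.rpow_const continuousAt_id (Or.inl ht₀.1.ne'))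
  set B := timeBound κ D σ t₀ * t₀ ^ (-(σ / 2) - 3 / 4) + 1 with hB
  have hev : ∀ᶠ t in 𝓝[Ioc 0 T] t₀, timeBound κ D σ t * t ^ (-(σ / 2) - 3 / 4) ≤ B :=
    nhdsWithin_le_nhds (hc.eventually (eventually_le_nhds (by rw [hB]; linarith)))
  refine continuousWithinAt_of_dominated
    (bound := fun r => B * ((1 - r) ^ (-(σ / 2)) * r ^ (-(3 / 4) : ℝ))) ?_ ?_ ?_ ?_
  · filter_upwards [self_mem_nhdsWithin] with t ht
    exact (integrableOn_duhamelTerm_mul hκ hD hσ₀ hσ hQ ht).aestronglyMeasurable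
  · filter_upwards [self_mem_nhdsWithin, hev] with t ht hb
    filter_upwards [ae_restrict_mem measurableSet_Ioo] with r hr
    refine (norm_duhamelTerm_mul_le hκ hD hσ₀ hσ.le hQ ht hr).trans ?_
    have h1 : 0 ≤ 1 - r := sub_nonneg.2 hr.2.le
    have h2 := hr.1.le
    gcongr
  · exact (integrableOn_beta (a := σ / 2) (b := 3 / 4) (by linarith) (by norm_num)).const_mul _
  · filter_upwards [ae_restrict_mem measurableSet_Ioo] with r hr
    have h := continuousOn_duhamelTerm hκ hσ₀ hσ.le hQ.continuousOn
    refine ContinuousWithinAt.comp (t := kerDomain T) (f := fun t : ℝ => (t, t * r))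
      (g := fun z : ℝ × ℝ => duhamelTerm κ σ Q z.1 z.2) (h _ ?_) (by fun_prop) ?_
    · exact ⟨mul_pos ht₀.1 hr.1, by simp only; nlinarith [hr.2, ht₀.1], ht₀.2⟩
    · intro t ht
      exact ⟨mul_pos ht.1 hr.1, by simp only; nlinarith [hr.2, ht.1], ht.2⟩

end MildNS
end

noncomputable section

namespace MildNS

set_option linter.unusedSectionVars false

open Filter Topology

variable {F : Type*} [NormedAddCommGroup F] [InnerProductSpace ℂ F] [CompleteSpace F]
variable {M : Matrix (Fin 3) (Fin 3) ℝ} {P : FiberedProjection}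
variable {κ D T σ : ℝ} {Q : ℝ → Lp F 2 (volume : Measure R3)}

/-! ### The bilinear operator of the integral equation -/

lemma one_le_expPow_zero {a : ℝ} (ha : 0 ≤ a) (ξ : R3) : 1 ≤ expPow a 0 ξ := by
  rw [expPow, Real.rpow_zero, mul_one]
  exact Real.one_le_exp (mul_nonneg ha (symA_nonneg ξ))

lemma wmul_kerW_zero (t s : ℝ) (g : R3 → F) : wmul (kerW 0 0 t s) g = wmul (heatW (t - s)) g := by
  ext1 ξ
  simp [wmul, kerW, expPow]

lemma wmul_expPow_kerW (κ σ t s : ℝ) (g : R3 → F) :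
    wmul (expPow (κ * t) σ) (wmul (kerW 0 0 t s) g) = wmul (kerW κ σ t s) g := by
  ext1 ξ
  simp [wmul, kerW, expPow, mul_smul]

/-- Dropping the exponential weight only decreases the norm, and on `(0,T]` the growth factors are
bounded by their values at `T`. Thus a weighted bound also covers the unweighted integral that
defines `B(u,v)(t)`. -/
lemma DuhamelBound.zero (hκ : 0 ≤ κ) (hD : 0 ≤ D) (hQ : DuhamelBound κ D T Q) :
    DuhamelBound 0 (D * jap (κ * √T) ^ (3 / 2 : ℝ) * Real.exp (κ ^ 2 * T / 2)) T Q := by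
  have e (s : ℝ) : wmul (expPow (0 * s) 0) (Q s) = Q s := by
    ext1 ξ; simp [wmul, expPow]
  refine ⟨hQ.continuousOn, fun s _ => by rw [e]; exact Lp.memLp _, fun s hs => ?_⟩
  have h1 : ‖Q s‖ ≤ 1 * ‖toL2 (wmul (expPow (κ * s) 0) (Q s))‖ := by
    have := norm_toL2_le (K := 1) (Lp.memLp (Q s)) (hQ.memLp s hs) (ae_of_all _ fun ξ => by
      rw [norm_wmul, one_mul, abs_of_nonneg (expPow_nonneg _ _ _)]
      exact le_mul_of_one_le_left (norm_nonneg _)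
        (one_le_expPow_zero (mul_nonneg hκ hs.1.le) ξ))
    rwa [toL2_coeFn] at this
  rw [e, toL2_coeFn]
  have j1 : jap (κ * √s) ≤ jap (κ * √T) := jap_mono (by positivity) (by gcongr; exact hs.2)
  have p1 := jap_pos (κ * √s)
  have p2 := jap_pos (κ * √T)
  have hs0 := hs.1
  have hs2 := hs.2
  calc ‖Q s‖ ≤ D * s ^ (-(3 / 4) : ℝ) * jap (κ * √s) ^ (3 / 2 : ℝ) * Real.exp (κ ^ 2 * s / 2) := by
        rw [one_mul] at h1
        exact h1.trans (hQ.norm_le s hs)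
    _ ≤ D * s ^ (-(3 / 4) : ℝ) * jap (κ * √T) ^ (3 / 2 : ℝ) * Real.exp (κ ^ 2 * T / 2) := by
        gcongr
    _ = _ := by simp [jap]; ring

lemma intervalIntegrable_duhamelTerm (hκ : 0 ≤ κ) (hD : 0 ≤ D) (hσ₀ : 0 ≤ σ) (hσ : σ < 2)
    (hQ : DuhamelBound κ D T Q) {t : ℝ} (ht : t ∈ Ioc 0 T) :
    IntervalIntegrable (duhamelTerm κ σ Q t) volume 0 t := by
  have h := integrableOn_duhamelTerm_mul hκ hD hσ₀ hσ hQ ht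
  rw [← intervalIntegrable_iff_integrableOn_Ioo_of_le zero_le_one] at h
  have h2 := IntervalIntegrable.comp_mul_left (c := t⁻¹) h
  simpa [ht.1.ne'] using h2

lemma integral_duhamelTerm {t : ℝ} (ht : 0 < t) :
    ∫ s in (0 : ℝ)..t, duhamelTerm κ σ Q t s = t • duhamelMean κ σ Q t := by
  have := intervalIntegral.integral_comp_mul_left (a := 0) (b := 1) (duhamelTerm κ σ Q t) ht.ne'
  rw [mul_zero, mul_one, intervalIntegral.integral_of_le zero_le_one,
    integral_Ioc_eq_integral_Ioo] at this
  rw [duhamelMean, this, smul_inv_smul₀ ht.ne']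

/-- The unbounded operator `e^{κtA}A^σ` passes under the integral by closedness, because both the
unweighted and the weighted integrands are integrable. -/
lemma wmul_duhamelMean (hκ : 0 ≤ κ) (hD : 0 ≤ D) (hσ₀ : 0 ≤ σ) (hσ : σ < 2)
    (hQ : DuhamelBound κ D T Q) {t : ℝ} (ht : t ∈ Ioc 0 T) :
    wmul (expPow (κ * t) σ) (duhamelMean 0 0 Q t) =ᵐ[volume] duhamelMean κ σ Q t := by
  have p2 := jap_pos (κ * √T)
  refine (integral_wmul (measurable_expPow _ _) (expPow_nonneg _ _)
    (integrableOn_duhamelTerm_mul le_rfl (by positivity) le_rfl two_pos (hQ.zero hκ hD) ht)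
    (integrableOn_duhamelTerm_mul hκ hD hσ₀ hσ hQ ht) ?_).symm
  filter_upwards [ae_restrict_mem measurableSet_Ioo] with r hr
  have hlt : t * r < t := by nlinarith [hr.2, ht.1]
  have h1 := coeFn_toL2 (memLp_duhamelTerm (κ := κ) (Q := Q) hκ hσ₀ hσ.le hlt)
  have h2 := coeFn_toL2 (memLp_duhamelTerm (κ := 0) (σ := 0) (Q := Q) le_rfl le_rfl two_pos.le hlt)
  refine h1.trans ?_
  rw [← wmul_expPow_kerW]
  exact wmul_congr _ h2.symm

/-- The Fourier transform of the bilinear term. -/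
def bilinHat (κ σ : ℝ) (Q : ℝ → Lp F 2 (volume : Measure R3)) (t : ℝ) :
    Lp F 2 (volume : Measure R3) := -(t • duhamelMean κ σ Q t)

lemma wmul_bilinHat (hκ : 0 ≤ κ) (hD : 0 ≤ D) (hσ₀ : 0 ≤ σ) (hσ : σ < 2)
    (hQ : DuhamelBound κ D T Q) {t : ℝ} (ht : t ∈ Ioc 0 T) :
    wmul (expPow (κ * t) σ) (bilinHat 0 0 Q t) =ᵐ[volume] bilinHat κ σ Q t := by
  filter_upwards [wmul_duhamelMean hκ hD hσ₀ hσ hQ ht, Lp.coeFn_neg (t • duhamelMean 0 0 Q t),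
    Lp.coeFn_neg (t • duhamelMean κ σ Q t), Lp.coeFn_smul t (duhamelMean 0 0 Q t),
    Lp.coeFn_smul t (duhamelMean κ σ Q t)] with ξ h1 h2 h3 h4 h5
  simp only [wmul, bilinHat, h2, h3, h4, h5, Pi.neg_apply, Pi.smul_apply, ← h1, smul_neg,
    smul_comm t]

/-- The power `t^{1/4-σ/2}` is `t^{-3/8}` for `σ = 5/4`, constant for `σ = 1/2`, and `t^{1/4}` for
`σ = 0`; these are the three time dependences of the final bounds. -/
lemma norm_bilinHat_le (hκ : 0 ≤ κ) (hD : 0 ≤ D) (hσ₀ : 0 ≤ σ) (hσ : σ < 2)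
    (hQ : DuhamelBound κ D T Q) {t : ℝ} (ht : t ∈ Ioc 0 T) :
    ‖bilinHat κ σ Q t‖ ≤ timeBound κ D σ t * t ^ (1 / 4 - σ / 2) * betaConst σ := by
  have h := norm_duhamelMean_le hκ hD hσ₀ hσ hQ ht
  have ht0 := ht.1
  have e : t ^ (1 / 4 - σ / 2) = t * t ^ (-(σ / 2) - 3 / 4) := by
    nth_rewrite 2 [← Real.rpow_one t]
    rw [← Real.rpow_add ht0]
    congr 1; ring
  rw [bilinHat, norm_neg, norm_smul, Real.norm_of_nonneg ht0.le, e]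
  calc t * ‖duhamelMean κ σ Q t‖ ≤ t * (timeBound κ D σ t * t ^ (-(σ / 2) - 3 / 4) * betaConst σ) := by
        gcongr
    _ = _ := by ring

lemma continuousOn_bilinHat (hκ : 0 ≤ κ) (hD : 0 ≤ D) (hσ₀ : 0 ≤ σ) (hσ : σ < 2)
    (hQ : DuhamelBound κ D T Q) : ContinuousOn (bilinHat κ σ Q) (Ioc 0 T) :=
  (continuousOn_id.smul (continuousOn_duhamelMean hκ hD hσ₀ hσ hQ)).neg

/-- The nonlinear term along two paths, in Fourier space. -/
def pathNonlin (M : Matrix (Fin 3) (Fin 3) ℝ) (P : FiberedProjection)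
    (u v : ℝ → 𝓢'(R3, C3)) (s : ℝ) : L2V := nonlin M P (hat54 (u s)) (hat54 (v s))

lemma duhamelIntegrand_eq_duhamelTerm {u v : ℝ → 𝓢'(R3, C3)} {t s : ℝ} (hu : MemHom (5 / 4) (u s))
    (hv : MemHom (5 / 4) (v s)) : duhamelIntegrand M P u v t s =
      (Lp.fourierTransformₗᵢ R3 C3).symm (duhamelTerm 0 0 (pathNonlin M P u v) t s) := by
  rw [duhamelIntegrand_eq hu hv, duhamelTerm, wmul_kerW_zero]
  rfl

lemma duhamelExists (hκ : 0 ≤ κ) (hD : 0 ≤ D) {u v : ℝ → 𝓢'(R3, C3)} {t : ℝ} (ht : t ∈ Ioc 0 T)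
    (hu : ∀ s ∈ Ioc 0 t, MemHom (5 / 4) (u s)) (hv : ∀ s ∈ Ioc 0 t, MemHom (5 / 4) (v s))
    (hQ : DuhamelBound κ D T (pathNonlin M P u v)) : DuhamelExists M P u v t := by
  refine ⟨fun s hs => (convection_spec (hu s hs) (hv s hs)).1, ?_⟩
  have p2 := jap_pos (κ * √T)
  have h := intervalIntegrable_duhamelTerm le_rfl (by positivity) le_rfl two_pos (hQ.zero hκ hD) ht
  rw [intervalIntegrable_iff_integrableOn_Ioc_of_le ht.1.le] at h ⊢
  refine IntegrableOn.congr_fun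
    ((Lp.fourierTransformₗᵢ R3 C3).symm.toContinuousLinearEquiv.toContinuousLinearMap.integrable_comp
      h) (fun s hs => ?_) measurableSet_Ioc
  exact (duhamelIntegrand_eq_duhamelTerm (hu s hs) (hv s hs)).symm

lemma bilin_eq {u v : ℝ → 𝓢'(R3, C3)} {t : ℝ} (ht : 0 < t)
    (hu : ∀ s ∈ Ioc 0 t, MemHom (5 / 4) (u s)) (hv : ∀ s ∈ Ioc 0 t, MemHom (5 / 4) (v s)) :
    bilin M P u v t =
      Lp.toTemperedDistribution (𝓕⁻ (bilinHat 0 0 (pathNonlin M P u v) t) : L2V) := by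
  rw [bilin, bilinHat, ← integral_duhamelTerm ht, intervalIntegral.integral_of_le ht.le,
    intervalIntegral.integral_of_le ht.le]
  have e : ∫ s in Ioc 0 t, duhamelIntegrand M P u v t s =
      ∫ s in Ioc 0 t, (Lp.fourierTransformₗᵢ R3 C3).symm.toContinuousLinearEquiv
        (duhamelTerm 0 0 (pathNonlin M P u v) t s) :=
    setIntegral_congr_fun measurableSet_Ioc fun s hs =>
      duhamelIntegrand_eq_duhamelTerm (hu s hs) (hv s hs)
  rw [e, ContinuousLinearEquiv.integral_comp_comm, ← map_neg]
  rfl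

lemma fourier_bilin {u v : ℝ → 𝓢'(R3, C3)} {t : ℝ} (ht : 0 < t)
    (hu : ∀ s ∈ Ioc 0 t, MemHom (5 / 4) (u s)) (hv : ∀ s ∈ Ioc 0 t, MemHom (5 / 4) (v s)) :
    IsRepresentedBy (𝓕 (bilin M P u v t)) (bilinHat 0 0 (pathNonlin M P u v) t) := by
  have h := fourier_toTD (𝓕⁻ (bilinHat 0 0 (pathNonlin M P u v) t) : L2V)
  rwa [FourierTransform.fourier_fourierInv_eq, ← bilin_eq ht hu hv] at h

lemma inDomain_bilin (hκ : 0 ≤ κ) (hD : 0 ≤ D) (hσ₀ : 0 ≤ σ) (hσ : σ < 2)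
    {u v : ℝ → 𝓢'(R3, C3)} {t : ℝ} (ht : t ∈ Ioc 0 T)
    (hu : ∀ s ∈ Ioc 0 t, MemHom (5 / 4) (u s)) (hv : ∀ s ∈ Ioc 0 t, MemHom (5 / 4) (v s))
    (hQ : DuhamelBound κ D T (pathNonlin M P u v)) :
    InDomain (expPow (κ * t) σ) (bilin M P u v t) ∧
      hatMul (expPow (κ * t) σ) (bilin M P u v t) = bilinHat κ σ (pathNonlin M P u v) t := by
  have hr := fourier_bilin (M := M) (P := P) ht.1 hu hv
  have h1 := wmul_bilinHat hκ hD hσ₀ hσ hQ ht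
  exact ⟨hr.inDomain ((Lp.memLp _).ae_eq h1.symm), (hr.hatMul _).trans (toL2_eq h1)⟩

end MildNS
end

noncomputable section

namespace MildNS

set_option linter.unusedSectionVars false

open Filter Topology

variable {F : Type*} [NormedAddCommGroup F] [InnerProductSpace ℂ F] [CompleteSpace F]
variable {M : Matrix (Fin 3) (Fin 3) ℝ} {P : FiberedProjection}

/-! ### The weighted path spaces -/

lemma lam_eq (lam0 T : ℝ) {t : ℝ} (ht : 0 ≤ t) : lam lam0 T t = lam0 / √T * √t := by
  rw [lam, Real.sqrt_div ht]; ring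

/-- Linearity in `t` is the reason for letting `λ` grow like `√t`: it makes the splitting in
`kerW_le` exact. -/
lemma theta_eq (lam0 T : ℝ) {t : ℝ} (ht : 0 ≤ t) : theta lam0 T t = lam0 / √T * t := by
  rw [theta, lam_eq lam0 T ht, mul_assoc, Real.mul_self_sqrt ht]

lemma exp_zeta (lam0 T t : ℝ) : Real.exp (zeta lam0 T t) =
    Real.exp (lam lam0 T t ^ 2 / 4) * jap (lam lam0 T t) ^ (3 / 4 : ℝ) := by
  rw [zeta, Real.exp_add, Real.rpow_def_of_pos (jap_pos _), mul_comm (3 / 4 : ℝ)]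

lemma continuous_lam (lam0 T : ℝ) : Continuous (lam lam0 T) := by unfold lam; fun_prop

lemma continuous_zeta (lam0 T : ℝ) : Continuous (zeta lam0 T) := by
  have h1 := continuous_lam lam0 T
  have h2 : Continuous fun t => Real.log (jap (lam lam0 T t)) :=
    (continuous_jap.comp h1).log fun t => (jap_pos _).ne'
  unfold zeta
  fun_prop

lemma continuous_theta (lam0 T : ℝ) : Continuous (theta lam0 T) := by
  have h1 := continuous_lam lam0 T
  unfold theta
  fun_prop

lemma theta_nonneg {lam0 : ℝ} (h : 0 ≤ lam0) (T t : ℝ) : 0 ≤ theta lam0 T t := by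
  unfold theta lam; positivity

lemma zeta_zero (T : ℝ) : zeta 0 T = 0 := by ext1 t; simp [zeta, lam, jap]

lemma theta_zero (T : ℝ) : theta 0 T = 0 := by ext1 t; simp [theta, lam]

lemma lam_le {lam0 T t : ℝ} (h : 0 ≤ lam0) (ht : t ∈ Ioc 0 T) : lam lam0 T t ≤ lam0 := by
  have hT := ht.1.trans_le ht.2
  refine mul_le_of_le_one_right h ?_
  exact Real.sqrt_le_one.2 ((div_le_one hT).2 ht.2)

lemma lam_nonneg {lam0 : ℝ} (h : 0 ≤ lam0) (T t : ℝ) : 0 ≤ lam lam0 T t := by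
  unfold lam; positivity

/-- `A^σ f` is recovered from `e^{aA} A^σ f`. -/
lemma InDomain.expPow_zero {a σ : ℝ} (ha : 0 ≤ a) {f : 𝓢'(R3, F)} (h : InDomain (expPow a σ) f) :
    InDomain (expPow 0 σ) f ∧
      hatMul (expPow 0 σ) f = toL2 (wmul (expPow (-a) 0) (hatMul (expPow a σ) f)) := by
  have h1 := memLp_of_wmul_expPow ha h.rep.aestronglyMeasurable h.memLp
  refine ⟨h.rep.inDomain h1, (h.rep.hatMul _).trans (toL2_congr ?_)⟩
  filter_upwards [h.coeFn_hatMul] with ξ hξ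
  simp only [wmul, hξ, smul_smul, expPow, ← Complex.ofReal_mul, Real.rpow_zero, mul_one,
    ← mul_assoc, ← Real.exp_add]
  congr 4
  ring

lemma expPow_neg_le_one {a : ℝ} (ha : 0 ≤ a) (ξ : R3) : |expPow (-a) 0 ξ| ≤ 1 := by
  rw [abs_of_nonneg (expPow_nonneg _ _ _), expPow, Real.rpow_zero, mul_one, Real.exp_le_one_iff]
  nlinarith [mul_nonneg ha (symA_nonneg ξ)]

variable {ζ θ : ℝ → ℝ} {I : Set ℝ} {u v : ℝ → 𝓢'(R3, C3)}

lemma normB_nonneg (hI : I ⊆ Ioi 0) : 0 ≤ normB ζ θ I v := by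
  refine Real.sSup_nonneg ?_
  rintro _ ⟨t, ht, rfl⟩
  have : 0 < t := hI ht
  have h2 : 0 ≤ expNorm (θ t) (5 / 4) (v t) := norm_nonneg _
  positivity

lemma MemB.norm_hatMul_le (hI : I ⊆ Ioi 0) (hv : MemB ζ θ I v) {t : ℝ} (ht : t ∈ I) :
    ‖hatMul (expPow (θ t) (5 / 4)) (v t)‖ ≤
      normB ζ θ I v * (t ^ (-(3 / 8) : ℝ) * Real.exp (ζ t)) := by
  have h0 : 0 < t := hI ht
  have h := le_csSup hv.bounded (mem_image_of_mem _ ht)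
  simp only [expNorm_eq] at h
  have h2 : (Real.exp (-ζ t) * t ^ (3 / 8 : ℝ)) * (t ^ (-(3 / 8) : ℝ) * Real.exp (ζ t)) = 1 := by
    rw [show ∀ a b c d : ℝ, (a * b) * (c * d) = (a * d) * (b * c) by intros; ring,
      ← Real.rpow_add h0, ← Real.exp_add]
    simp
  calc ‖hatMul (expPow (θ t) (5 / 4)) (v t)‖ =
      (Real.exp (-ζ t) * t ^ (3 / 8 : ℝ) * ‖hatMul (expPow (θ t) (5 / 4)) (v t)‖) *
        (t ^ (-(3 / 8) : ℝ) * Real.exp (ζ t)) := by rw [mul_right_comm, h2, one_mul]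
    _ ≤ _ := by
      refine mul_le_mul_of_nonneg_right ?_ (by positivity)
      simpa only [normB, expNorm_eq] using h

lemma MemB.continuousOn_hatMul (hI : I ⊆ Ioi 0) (hζ : ContinuousOn ζ I) (hv : MemB ζ θ I v) :
    ContinuousOn (fun t => hatMul (expPow (θ t) (5 / 4)) (v t)) I := by
  have h1 : ContinuousOn (fun t => (Lp.fourierTransformₗᵢ R3 C3)
      ((Real.exp (-ζ t) * t ^ (3 / 8 : ℝ))⁻¹ • ((Real.exp (-ζ t) * t ^ (3 / 8 : ℝ)) •
        applyMul (expPow (θ t) (5 / 4)) (v t)))) I := by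
    refine (LinearIsometryEquiv.continuous _).comp_continuousOn
      (ContinuousOn.fun_smul ?_ hv.continuousOn)
    refine ContinuousOn.fun_inv₀ ?_ fun t ht => ?_
    · refine ContinuousOn.fun_mul (by fun_prop) (ContinuousOn.rpow_const continuousOn_id fun t _ => ?_)
      exact Or.inr (by norm_num)
    · have : 0 < t := hI ht
      positivity
  refine h1.congr fun t ht => ?_
  have : 0 < t := hI ht
  simp only
  rw [inv_smul_smul₀ (by positivity), applyMul_eq]
  exact ((Lp.fourierTransformₗᵢ R3 C3).apply_symm_apply _).symm

lemma memB_of_bound (hζ : ContinuousOn ζ I) {K : ℝ} (hK : 0 ≤ K)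
    (h1 : ∀ t ∈ I, MemHom (5 / 4) (v t)) (h2 : ∀ t ∈ I, InDomain (expPow (θ t) (5 / 4)) (v t))
    (h3 : ContinuousOn (fun t => hatMul (expPow (θ t) (5 / 4)) (v t)) I)
    (h4 : ∀ t ∈ I, Real.exp (-ζ t) * t ^ (3 / 8 : ℝ) * ‖hatMul (expPow (θ t) (5 / 4)) (v t)‖ ≤ K) :
    MemB ζ θ I v ∧ normB ζ θ I v ≤ K := by
  have h5 : ∀ x ∈ ((fun t => Real.exp (-ζ t) * t ^ (3 / 8 : ℝ) * expNorm (θ t) (5 / 4) (v t)) '' I),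
      x ≤ K := by
    rintro _ ⟨t, ht, rfl⟩
    simpa only [expNorm_eq] using h4 t ht
  refine ⟨⟨h1, h2, ?_, ⟨K, h5⟩⟩, Real.sSup_le h5 hK⟩
  refine ContinuousOn.fun_smul ?_ ?_
  · refine ContinuousOn.fun_mul (by fun_prop) (ContinuousOn.rpow_const continuousOn_id fun t _ => ?_)
    exact Or.inr (by norm_num)
  · exact (Lp.fourierTransformₗᵢ R3 C3).symm.continuous.comp_continuousOn h3

/-- `A^{5/4}v` is recovered by applying `e^{-θA}`, a family of contractions that is strongly
continuous in `t`. -/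
lemma MemB.continuousOn_hat54 (hI : I ⊆ Ioi 0) (hζ : ContinuousOn ζ I) (hθ : ContinuousOn θ I)
    (hθ0 : ∀ t ∈ I, 0 ≤ θ t) (hv : MemB ζ θ I v) : ContinuousOn (fun t => hat54 (v t)) I := by
  intro t₀ ht₀
  have h := hv.continuousOn_hatMul hI hζ t₀ ht₀
  have h2 := tendsto_toL2_wmul_eventually (l := 𝓝[I] t₀) (w := fun t => expPow (-θ t) 0)
    (w₀ := expPow (-θ t₀) 0) (K := 1) (fun t => measurable_expPow _ _)
    (eventually_mem_nhdsWithin.mono fun t ht => expPow_neg_le_one (hθ0 t ht))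
    (measurable_expPow _ _) (expPow_neg_le_one (hθ0 t₀ ht₀)) (fun ξ => by
      have : ContinuousWithinAt (fun t => expPow (-θ t) 0 ξ) I t₀ := by
        have := hθ t₀ ht₀
        unfold expPow
        fun_prop
      exact this) h
  refine (h2.congr' ?_).trans_eq ?_
  · filter_upwards [self_mem_nhdsWithin] with t ht
    exact ((hv.inDomain t ht).expPow_zero (hθ0 t ht)).2.symm
  · exact congrArg 𝓝 ((hv.inDomain t₀ ht₀).expPow_zero (hθ0 t₀ ht₀)).2.symm

/-! ### The bilinear estimate in the weighted spaces -/

lemma duhamelBound_of_le {lam0 T Nu Nv : ℝ} (h0 : 0 ≤ lam0) (hN : 0 ≤ Nu)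
    (cu : ContinuousOn (fun t => hat54 (u t)) (Ioc 0 T))
    (cv : ContinuousOn (fun t => hat54 (v t)) (Ioc 0 T))
    (du : ∀ s ∈ Ioc 0 T, InDomain (expPow (theta lam0 T s) (5 / 4)) (u s))
    (dv : ∀ s ∈ Ioc 0 T, InDomain (expPow (theta lam0 T s) (5 / 4)) (v s))
    (bu : ∀ s ∈ Ioc 0 T, ‖hatMul (expPow (theta lam0 T s) (5 / 4)) (u s)‖ ≤
      Nu * (s ^ (-(3 / 8) : ℝ) * Real.exp (zeta lam0 T s)))
    (bv : ∀ s ∈ Ioc 0 T, ‖hatMul (expPow (theta lam0 T s) (5 / 4)) (v s)‖ ≤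
      Nv * (s ^ (-(3 / 8) : ℝ) * Real.exp (zeta lam0 T s))) :
    DuhamelBound (lam0 / √T) (√(convectionConst M).toReal * Nu * Nv) T (pathNonlin M P u v) := by
  have hn (s : ℝ) (hs : s ∈ Ioc 0 T) := norm_nonlin_le (M := M) (P := P) (theta_nonneg h0 T s)
    ((du s hs).expPow_zero (theta_nonneg h0 T s)).1 ((dv s hs).expPow_zero (theta_nonneg h0 T s)).1
    (du s hs) (dv s hs)
  refine ⟨?_, fun s hs => ?_, fun s hs => ?_⟩
  · have c3 : ContinuousOn (fun s => (hat54 (u s), hat54 (v s))) (Ioc 0 T) := cu.prodMk cv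
    have c4 : Continuous (fun z : L2V × L2V => nonlin M P z.1 z.2) := continuous_nonlin
    refine (c4.comp_continuousOn c3).congr fun s _ => ?_
    simp only [Function.comp, pathNonlin]
  · have h := (hn s hs).1
    rw [pathNonlin, ← theta_eq lam0 T hs.1.le]
    exact h
  · have h := (hn s hs).2
    have h1 := bu s hs
    have h2 := bv s hs
    have hs0 := hs.1
    -- Each factor carries the weight `s^{-3/8} e^{ζ(s)}`; its square is precisely the growth
    -- allowed in `DuhamelBound`.
    have e1 : (s ^ (-(3 / 8) : ℝ) * Real.exp (zeta lam0 T s)) ^ 2 = s ^ (-(3 / 4) : ℝ) *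
        jap (lam0 / √T * √s) ^ (3 / 2 : ℝ) * Real.exp ((lam0 / √T) ^ 2 * s / 2) := by
      have p := jap_pos (lam lam0 T s)
      rw [exp_zeta, mul_pow, mul_pow, ← Real.rpow_mul_natCast hs0.le, ← Real.rpow_mul_natCast p.le,
        ← Real.exp_nat_mul, lam_eq lam0 T hs0.le]
      rw [mul_pow _ (√s), Real.sq_sqrt hs0.le]
      norm_num
      ring_nf
    rw [pathNonlin, ← theta_eq lam0 T hs0.le]
    refine h.trans ?_
    clear h hn cu cv du dv bu bv
    generalize ‖hatMul (expPow (theta lam0 T s) (5 / 4)) (u s)‖ = x at h1 ⊢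
    have hy : 0 ≤ ‖hatMul (expPow (theta lam0 T s) (5 / 4)) (v s)‖ := norm_nonneg _
    generalize ‖hatMul (expPow (theta lam0 T s) (5 / 4)) (v s)‖ = y at h2 hy ⊢
    have hw : 0 ≤ s ^ (-(3 / 8) : ℝ) * Real.exp (zeta lam0 T s) := by positivity
    generalize s ^ (-(3 / 8) : ℝ) * Real.exp (zeta lam0 T s) = z at *
    calc _ ≤ √(convectionConst M).toReal * (Nu * z) * (Nv * z) := by gcongr
      _ = √(convectionConst M).toReal * Nu * Nv * z ^ 2 := by ring
      _ = _ := by rw [e1]; ring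

lemma duhamelBound_pathNonlin {lam0 T : ℝ} (h0 : 0 ≤ lam0)
    (hu : MemB (zeta lam0 T) (theta lam0 T) (Ioc 0 T) u)
    (hv : MemB (zeta lam0 T) (theta lam0 T) (Ioc 0 T) v) :
    DuhamelBound (lam0 / √T) (√(convectionConst M).toReal *
      normB (zeta lam0 T) (theta lam0 T) (Ioc 0 T) u *
      normB (zeta lam0 T) (theta lam0 T) (Ioc 0 T) v) T (pathNonlin M P u v) := by
  have hI : Ioc 0 T ⊆ Ioi 0 := fun t ht => ht.1
  exact duhamelBound_of_le h0 (normB_nonneg hI)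
    (hu.continuousOn_hat54 hI (continuous_zeta _ _).continuousOn
      (continuous_theta _ _).continuousOn fun t _ => theta_nonneg h0 T t)
    (hv.continuousOn_hat54 hI (continuous_zeta _ _).continuousOn
      (continuous_theta _ _).continuousOn fun t _ => theta_nonneg h0 T t)
    hu.inDomain hv.inDomain (fun _ hs => hu.norm_hatMul_le hI hs)
    fun _ hs => hv.norm_hatMul_le hI hs

theorem exists_isBilinearConstant (M : Matrix (Fin 3) (Fin 3) ℝ) (P : FiberedProjection) :
    ∃ C₃, IsBilinearConstant M P C₃ := by
  have hβ := betaConst_nonneg (5 / 4)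
  -- The summand `1` only makes the constant strictly positive.
  refine ⟨2 * √(convectionConst M).toReal * betaConst (5 / 4) + 1, by positivity, ?_⟩
  intro lam0 T h0 hT u v hu hv
  have hI : Ioc 0 T ⊆ Ioi 0 := fun t ht => ht.1
  set κ := lam0 / √T with hκ_def
  have hκ : 0 ≤ κ := by positivity
  have hNu : 0 ≤ normB (zeta lam0 T) (theta lam0 T) (Ioc 0 T) u := normB_nonneg hI
  have hNv : 0 ≤ normB (zeta lam0 T) (theta lam0 T) (Ioc 0 T) v := normB_nonneg hI
  set Nu := normB (zeta lam0 T) (theta lam0 T) (Ioc 0 T) u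
  set Nv := normB (zeta lam0 T) (theta lam0 T) (Ioc 0 T) v
  have hQ : DuhamelBound κ (√(convectionConst M).toReal * Nu * Nv) T (pathNonlin M P u v) :=
    duhamelBound_pathNonlin (M := M) (P := P) h0 hu hv
  have hD : 0 ≤ √(convectionConst M).toReal * Nu * Nv :=
    mul_nonneg (mul_nonneg (Real.sqrt_nonneg _) hNu) hNv
  have su (t : ℝ) (ht : t ∈ Ioc 0 T) (s : ℝ) (hs : s ∈ Ioc 0 t) : MemHom (5 / 4) (u s) :=
    hu.memHom s ⟨hs.1, hs.2.trans ht.2⟩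
  have sv (t : ℝ) (ht : t ∈ Ioc 0 T) (s : ℝ) (hs : s ∈ Ioc 0 t) : MemHom (5 / 4) (v s) :=
    hv.memHom s ⟨hs.1, hs.2.trans ht.2⟩
  have hdom (t : ℝ) (ht : t ∈ Ioc 0 T) := inDomain_bilin (σ := 5 / 4) hκ hD (by norm_num)
    (by norm_num) ht (su t ht) (sv t ht) hQ
  have hC : 0 ≤ 2 * √(convectionConst M).toReal * betaConst (5 / 4) + 1 := by positivity
  have hK : 0 ≤ (2 * √(convectionConst M).toReal * betaConst (5 / 4) + 1) * jap lam0 ^ 2 *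
      Real.exp (lam0 ^ 2 / 4) * Nu * Nv :=
    mul_nonneg (mul_nonneg (mul_nonneg (mul_nonneg hC (sq_nonneg _)) (Real.exp_nonneg _)) hNu) hNv
  refine ⟨fun t ht => duhamelExists hκ hD ht (su t ht) (sv t ht) hQ,
    memB_of_bound (continuous_zeta _ _).continuousOn hK (fun t ht => ?_)
      (fun t ht => ?_) ?_ fun t ht => ?_⟩
  · exact ((hdom t ht).1.expPow_zero (mul_nonneg hκ ht.1.le)).1
  · rw [theta_eq _ _ ht.1.le]; exact (hdom t ht).1
  · refine (continuousOn_bilinHat (σ := 5 / 4) hκ hD (by norm_num) (by norm_num) hQ).congr fun t ht => ?_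
    simp only [theta_eq lam0 T ht.1.le]
    exact (hdom t ht).2
  · have hb := norm_bilinHat_le (σ := 5 / 4) hκ hD (by norm_num) (by norm_num) hQ ht
    have ht0 := ht.1
    rw [theta_eq lam0 T ht0.le, (hdom t ht).2]
    clear hdom hQ su sv hu hv hK hD
    generalize ‖bilinHat κ (5 / 4) (pathNonlin M P u v) t‖ = x at hb ⊢
    clear_value Nu Nv
    have hl : lam lam0 T t = κ * √t := lam_eq _ _ ht0.le
    have p := jap_pos (lam lam0 T t)
    have e0 : Real.exp (-zeta lam0 T t) * Real.exp (zeta lam0 T t) = 1 := by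
      rw [← Real.exp_add]; simp
    -- With `σ = 5/4` the bracket has exponent `2 + 3/4`. One factor `⟨λ⟩^{3/4} e^{λ²/4} = e^ζ` is
    -- removed by the norm, and `⟨λ⟩² e^{λ²/4}` is the loss in the bilinear estimate.
    have e1 : timeBound κ (√(convectionConst M).toReal * Nu * Nv) (5 / 4) t =
        2 * (√(convectionConst M).toReal * Nu * Nv) * jap (lam lam0 T t) ^ 2 *
          Real.exp (lam lam0 T t ^ 2 / 4) * Real.exp (zeta lam0 T t) := by
      rw [timeBound, ← hl, exp_zeta, show (5 / 4 + 3 / 2 : ℝ) = 2 + 3 / 4 by norm_num,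
        Real.rpow_add p, Real.rpow_two]
      have : Real.exp (κ ^ 2 * t / 2) =
          Real.exp (lam lam0 T t ^ 2 / 4) * Real.exp (lam lam0 T t ^ 2 / 4) := by
        rw [← Real.exp_add, hl, mul_pow, Real.sq_sqrt ht0.le]; congr 1; ring
      rw [this]; ring
    -- Scale invariance: no power of `t` is left, so the constant does not depend on `T`.
    have e2 : t ^ (3 / 8 : ℝ) * t ^ (1 / 4 - (5 / 4) / 2 : ℝ) = 1 := by
      rw [← Real.rpow_add ht0]; norm_num
    have j1 := jap_mono (lam_nonneg h0 T t) (lam_le h0 ht)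
    have j2 := lam_le h0 ht
    have j3 := lam_nonneg h0 T t
    calc _ ≤ Real.exp (-zeta lam0 T t) * t ^ (3 / 8 : ℝ) *
        (timeBound κ (√(convectionConst M).toReal * Nu * Nv) (5 / 4) t *
          t ^ (1 / 4 - (5 / 4) / 2 : ℝ) * betaConst (5 / 4)) := by gcongr
      _ = (Real.exp (-zeta lam0 T t) * Real.exp (zeta lam0 T t)) *
          (t ^ (3 / 8 : ℝ) * t ^ (1 / 4 - (5 / 4) / 2 : ℝ)) *
          (2 * √(convectionConst M).toReal * betaConst (5 / 4) * jap (lam lam0 T t) ^ 2 *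
            Real.exp (lam lam0 T t ^ 2 / 4) * Nu * Nv) := by rw [e1]; ring
      _ = 2 * √(convectionConst M).toReal * betaConst (5 / 4) * jap (lam lam0 T t) ^ 2 *
            Real.exp (lam lam0 T t ^ 2 / 4) * Nu * Nv := by rw [e0, e2]; ring
      _ ≤ (2 * √(convectionConst M).toReal * betaConst (5 / 4) + 1) * jap lam0 ^ 2 *
            Real.exp (lam0 ^ 2 / 4) * Nu * Nv := by
        gcongr
        linarith

end MildNS
end

noncomputable section

namespace MildNS

set_option linter.unusedSectionVars false

open Filter Topology

variable {F : Type*} [NormedAddCommGroup F] [InnerProductSpace ℂ F] [CompleteSpace F]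

/-! ### The heat semigroup -/

lemma norm_iteratedFDerivWithin_exp_neg (n : ℕ) {x : ℝ} (hx : x ∈ Ici (0 : ℝ)) :
    ‖iteratedFDerivWithin ℝ n (fun x => Real.exp (-x)) (Ici 0) x‖ ≤ 1 := by
  have hc : ContDiff ℝ n fun x : ℝ => Real.exp (-x) := by fun_prop
  rw [iteratedFDerivWithin_eq_iteratedFDeriv (uniqueDiffOn_Ici 0) hc.contDiffAt hx,
    norm_iteratedFDeriv_eq_norm_iteratedDeriv, iteratedDeriv_comp_neg n Real.exp x]
  simp only [iteratedDeriv_eq_iterate, Real.iter_deriv_exp]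
  simp only [norm_smul, norm_pow, norm_neg, norm_one, one_pow, one_mul,
    Real.norm_eq_abs, Real.abs_exp, Real.exp_le_one_iff]
  simpa using hx

/-- `e^{-x}` does not have temperate growth on the whole line, but its derivatives are bounded on
`[0,∞)`, where `tA²` takes its values. -/
lemma hasTemperateGrowth_heat {t : ℝ} (ht : 0 ≤ t) :
    (fun ξ : R3 => ((Real.exp (-(t * symA ξ ^ 2)) : ℝ) : ℂ)).HasTemperateGrowth := by
  have h1 : (fun ξ : R3 => t * symA ξ ^ 2).HasTemperateGrowth := by
    have : (fun ξ : R3 => t * symA ξ ^ 2) = fun ξ => (t * (2 * Real.pi) ^ 2) * ‖ξ‖ ^ 2 := by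
      ext1 ξ; rw [symA]; ring
    rw [this]
    have h2 := Function.hasTemperateGrowth_norm_sq R3
    fun_prop
  have h2 : ((fun x : ℝ => Real.exp (-x)) ∘ fun ξ : R3 => t * symA ξ ^ 2).HasTemperateGrowth := by
    refine Function.HasTemperateGrowth.comp' (t := Ici (0 : ℝ)) ?_ (uniqueDiffOn_Ici 0)
      (by fun_prop) (fun N => ⟨0, 1, zero_le_one, fun n _ x hx => ?_⟩) h1
    · rintro _ ⟨ξ, rfl⟩
      exact mul_nonneg ht (sq_nonneg _)
    · simpa using norm_iteratedFDerivWithin_exp_neg n hx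
  exact (Function.HasTemperateGrowth.comp Complex.ofRealCLM.hasTemperateGrowth h2 :)

lemma fourier_heat {t : ℝ} (ht : 0 ≤ t) {f : 𝓢'(R3, F)} {g : R3 → F}
    (h : IsRepresentedBy (𝓕 f) g) : IsRepresentedBy (𝓕 (heat t f)) (wmul (heatW t) g) := by
  rw [heat, TemperedDistribution.fourierMultiplierCLM_apply, FourierTransform.fourier_fourierInv_eq]
  exact h.smulLeft (hasTemperateGrowth_heat ht)

lemma kerW_zero_le {κ τ t : ℝ} (ht : 0 < t) (hτ₀ : 0 ≤ τ) (hτ : τ ≤ 2) (ξ : R3) :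
    |kerW κ τ t 0 ξ| ≤ kerBound κ τ t := by
  rw [abs_of_nonneg (kerW_nonneg _ _ _ _ _)]
  simpa [expPow] using kerW_le (κ := κ) ht hτ₀ hτ ξ

/-- The smoothing of the heat semigroup. -/
lemma InDomain.heat {κ ρ τ t : ℝ} (ht : 0 < t) (hτ₀ : 0 ≤ τ) (hτ : τ ≤ 2) {f : 𝓢'(R3, F)}
    (h : InDomain (expPow 0 ρ) f) : InDomain (expPow (κ * t) (ρ + τ)) (heat t f) ∧
      hatMul (expPow (κ * t) (ρ + τ)) (heat t f) =
        toL2 (wmul (kerW κ τ t 0) (hatMul (expPow 0 ρ) f)) := by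
  have hr := fourier_heat ht.le h.rep
  have h1 : wmul (expPow (κ * t) (ρ + τ)) (wmul (heatW t) (funRep (𝓕 f))) =ᵐ[volume]
      wmul (kerW κ τ t 0) (hatMul (expPow 0 ρ) f) := by
    filter_upwards [ae_symA_pos, h.coeFn_hatMul] with ξ hξ h2
    simp only [wmul, h2, smul_smul, ← Complex.ofReal_mul, kerW, expPow, Real.rpow_add hξ, sub_zero,
      zero_mul, Real.exp_zero, one_mul]
    congr 2
    ring
  have h3 : MemLp (wmul (kerW κ τ t 0) (hatMul (expPow 0 ρ) f)) 2 :=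
    memLp_wmul (measurable_kerW _ _ _ _) (ae_of_all _ fun ξ => kerW_zero_le ht hτ₀ hτ ξ)
      (Lp.memLp _)
  exact ⟨hr.inDomain (h3.ae_eq h1.symm), (hr.hatMul _).trans (toL2_congr h1)⟩

lemma norm_hatMul_heat_le {κ ρ τ t : ℝ} (ht : 0 < t) (hτ₀ : 0 ≤ τ) (hτ : τ ≤ 2) {f : 𝓢'(R3, F)}
    (h : InDomain (expPow 0 ρ) f) : ‖hatMul (expPow (κ * t) (ρ + τ)) (MildNS.heat t f)‖ ≤
      kerBound κ τ t * ‖hatMul (expPow 0 ρ) f‖ := by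
  rw [(h.heat ht hτ₀ hτ).2]
  have h1 : MemLp (wmul (kerW κ τ t 0) (hatMul (expPow 0 ρ) f)) 2 :=
    memLp_wmul (measurable_kerW _ _ _ _) (ae_of_all _ fun ξ => kerW_zero_le ht hτ₀ hτ ξ)
      (Lp.memLp _)
  have h2 := norm_toL2_le (K := kerBound κ τ t) h1 (Lp.memLp (hatMul (expPow 0 ρ) f))
    (ae_of_all _ fun ξ => by
      rw [norm_wmul]
      exact mul_le_mul_of_nonneg_right (kerW_zero_le ht hτ₀ hτ ξ) (norm_nonneg _))
  rwa [toL2_coeFn] at h2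

lemma continuousOn_hatMul_heat {κ ρ τ T : ℝ} (hκ : 0 ≤ κ) (hτ₀ : 0 ≤ τ) (hτ : τ ≤ 2)
    {f : 𝓢'(R3, F)} (h : InDomain (expPow 0 ρ) f) :
    ContinuousOn (fun t => hatMul (expPow (κ * t) (ρ + τ)) (MildNS.heat t f)) (Ioc 0 T) := by
  suffices hs : ContinuousOn (fun t => toL2 (wmul (kerW κ τ t 0) (hatMul (expPow 0 ρ) f)))
      (Ioc 0 T) from hs.congr fun t ht => (h.heat ht.1 hτ₀ hτ).2
  intro t₀ ht₀
  obtain ⟨δ, hδ0, hδ⟩ := exists_between ht₀.1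
  have hb (t : ℝ) (h1 : δ ≤ t) (h2 : t ≤ T) (ξ : R3) :
      |kerW κ τ t 0 ξ| ≤ kerBound (κ * T / δ) τ δ := by
    rw [abs_of_nonneg (kerW_nonneg _ _ _ _ _)]
    exact kerW_le_const hκ hδ0 (by linarith) h2 hτ₀ hτ ξ
  have hker (ξ : R3) : Continuous fun t : ℝ => kerW κ τ t 0 ξ := by
    unfold kerW expPow heatW; fun_prop
  refine tendsto_toL2_wmul_eventually (w := fun t => kerW κ τ t 0) (w₀ := kerW κ τ t₀ 0)
    (K := kerBound (κ * T / δ) τ δ) (fun t => measurable_kerW _ _ _ _) ?_ (measurable_kerW _ _ _ _)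
    (hb t₀ hδ.le ht₀.2) (fun ξ => ((hker ξ).tendsto t₀).mono_left nhdsWithin_le_nhds)
    tendsto_const_nhds
  filter_upwards [self_mem_nhdsWithin, nhdsWithin_le_nhds (eventually_ge_nhds hδ)] with t h1 h2
  exact hb t h2 h1.2

theorem isLinearConstant_two : IsLinearConstant 2 := by
  refine ⟨two_pos, fun lam0 T h0 hT u₀ hu₀ => ?_⟩
  have hκ : 0 ≤ lam0 / √T := by positivity
  have e : (5 / 4 : ℝ) = 1 / 2 + 3 / 4 := by norm_num
  have hd (t : ℝ) (ht : t ∈ Ioc 0 T) : InDomain (expPow (theta lam0 T t) (5 / 4)) (heat t u₀) := by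
    rw [e, theta_eq lam0 T ht.1.le]
    exact (InDomain.heat ht.1 (by norm_num) (by norm_num) hu₀).1
  have hN : 0 ≤ 2 * expNorm 0 (1 / 2) u₀ := mul_nonneg two_pos.le (norm_nonneg _)
  refine memB_of_bound (continuous_zeta _ _).continuousOn hN
    (fun t ht => ((hd t ht).expPow_zero (theta_nonneg h0 T t)).1) hd ?_ fun t ht => ?_
  · refine (continuousOn_hatMul_heat (τ := 3 / 4) hκ (by norm_num) (by norm_num) hu₀).congr
      fun t ht => ?_
    simp only [theta_eq lam0 T ht.1.le, e]
  · have h1 := norm_hatMul_heat_le (κ := lam0 / √T) (τ := 3 / 4) ht.1 (by norm_num) (by norm_num) hu₀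
    rw [← e, ← theta_eq lam0 T ht.1.le, ← expNorm_eq 0] at h1
    have ht0 := ht.1
    -- An equality: `ζ` is exactly the logarithm of the growth of the linear term in passing from
    -- `A^{1/2}` to `A^{5/4}`, and the factor `2` of `kerBound` is the constant claimed.
    have e1 : kerBound (lam0 / √T) (3 / 4) t = 2 * t ^ (-(3 / 8) : ℝ) * Real.exp (zeta lam0 T t) := by
      rw [kerBound, exp_zeta, lam_eq lam0 T ht0.le, mul_pow, Real.sq_sqrt ht0.le]
      norm_num
      ring
    have e2 : Real.exp (-zeta lam0 T t) * Real.exp (zeta lam0 T t) = 1 := by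
      rw [← Real.exp_add]; simp
    have e3 : t ^ (3 / 8 : ℝ) * t ^ (-(3 / 8) : ℝ) = 1 := by
      rw [← Real.rpow_add ht0]; simp
    calc _ ≤ Real.exp (-zeta lam0 T t) * t ^ (3 / 8 : ℝ) *
          (kerBound (lam0 / √T) (3 / 4) t * expNorm 0 (1 / 2) u₀) :=
          mul_le_mul_of_nonneg_left h1 (by positivity)
      _ = (Real.exp (-zeta lam0 T t) * Real.exp (zeta lam0 T t)) *
          (t ^ (3 / 8 : ℝ) * t ^ (-(3 / 8) : ℝ)) * (2 * expNorm 0 (1 / 2) u₀) := by rw [e1]; ring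
      _ = _ := by rw [e2, e3, one_mul, one_mul]

end MildNS
end

noncomputable section

namespace MildNS

set_option linter.unusedSectionVars false

open Filter Topology

variable {F : Type*} [NormedAddCommGroup F] [InnerProductSpace ℂ F] [CompleteSpace F]
variable {M : Matrix (Fin 3) (Fin 3) ℝ} {P : FiberedProjection}

/-! ### Linear structure of the path spaces -/

lemma InDomain.sub {w : R3 → ℝ} {f f' : 𝓢'(R3, F)} (h : InDomain w f) (h' : InDomain w f') :
    InDomain w (f - f') ∧ hatMul w (f - f') = hatMul w f - hatMul w f' := by
  have hr : IsRepresentedBy (𝓕 (f - f')) (funRep (𝓕 f) - funRep (𝓕 f')) := by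
    rw [sub_eq_add_neg, ← neg_one_smul ℂ f', FourierTransform.fourier_add,
      FourierTransform.fourier_smul, neg_one_smul, ← sub_eq_add_neg]
    exact h.rep.sub h'.rep
  have e : wmul w (funRep (𝓕 f) - funRep (𝓕 f')) =
      wmul w (funRep (𝓕 f)) - wmul w (funRep (𝓕 f')) := by
    ext1 x; simp [wmul, smul_sub]
  refine ⟨hr.inDomain (by rw [e]; exact h.memLp.sub h'.memLp), ?_⟩
  rw [hr.hatMul, e, toL2_sub h.memLp h'.memLp, hatMul, hatMul]

lemma fourier_zero_rep : IsRepresentedBy (𝓕 (0 : 𝓢'(R3, F))) 0 := by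
  rw [FourierTransform.fourier_zero]
  exact isRepresentedBy_zero

lemma inDomain_zero (w : R3 → ℝ) : InDomain w (0 : 𝓢'(R3, F)) ∧ hatMul w (0 : 𝓢'(R3, F)) = 0 := by
  have e : wmul w (0 : R3 → F) = 0 := by ext1 x; simp [wmul]
  have h := fourier_zero_rep (F := F)
  refine ⟨h.inDomain (by rw [e]; exact MemLp.zero'), ?_⟩
  rw [h.hatMul, e]
  refine toL2_eq (Lp.coeFn_zero F 2 (volume : Measure R3)).symm

variable {ζ θ : ℝ → ℝ} {I J : Set ℝ} {u v u' v' : ℝ → 𝓢'(R3, C3)}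

lemma normB_le {K : ℝ} (hK : 0 ≤ K) (h : ∀ t ∈ I,
    Real.exp (-ζ t) * t ^ (3 / 8 : ℝ) * ‖hatMul (expPow (θ t) (5 / 4)) (v t)‖ ≤ K) :
    normB ζ θ I v ≤ K := by
  refine Real.sSup_le ?_ hK
  rintro _ ⟨t, ht, rfl⟩
  simpa only [expNorm_eq] using h t ht

lemma MemB.le_normB (hv : MemB ζ θ I v) {t : ℝ} (ht : t ∈ I) :
    Real.exp (-ζ t) * t ^ (3 / 8 : ℝ) * ‖hatMul (expPow (θ t) (5 / 4)) (v t)‖ ≤ normB ζ θ I v := by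
  have h := le_csSup hv.bounded (mem_image_of_mem _ ht)
  simpa only [normB, expNorm_eq] using h

lemma MemB.add (hI : I ⊆ Ioi 0) (hζ : ContinuousOn ζ I) (hu : MemB ζ θ I u) (hv : MemB ζ θ I v) :
    MemB ζ θ I (u + v) ∧ normB ζ θ I (u + v) ≤ normB ζ θ I u + normB ζ θ I v := by
  have e (t : ℝ) (ht : t ∈ I) := hatMul_add (hu.inDomain t ht) (hv.inDomain t ht)
  refine memB_of_bound hζ (add_nonneg (normB_nonneg hI) (normB_nonneg hI))
    (fun t ht => InDomain.add (hu.memHom t ht) (hv.memHom t ht))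
    (fun t ht => InDomain.add (hu.inDomain t ht) (hv.inDomain t ht))
    (((hu.continuousOn_hatMul hI hζ).add (hv.continuousOn_hatMul hI hζ)).congr e) fun t ht => ?_
  have h1 := hu.le_normB ht
  have h2 := hv.le_normB ht
  have ht0 : 0 < t := hI ht
  rw [Pi.add_apply, e t ht]
  refine (mul_le_mul_of_nonneg_left (norm_add_le _ _) (by positivity)).trans ?_
  rw [mul_add]
  exact add_le_add h1 h2

lemma MemB.sub (hI : I ⊆ Ioi 0) (hζ : ContinuousOn ζ I) (hu : MemB ζ θ I u) (hv : MemB ζ θ I v) :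
    MemB ζ θ I (u - v) ∧ normB ζ θ I (u - v) ≤ normB ζ θ I u + normB ζ θ I v := by
  have e (t : ℝ) (ht : t ∈ I) := (InDomain.sub (hu.inDomain t ht) (hv.inDomain t ht)).2
  refine memB_of_bound hζ (add_nonneg (normB_nonneg hI) (normB_nonneg hI))
    (fun t ht => (InDomain.sub (hu.memHom t ht) (hv.memHom t ht)).1)
    (fun t ht => (InDomain.sub (hu.inDomain t ht) (hv.inDomain t ht)).1)
    (((hu.continuousOn_hatMul hI hζ).sub (hv.continuousOn_hatMul hI hζ)).congr e) fun t ht => ?_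
  have h1 := hu.le_normB ht
  have h2 := hv.le_normB ht
  have ht0 : 0 < t := hI ht
  rw [Pi.sub_apply, e t ht]
  refine (mul_le_mul_of_nonneg_left (norm_sub_le _ _) (by positivity)).trans ?_
  rw [mul_add]
  exact add_le_add h1 h2

lemma memB_zero (hζ : ContinuousOn ζ I) : MemB ζ θ I 0 ∧ normB ζ θ I 0 ≤ 0 := by
  have e (t : ℝ) : hatMul (expPow (θ t) (5 / 4)) ((0 : ℝ → 𝓢'(R3, C3)) t) = 0 :=
    (inDomain_zero _).2
  refine memB_of_bound hζ le_rfl (fun t _ => (inDomain_zero _).1) (fun t _ => (inDomain_zero _).1)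
    ?_ fun t _ => ?_
  · simp only [e]; exact continuousOn_const
  · rw [e, norm_zero, mul_zero]

lemma normB_mono (hJ : J ⊆ Ioi 0) (h : I ⊆ J) (hv : MemB ζ θ J v) :
    normB ζ θ I v ≤ normB ζ θ J v :=
  normB_le (normB_nonneg hJ) fun _ ht => hv.le_normB (h ht)

lemma MemB.mono (h : I ⊆ J) (hv : MemB ζ θ J v) : MemB ζ θ I v :=
  ⟨fun t ht => hv.memHom t (h ht), fun t ht => hv.inDomain t (h ht), hv.continuousOn.mono h,
    hv.bounded.mono (image_mono h)⟩

lemma MemB.congr (hv : MemB ζ θ I v) (h : ∀ t ∈ I, u t = v t) : MemB ζ θ I u := by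
  refine ⟨fun t ht => ?_, fun t ht => ?_, hv.continuousOn.congr fun t ht => ?_, ?_⟩
  · rw [h t ht]; exact hv.memHom t ht
  · rw [h t ht]; exact hv.inDomain t ht
  · simp only [h t ht]
  · have e : (fun t => Real.exp (-ζ t) * t ^ (3 / 8 : ℝ) * expNorm (θ t) (5 / 4) (u t)) '' I =
        (fun t => Real.exp (-ζ t) * t ^ (3 / 8 : ℝ) * expNorm (θ t) (5 / 4) (v t)) '' I :=
      image_congr fun t ht => by simp only [h t ht]
    rw [e]
    exact hv.bounded

lemma normB_congr (h : ∀ t ∈ I, u t = v t) : normB ζ θ I u = normB ζ θ I v := by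
  have e : (fun t => Real.exp (-ζ t) * t ^ (3 / 8 : ℝ) * expNorm (θ t) (5 / 4) (u t)) '' I =
      (fun t => Real.exp (-ζ t) * t ^ (3 / 8 : ℝ) * expNorm (θ t) (5 / 4) (v t)) '' I :=
    image_congr fun t ht => by simp only [h t ht]
  rw [normB, normB, e]

/-! ### Additivity of the bilinear operator -/

lemma memLp_wmul_heatW {τ : ℝ} (hτ : 0 ≤ τ) (g : Lp F 2 (volume : Measure R3)) :
    MemLp (wmul (heatW τ) g) 2 :=
  memLp_wmul (measurable_heatW _) (K := 1) (ae_of_all _ fun ξ => by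
    rw [heatW, Real.abs_exp, Real.exp_le_one_iff]
    nlinarith [mul_nonneg hτ (sq_nonneg (symA ξ))]) (Lp.memLp _)

lemma toL2_wmul_heatW_add {τ : ℝ} (hτ : 0 ≤ τ) (g h : Lp F 2 (volume : Measure R3)) :
    toL2 (wmul (heatW τ) (g + h : Lp F 2 (volume : Measure R3))) =
      toL2 (wmul (heatW τ) g) + toL2 (wmul (heatW τ) h) := by
  rw [← toL2_add (memLp_wmul_heatW hτ g) (memLp_wmul_heatW hτ h),
    toL2_congr (wmul_congr _ (Lp.coeFn_add g h))]
  congr 1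
  ext1 ξ
  simp [wmul]

lemma hat54_add {f f' : 𝓢'(R3, C3)} (h : MemHom (5 / 4) f) (h' : MemHom (5 / 4) f') :
    hat54 (f + f') = hat54 f + hat54 f' := hatMul_add h h'

lemma duhamelIntegrand_add_left {t s : ℝ} (hs : s ≤ t) (hu : MemHom (5 / 4) (u s))
    (hu' : MemHom (5 / 4) (u' s)) (hv : MemHom (5 / 4) (v s)) :
    duhamelIntegrand M P (u + u') v t s =
      duhamelIntegrand M P u v t s + duhamelIntegrand M P u' v t s := by
  have h : MemHom (5 / 4) ((u + u') s) := InDomain.add hu hu'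
  rw [duhamelIntegrand_eq h hv, duhamelIntegrand_eq hu hv, duhamelIntegrand_eq hu' hv,
    ← FourierTransform.fourierInv_add, ← toL2_wmul_heatW_add (sub_nonneg.2 hs), Pi.add_apply,
    hat54_add hu hu', nonlin, nonlin, nonlin, map_add, add_apply, map_add]

lemma duhamelIntegrand_add_right {t s : ℝ} (hs : s ≤ t) (hu : MemHom (5 / 4) (u s))
    (hv : MemHom (5 / 4) (v s)) (hv' : MemHom (5 / 4) (v' s)) :
    duhamelIntegrand M P u (v + v') t s =
      duhamelIntegrand M P u v t s + duhamelIntegrand M P u v' t s := by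
  have h : MemHom (5 / 4) ((v + v') s) := InDomain.add hv hv'
  rw [duhamelIntegrand_eq hu h, duhamelIntegrand_eq hu hv, duhamelIntegrand_eq hu hv',
    ← FourierTransform.fourierInv_add, ← toL2_wmul_heatW_add (sub_nonneg.2 hs), Pi.add_apply,
    hat54_add hv hv', nonlin, nonlin, nonlin, map_add, map_add]

lemma toTemperedDistribution_add (f g : Lp F 2 (volume : Measure R3)) :
    Lp.toTemperedDistribution (f + g) = Lp.toTemperedDistribution f + Lp.toTemperedDistribution g :=
  map_add (Lp.toTemperedDistributionCLM F (volume : Measure R3) 2) f g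

lemma toTemperedDistribution_zero :
    Lp.toTemperedDistribution (0 : Lp F 2 (volume : Measure R3)) = 0 :=
  map_zero (Lp.toTemperedDistributionCLM F (volume : Measure R3) 2)

lemma bilin_add_of_integrand {a b c d p q : ℝ → 𝓢'(R3, C3)} {t : ℝ} (ht : 0 ≤ t)
    (h1 : DuhamelExists M P a b t) (h2 : DuhamelExists M P c d t)
    (h : ∀ s ∈ Ioc 0 t, duhamelIntegrand M P p q t s =
      duhamelIntegrand M P a b t s + duhamelIntegrand M P c d t s) :
    bilin M P p q t = bilin M P a b t + bilin M P c d t := by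
  have e : ∫ s in (0 : ℝ)..t, duhamelIntegrand M P p q t s =
      (∫ s in (0 : ℝ)..t, duhamelIntegrand M P a b t s) +
        ∫ s in (0 : ℝ)..t, duhamelIntegrand M P c d t s := by
    rw [← intervalIntegral.integral_add h1.2 h2.2]
    refine intervalIntegral.integral_congr_ae (ae_of_all _ fun s hs => h s ?_)
    rwa [uIoc_of_le ht] at hs
  rw [bilin, bilin, bilin, e, neg_add, toTemperedDistribution_add]

end MildNS
end

noncomputable section

namespace MildNS

set_option linter.unusedSectionVars false

open Filter Topology

variable {F : Type*} [NormedAddCommGroup F] [InnerProductSpace ℂ F] [CompleteSpace F]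
variable {M : Matrix (Fin 3) (Fin 3) ℝ} {P : FiberedProjection}
variable {ζ θ : ℝ → ℝ} {I : Set ℝ} {u v u' v' : ℝ → 𝓢'(R3, C3)} {γ : ℝ}

/-! ### Differences of bilinear terms -/

lemma bilin_congr {t : ℝ} (ht : 0 ≤ t) (h : ∀ s ∈ Ioc 0 t, u s = u' s)
    (h' : ∀ s ∈ Ioc 0 t, v s = v' s) : bilin M P u v t = bilin M P u' v' t := by
  have e : ∫ s in (0 : ℝ)..t, duhamelIntegrand M P u v t s =
      ∫ s in (0 : ℝ)..t, duhamelIntegrand M P u' v' t s := by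
    refine intervalIntegral.integral_congr_ae (ae_of_all _ fun s hs => ?_)
    rw [uIoc_of_le ht] at hs
    rw [duhamelIntegrand, duhamelIntegrand, h s hs, h' s hs]
  rw [bilin, bilin, e]

lemma DuhamelExists.congr {t : ℝ} (ht : 0 ≤ t) (hd : DuhamelExists M P u v t)
    (h : ∀ s ∈ Ioc 0 t, u' s = u s) (h' : ∀ s ∈ Ioc 0 t, v' s = v s) :
    DuhamelExists M P u' v' t := by
  refine ⟨fun s hs => by rw [h s hs, h' s hs]; exact hd.1 s hs, hd.2.congr fun s hs => ?_⟩
  rw [uIoc_of_le ht] at hs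
  simp only [duhamelIntegrand, h s hs, h' s hs]

lemma bilin_zero : bilin M P u v 0 = 0 := by
  rw [bilin, intervalIntegral.integral_same, neg_zero, toTemperedDistribution_zero]

lemma duhamelExists_zero : DuhamelExists M P u v 0 :=
  ⟨fun _ hs => absurd hs.2 (not_le.2 hs.1), IntervalIntegrable.refl⟩

/-- `B(u,u) - B(v,v) = B(u - v, u) + B(v, u - v)`. -/
lemma bilin_sub_bilin (hI : I ⊆ Ioi 0) (hI' : ∀ t ∈ I, Ioc 0 t ⊆ I) (hζ : ContinuousOn ζ I)
    (hγ : IsBilinearBound M P ζ θ I γ) {γ' : ℝ} (hγ' : IsBilinearBound M P ζ θ I γ')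
    (hu : MemB ζ θ I u) (hv : MemB ζ θ I v) :
    normB ζ θ I (bilin M P u u - bilin M P v v) ≤ γ * normB ζ θ I (u - v) * normB ζ θ I u +
      γ' * normB ζ θ I v * normB ζ θ I (u - v) := by
  have hd := (hu.sub hI hζ hv).1
  have h1 := hγ _ _ hd hu
  have h2 := hγ' _ _ hv hd
  have h3 := hγ _ _ hv hu
  have h4 := hγ _ _ hv hv
  have e (t : ℝ) (ht : t ∈ I) : (bilin M P u u - bilin M P v v) t =
      (bilin M P (u - v) u + bilin M P v (u - v)) t := by
    have ht0 : 0 < t := hI ht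
    have e1 : bilin M P u u t = bilin M P (u - v) u t + bilin M P v u t := by
      refine bilin_add_of_integrand ht0.le (h1.1 t ht) (h3.1 t ht) fun s hs => ?_
      have hs' := hI' t ht hs
      rw [← duhamelIntegrand_add_left hs.2 (hd.memHom s hs') (hv.memHom s hs') (hu.memHom s hs'),
        sub_add_cancel]
    have e2 : bilin M P v u t = bilin M P v (u - v) t + bilin M P v v t := by
      refine bilin_add_of_integrand ht0.le (h2.1 t ht) (h4.1 t ht) fun s hs => ?_
      have hs' := hI' t ht hs
      rw [← duhamelIntegrand_add_right hs.2 (hv.memHom s hs') (hd.memHom s hs') (hv.memHom s hs'),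
        sub_add_cancel]
    rw [Pi.sub_apply, Pi.add_apply, e1, e2]
    abel
  rw [normB_congr e]
  exact (h1.2.1.add hI hζ h2.2.1).2.trans (add_le_add h1.2.2 h2.2.2)

/-! ### Global path spaces -/

lemma memB_Ioi {K : ℝ} (hK : 0 ≤ K) (h : ∀ T : ℝ, 0 < T → MemB 0 0 (Ioc 0 T) v ∧
    normB 0 0 (Ioc 0 T) v ≤ K) : MemB 0 0 (Ioi 0) v ∧ normB 0 0 (Ioi 0) v ≤ K := by
  have hm (t : ℝ) (ht : t ∈ Ioi (0 : ℝ)) : t ∈ Ioc 0 t := ⟨ht, le_rfl⟩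
  refine memB_of_bound continuousOn_const hK (fun t ht => (h t ht).1.memHom t (hm t ht))
    (fun t ht => (h t ht).1.inDomain t (hm t ht)) (fun t ht => ?_)
    fun t ht => ((h t ht).1.le_normB (hm t ht)).trans (h t ht).2
  have ht0 : 0 < t := ht
  -- The interval is extended to `t + 1` so that `t` becomes an interior point and one-sided
  -- continuity at an endpoint does not intervene.
  have h1 := ((h (t + 1) (by linarith)).1.continuousOn_hatMul (fun _ hs => hs.1)
    continuousOn_const) t ⟨ht0, by linarith⟩
  exact (h1.continuousAt (Ioc_mem_nhds ht0 (by linarith))).continuousWithinAt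

/-- For `λ₀ = 0` both `ζ` and `θ` vanish and the constant reduces to `C₃`; independence of `T` then
gives the half-line. -/
lemma isBilinearBound_Ioi {C₃ : ℝ} (h : IsBilinearConstant M P C₃) :
    IsBilinearBound M P 0 0 (Ioi 0) C₃ := by
  intro u v hu hv
  have hsub (T : ℝ) : Ioc 0 T ⊆ Ioi 0 := fun t ht => ht.1
  have hN (w) : 0 ≤ normB 0 0 (Ioi 0) w := normB_nonneg le_rfl
  have h1 (T : ℝ) (hT : 0 < T) := h.2 0 T le_rfl hT
  simp only [zeta_zero, theta_zero] at h1
  have h2 (T : ℝ) (hT : 0 < T) := h1 T hT u v (hu.mono (hsub T)) (hv.mono (hsub T))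
  have h3 := h.1
  refine ⟨fun t ht => (h2 t ht).1 t ⟨ht, le_rfl⟩,
    memB_Ioi (mul_nonneg (mul_nonneg h3.le (hN u)) (hN v)) fun T hT => ⟨(h2 T hT).2.1, ?_⟩⟩
  refine (h2 T hT).2.2.trans ?_
  have e : C₃ * jap 0 ^ 2 * Real.exp (0 ^ 2 / 4) = C₃ := by simp [jap]
  rw [e]
  exact mul_le_mul (mul_le_mul_of_nonneg_left (normB_mono le_rfl (hsub T) hu) h3.le)
    (normB_mono le_rfl (hsub T) hv) (normB_nonneg (hsub T)) (mul_nonneg h3.le (hN u))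

lemma memB_heat_Ioi {C₁ : ℝ} (h : IsLinearConstant C₁) {u₀ : 𝓢'(R3, C3)}
    (hu₀ : MemHom (1 / 2) u₀) : MemB 0 0 (Ioi 0) (fun t => heat t u₀) ∧
      normB 0 0 (Ioi 0) (fun t => heat t u₀) ≤ C₁ * expNorm 0 (1 / 2) u₀ := by
  refine memB_Ioi (mul_nonneg h.1.le (norm_nonneg _)) fun T hT => ?_
  have := h.2 0 T le_rfl hT u₀ hu₀
  rwa [zeta_zero, theta_zero] at this

lemma MemB.norm_hat54_le (hv : MemB 0 0 (Ioi 0) v) {t : ℝ} (ht : 0 < t) :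
    t ^ (3 / 8 : ℝ) * ‖hat54 (v t)‖ ≤ normB 0 0 (Ioi 0) v := by
  simpa [hat54] using hv.le_normB (mem_Ioi.2 ht)

lemma MemB.continuousOn_hat54_Ioi (hv : MemB 0 0 (Ioi 0) v) :
    ContinuousOn (fun t => hat54 (v t)) (Ioi 0) :=
  hv.continuousOn_hat54 le_rfl continuousOn_const continuousOn_const fun _ _ => le_rfl

lemma memB_zero_zero {K : ℝ} (hK : 0 ≤ K) (h1 : ∀ t, 0 < t → MemHom (5 / 4) (v t))
    (h2 : ContinuousOn (fun t => hat54 (v t)) (Ioi 0))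
    (h3 : ∀ t, 0 < t → t ^ (3 / 8 : ℝ) * ‖hat54 (v t)‖ ≤ K) :
    MemB 0 0 (Ioi 0) v ∧ normB 0 0 (Ioi 0) v ≤ K :=
  memB_of_bound (ζ := 0) (θ := 0) continuousOn_const hK h1 h1 h2 fun t ht => by
    rw [Pi.zero_apply, neg_zero, Real.exp_zero, one_mul]
    exact h3 t ht

lemma eq_of_hat54_eq {f f' : 𝓢'(R3, C3)} (h : MemHom (5 / 4) f) (h' : MemHom (5 / 4) f')
    (e : hat54 f = hat54 f') : f = f' := by
  refine eq_of_fourier_rep (InDomain.rep h) (InDomain.rep h')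
    ((InDomain.funRep_ae_eq_invW h).trans (EventuallyEq.trans ?_
      (InDomain.funRep_ae_eq_invW h').symm))
  rw [hat54, hat54] at e
  rw [e]

lemma MemB.eq_of_normB_sub (hu : MemB 0 0 (Ioi 0) u) (hv : MemB 0 0 (Ioi 0) v)
    (h : normB 0 0 (Ioi 0) (u - v) ≤ 0) {t : ℝ} (ht : 0 < t) : u t = v t := by
  refine eq_of_hat54_eq (hu.memHom t ht) (hv.memHom t ht) ?_
  have h1 := ((hu.sub le_rfl continuousOn_const hv).1.norm_hat54_le ht).trans h
  have h2 : hat54 ((u - v) t) = hat54 (u t) - hat54 (v t) :=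
    (InDomain.sub (hu.memHom t ht) (hv.memHom t ht)).2
  have h3 : 0 < t ^ (3 / 8 : ℝ) := by positivity
  rw [h2] at h1
  have h4 : ‖hat54 (u t) - hat54 (v t)‖ ≤ 0 := by
    by_contra hc
    exact absurd h1 (not_le.2 (mul_pos h3 (not_le.1 hc)))
  exact sub_eq_zero.1 (norm_le_zero_iff.1 h4)

/-- Here `5/4 < 3/2` matters: `A^{-5/4}g` is then integrable at low frequencies and defines a
tempered distribution. Completeness of the path space rests on this. -/
lemma exists_of_hat54 (g : L2V) : ∃ f : 𝓢'(R3, C3), MemHom (5 / 4) f ∧ hat54 f = g := by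
  obtain ⟨f, hf⟩ := exists_fourier_rep (σ := 5 / 4) (by norm_num) (by norm_num)
    (memLp_invW (Lp.memLp g))
  exact ⟨f, hf.inDomain (memLp_invW (Lp.memLp g)), (hf.hatMul _).trans (toL2_eq (wmul_invW g))⟩

/-- Completeness of the path space, for sequences that converge geometrically. -/
lemma exists_limit {x : ℕ → ℝ → 𝓢'(R3, C3)} (hx : ∀ n, MemB 0 0 (Ioi 0) (x n)) {c q : ℝ}
    (hc : 0 ≤ c) (hq : q < 1) (hd : ∀ n, normB 0 0 (Ioi 0) (x (n + 1) - x n) ≤ c * q ^ n)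
    (hq0 : 0 ≤ q) :
    ∃ X : ℝ → 𝓢'(R3, C3), MemB 0 0 (Ioi 0) X ∧
      ∀ n, normB 0 0 (Ioi 0) (X - x n) ≤ c * q ^ n / (1 - q) := by
  have hsub (n : ℕ) (t : ℝ) (ht : 0 < t) : hat54 ((x (n + 1) - x n) t) =
      hat54 (x (n + 1) t) - hat54 (x n t) :=
    (InDomain.sub ((hx (n + 1)).memHom t ht) ((hx n).memHom t ht)).2
  set a : ℕ → ℝ → L2V := fun n t => t ^ (3 / 8 : ℝ) • hat54 (x n t) with ha
  have hdist (t : ℝ) (ht : 0 < t) (n : ℕ) : dist (a n t) (a (n + 1) t) ≤ c * q ^ n := by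
    have h1 := (((hx (n + 1)).sub le_rfl continuousOn_const (hx n)).1.norm_hat54_le ht).trans (hd n)
    rw [dist_comm, dist_eq_norm]
    simp only [ha]
    rw [← smul_sub, norm_smul, ← hsub n t ht, Real.norm_of_nonneg (by positivity)]
    exact h1
  have hlim (t : ℝ) (ht : 0 < t) : ∃ y, Tendsto (fun n => a n t) atTop (𝓝 y) :=
    cauchySeq_tendsto_of_complete (cauchySeq_of_le_geometric q c hq (hdist t ht))
  choose! b hb using hlim
  have hab (t : ℝ) (ht : 0 < t) (n : ℕ) : dist (a n t) (b t) ≤ c * q ^ n / (1 - q) :=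
    dist_le_of_le_geometric_of_tendsto q c hq (hdist t ht) (hb t ht) n
  choose X hX using fun t => exists_of_hat54 ((t ^ (3 / 8 : ℝ))⁻¹ • b t)
  have hbX (t : ℝ) (ht : 0 < t) : b t = t ^ (3 / 8 : ℝ) • hat54 (X t) := by
    rw [(hX t).2, smul_inv_smul₀ (by positivity)]
  have h0 : Tendsto (fun n : ℕ => c * q ^ n / (1 - q)) atTop (𝓝 0) := by
    have := ((tendsto_pow_atTop_nhds_zero_of_lt_one hq0 hq).const_mul c).div_const (1 - q)
    simpa using this
  have hpos (n : ℕ) : 0 ≤ c * q ^ n / (1 - q) :=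
    div_nonneg (mul_nonneg hc (pow_nonneg hq0 n)) (sub_nonneg.2 hq.le)
  have hac (n : ℕ) : ContinuousOn (a n) (Ioi 0) := by
    refine ContinuousOn.fun_smul (ContinuousOn.rpow_const continuousOn_id fun t _ =>
      Or.inr (by norm_num)) (hx n).continuousOn_hat54_Ioi
  have hbc : ContinuousOn b (Ioi 0) := by
    have hu : TendstoUniformlyOn a b atTop (Ioi 0) := by
      rw [Metric.tendstoUniformlyOn_iff]
      intro ε hε
      filter_upwards [h0.eventually (gt_mem_nhds hε)] with n hn t ht
      rw [dist_comm]
      exact (hab t ht n).trans_lt hn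
    exact hu.continuousOn (Frequently.of_forall hac)
  have hXc : ContinuousOn (fun t => hat54 (X t)) (Ioi 0) := by
    simp only [(hX _).2]
    refine ContinuousOn.fun_smul (ContinuousOn.fun_inv₀ (ContinuousOn.rpow_const continuousOn_id
      fun t _ => Or.inr (by norm_num)) fun t ht => ?_) hbc
    have : 0 < t := ht
    positivity
  have hXn (n : ℕ) : MemB 0 0 (Ioi 0) (X - x n) ∧
      normB 0 0 (Ioi 0) (X - x n) ≤ c * q ^ n / (1 - q) := by
    have e (t : ℝ) (ht : 0 < t) : hat54 ((X - x n) t) = hat54 (X t) - hat54 (x n t) :=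
      (InDomain.sub (hX t).1 ((hx n).memHom t ht)).2
    refine memB_zero_zero (hpos n)
      (fun t ht => (InDomain.sub (hX t).1 ((hx n).memHom t ht)).1)
      ((hXc.sub (hx n).continuousOn_hat54_Ioi).congr e) fun t ht => ?_
    have h1 := hab t ht n
    rw [dist_comm, dist_eq_norm, hbX t ht] at h1
    simp only [ha] at h1
    rwa [← smul_sub, norm_smul, ← e t ht, Real.norm_of_nonneg (by positivity)] at h1
  refine ⟨X, ?_, fun n => (hXn n).2⟩
  exact ((hXn 0).1.add le_rfl continuousOn_const (hx 0)).1.congr fun t _ => by simp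

end MildNS
end

noncomputable section

namespace MildNS

set_option linter.unusedSectionVars false

open Filter Topology

variable {F : Type*} [NormedAddCommGroup F] [InnerProductSpace ℂ F] [CompleteSpace F]
variable {M : Matrix (Fin 3) (Fin 3) ℝ} {P : FiberedProjection}
variable {ζ θ : ℝ → ℝ} {I : Set ℝ} {u v u' v' : ℝ → 𝓢'(R3, C3)} {γ R : ℝ} {u₀ : 𝓢'(R3, C3)}

/-! ### Picard iteration -/

/-- The Picard iterates of the integral equation. -/
def picard (M : Matrix (Fin 3) (Fin 3) ℝ) (P : FiberedProjection) (u₀ : 𝓢'(R3, C3)) :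
    ℕ → ℝ → 𝓢'(R3, C3)
  | 0 => 0
  | n + 1 => (fun t => heat t u₀) + bilin M P (picard M P u₀ n) (picard M P u₀ n)

/-- The ball of radius `2R` is invariant because `R + γ(2R)² = R + (4γR)R ≤ 2R`. The space is left
general so that the same iterates can be bounded in the weighted spaces and in the global one. -/
lemma picard_memB (hI : I ⊆ Ioi 0) (hζ : ContinuousOn ζ I) (hγ : IsBilinearBound M P ζ θ I γ)
    (hγ0 : 0 ≤ γ) (hR : 0 ≤ R) (hY : MemB ζ θ I (fun t => heat t u₀))
    (hYR : normB ζ θ I (fun t => heat t u₀) ≤ R) (hs : 4 * γ * R < 1) (n : ℕ) :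
    MemB ζ θ I (picard M P u₀ n) ∧ normB ζ θ I (picard M P u₀ n) ≤ 2 * R := by
  induction n with
  | zero => exact ⟨(memB_zero hζ).1, (memB_zero hζ).2.trans (by linarith)⟩
  | succ n ih =>
    have h1 := hγ _ _ ih.1 ih.1
    have h2 := hY.add hI hζ h1.2.1
    refine ⟨h2.1, h2.2.trans ((add_le_add hYR h1.2.2).trans ?_)⟩
    have h0 : 0 ≤ normB ζ θ I (picard M P u₀ n) := normB_nonneg hI
    have h3 := ih.2
    clear h1 h2 ih
    generalize normB ζ θ I (picard M P u₀ n) = N at *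
    calc R + γ * N * N ≤ R + γ * (2 * R) * (2 * R) := by gcongr
      _ = R + (4 * γ * R) * R := by ring
      _ ≤ R + 1 * R := by gcongr
      _ = 2 * R := by ring

/-- On the ball of radius `2R` the bilinear difference has Lipschitz constant `γ·2R + γ·2R = 4γR <
1`. -/
lemma picard_diff (hI : I ⊆ Ioi 0) (hI' : ∀ t ∈ I, Ioc 0 t ⊆ I) (hζ : ContinuousOn ζ I)
    (hγ : IsBilinearBound M P ζ θ I γ)
    (hγ0 : 0 ≤ γ) (hR : 0 ≤ R) (hY : MemB ζ θ I (fun t => heat t u₀))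
    (hYR : normB ζ θ I (fun t => heat t u₀) ≤ R) (hs : 4 * γ * R < 1) (n : ℕ) :
    normB ζ θ I (picard M P u₀ (n + 1) - picard M P u₀ n) ≤ 2 * R * (4 * γ * R) ^ n := by
  have hp := picard_memB hI hζ hγ hγ0 hR hY hYR hs
  induction n with
  | zero =>
    have h := ((hp 1).1.sub hI hζ (hp 0).1).2
    have h0 : normB ζ θ I (picard M P u₀ 0) ≤ 0 := (memB_zero hζ).2
    have h1 := (hp 1).2
    rw [pow_zero, mul_one]
    exact h.trans (by linarith)
  | succ n ih =>
    have e : picard M P u₀ (n + 1 + 1) - picard M P u₀ (n + 1) =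
        bilin M P (picard M P u₀ (n + 1)) (picard M P u₀ (n + 1)) -
          bilin M P (picard M P u₀ n) (picard M P u₀ n) :=
      add_sub_add_left_eq_sub _ _ _
    have h := bilin_sub_bilin hI hI' hζ hγ hγ (hp (n + 1)).1 (hp n).1
    rw [← e] at h
    have a0 : 0 ≤ normB ζ θ I (picard M P u₀ n) := normB_nonneg hI
    have a1 : 0 ≤ normB ζ θ I (picard M P u₀ (n + 1)) := normB_nonneg hI
    have a2 : 0 ≤ normB ζ θ I (picard M P u₀ (n + 1) - picard M P u₀ n) := normB_nonneg hI
    have b0 := (hp n).2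
    have b1 := (hp (n + 1)).2
    refine h.trans ?_
    clear h e hp hY hYR
    generalize normB ζ θ I (picard M P u₀ (n + 1) - picard M P u₀ n) = d at *
    generalize normB ζ θ I (picard M P u₀ (n + 1)) = x at *
    generalize normB ζ θ I (picard M P u₀ n) = y at *
    calc γ * d * x + γ * y * d ≤ γ * d * (2 * R) + γ * (2 * R) * d := by gcongr
      _ = (4 * γ * R) * d := by ring
      _ ≤ (4 * γ * R) * (2 * R * (4 * γ * R) ^ n) := by gcongr
      _ = _ := by ring

lemma Ioc_subset_Ioi_zero {t : ℝ} : Ioc 0 t ⊆ Ioi (0 : ℝ) := fun _ hs => hs.1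

/-- The convergence of the iterates at each fixed time is part of the conclusion, because it is what
transfers weighted bounds to the solution. -/
theorem exists_globalMildSolution (hγ : IsBilinearBound M P 0 0 (Ioi 0) γ)
    (hγ0 : 0 ≤ γ) (hR : 0 ≤ R) (hY : MemB 0 0 (Ioi 0) (fun t => heat t u₀))
    (hYR : normB 0 0 (Ioi 0) (fun t => heat t u₀) ≤ R) (hs : 4 * γ * R < 1) :
    ∃ X, IsGlobalMildSolution M P u₀ X ∧
      ∀ t, 0 < t → Tendsto (fun n => hat54 (picard M P u₀ n t)) atTop (𝓝 (hat54 (X t))) := by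
  have hζ : ContinuousOn (0 : ℝ → ℝ) (Ioi 0) := continuousOn_const
  have hp := picard_memB le_rfl hζ hγ hγ0 hR hY hYR hs
  have hI' : ∀ t ∈ Ioi (0 : ℝ), Ioc 0 t ⊆ Ioi 0 := fun t _ => Ioc_subset_Ioi_zero
  set q := 4 * γ * R with hq
  have hq0 : 0 ≤ q := by positivity
  obtain ⟨X, hX, hXn⟩ := exists_limit (fun n => (hp n).1) (c := 2 * R) (q := q) (by positivity) hs
    (picard_diff le_rfl hI' hζ hγ hγ0 hR hY hYR hs) hq0
  have h0 : Tendsto (fun n : ℕ => 2 * R * q ^ n / (1 - q)) atTop (𝓝 0) := by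
    have := ((tendsto_pow_atTop_nhds_zero_of_lt_one hq0 hs).const_mul (2 * R)).div_const (1 - q)
    simpa using this
  have hN : normB 0 0 (Ioi 0) X ≤ 2 * R := by
    have h1 : Tendsto (fun n : ℕ => 2 * R * q ^ n / (1 - q) + 2 * R) atTop (𝓝 (0 + 2 * R)) :=
      h0.add_const _
    rw [zero_add] at h1
    refine ge_of_tendsto' h1 fun n => ?_
    have h2 := ((hX.sub le_rfl hζ (hp n).1).1.add le_rfl hζ (hp n).1).2
    rw [sub_add_cancel] at h2
    exact h2.trans (add_le_add (hXn n) (hp n).2)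
  have hB := hγ _ _ hX hX
  have hZ := (hY.add le_rfl hζ hB.2.1).1
  -- The defect of the limit is compared with the next iterate; both the approximation error and the
  -- difference of the bilinear terms decay geometrically.
  have hfix : normB 0 0 (Ioi 0) (X - ((fun t => heat t u₀) + bilin M P X X)) ≤ 0 := by
    have h1 : Tendsto (fun n : ℕ => 2 * R * q ^ (n + 1) / (1 - q) +
        q * (2 * R * q ^ n / (1 - q))) atTop (𝓝 (0 + q * 0)) :=
      (h0.comp (tendsto_add_atTop_nat 1)).add (h0.const_mul q)
    rw [mul_zero, zero_add] at h1
    refine ge_of_tendsto' h1 fun n => ?_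
    have hBn := hγ _ _ (hp n).1 (hp n).1
    have e : X - ((fun t => heat t u₀) + bilin M P X X) = (X - picard M P u₀ (n + 1)) -
        (bilin M P X X - bilin M P (picard M P u₀ n) (picard M P u₀ n)) := by
      rw [picard]; abel
    have h2 := ((hX.sub le_rfl hζ (hp (n + 1)).1).1.sub le_rfl hζ
      (hB.2.1.sub le_rfl hζ hBn.2.1).1).2
    rw [← e] at h2
    refine h2.trans (add_le_add (hXn (n + 1)) ?_)
    refine (bilin_sub_bilin le_rfl hI' hζ hγ hγ hX (hp n).1).trans ?_
    have a0 : 0 ≤ normB 0 0 (Ioi 0) (picard M P u₀ n) := normB_nonneg le_rfl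
    have a1 : 0 ≤ normB 0 0 (Ioi 0) X := normB_nonneg le_rfl
    have a2 : 0 ≤ normB 0 0 (Ioi 0) (X - picard M P u₀ n) := normB_nonneg le_rfl
    have b0 := (hp n).2
    have b1 := hXn n
    clear h2 e hp hY hYR hXn hB hBn h1 hX hZ
    generalize normB 0 0 (Ioi 0) (X - picard M P u₀ n) = d at *
    generalize normB 0 0 (Ioi 0) X = x at *
    generalize normB 0 0 (Ioi 0) (picard M P u₀ n) = y at *
    calc γ * d * x + γ * y * d ≤ γ * d * (2 * R) + γ * (2 * R) * d := by gcongr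
      _ = q * d := by rw [hq]; ring
      _ ≤ _ := by gcongr
  have hXZ (t : ℝ) (ht : 0 < t) : X t = heat t u₀ + bilin M P X X t :=
    hX.eq_of_normB_sub hZ hfix ht
  -- The path space does not see `t = 0`, so the value there is set to the one the integral equation
  -- demands.
  let X' : ℝ → 𝓢'(R3, C3) := fun t => if 0 < t then X t else heat t u₀
  have hXX' (t : ℝ) (ht : 0 < t) : X' t = X t := if_pos ht
  have hX' : MemB 0 0 (Ioi 0) X' := hX.congr hXX'
  have hN' : normB 0 0 (Ioi 0) X' ≤ 2 * R := (normB_congr hXX').trans_le hN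
  refine ⟨X', ⟨fun t ht => ?_, hX', hY, γ, R, hγ0, hR, hγ, hYR, hs, hN'⟩, fun t ht => ?_⟩
  · rcases ht.eq_or_lt with rfl | ht
    · refine ⟨duhamelExists_zero, ?_⟩
      rw [bilin_zero, add_zero]
      exact if_neg (lt_irrefl _)
    · have hc (s : ℝ) (hs : s ∈ Ioc 0 t) : X' s = X s := hXX' s hs.1
      refine ⟨(hB.1 t ht).congr ht.le hc hc, ?_⟩
      rw [hXX' t ht, hXZ t ht, bilin_congr ht.le hc hc]
  · rw [hXX' t ht, tendsto_iff_norm_sub_tendsto_zero]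
    have h1 := h0.div_const (t ^ (3 / 8 : ℝ))
    rw [zero_div] at h1
    refine squeeze_zero (fun _ => norm_nonneg _) (fun n => ?_) h1
    have h2 := ((hX.sub le_rfl hζ (hp n).1).1.norm_hat54_le ht).trans (hXn n)
    have e : hat54 ((X - picard M P u₀ n) t) = hat54 (X t) - hat54 (picard M P u₀ n t) :=
      (InDomain.sub (hX.memHom t ht) ((hp n).1.memHom t ht)).2
    rw [e] at h2
    rw [le_div_iff₀ (by positivity), norm_sub_rev, mul_comm]
    exact h2

/-- The two solutions may come with different pairs `(γ,R)` and `(γ',R')`. Each term of the bilinear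
difference is estimated with the constant belonging to its own solution, and `2γR + 2γ'R' < 1/2 +
1/2`, so the norm of the difference vanishes. -/
theorem IsGlobalMildSolution.unique {X X' : ℝ → 𝓢'(R3, C3)} (h : IsGlobalMildSolution M P u₀ X)
    (h' : IsGlobalMildSolution M P u₀ X') {t : ℝ} (ht : 0 ≤ t) : X t = X' t := by
  obtain ⟨hX, hm, hY, γ, R, hγ0, hR, hγ, hYR, hs, hN⟩ := h
  obtain ⟨hX', hm', -, γ', R', hγ0', hR', hγ', hYR', hs', hN'⟩ := h'
  rcases ht.eq_or_lt with rfl | ht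
  · rw [(hX 0 le_rfl).2, (hX' 0 le_rfl).2, bilin_zero, bilin_zero]
  have hζ : ContinuousOn (0 : ℝ → ℝ) (Ioi 0) := continuousOn_const
  have hI' : ∀ t ∈ Ioi (0 : ℝ), Ioc 0 t ⊆ Ioi 0 := fun t _ => Ioc_subset_Ioi_zero
  have h1 := bilin_sub_bilin le_rfl hI' hζ hγ hγ' hm hm'
  have e : ∀ s ∈ Ioi (0 : ℝ), (X - X') s = (bilin M P X X - bilin M P X' X') s := by
    intro s hs
    have h2 := (hX s (le_of_lt hs)).2
    have h3 := (hX' s (le_of_lt hs)).2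
    rw [Pi.sub_apply, Pi.sub_apply]
    nth_rewrite 1 [h2, h3]
    abel
  refine hm.eq_of_normB_sub hm' ?_ ht
  rw [← normB_congr e] at h1
  have a2 : 0 ≤ normB 0 0 (Ioi 0) (X - X') := normB_nonneg le_rfl
  clear e hX hX' hm hm' hY hYR hYR' hγ hγ'
  generalize normB 0 0 (Ioi 0) (X - X') = d at *
  generalize normB 0 0 (Ioi 0) X = x at *
  generalize normB 0 0 (Ioi 0) X' = y at *
  have h2 : γ * d * x + γ' * y * d ≤ γ * d * (2 * R) + γ' * (2 * R') * d := by gcongr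
  by_contra hd
  have hd' := not_le.1 hd
  nlinarith

/-! ### Bounds of the solution in the weighted spaces -/

/-- Lower semicontinuity by Fatou's lemma along an almost everywhere convergent subsequence;
convergence in the weighted norm is not required. -/
lemma memLp_wmul_of_tendsto {w : R3 → ℝ} (hw : Measurable w) {g : ℕ → Lp F 2 (volume : Measure R3)}
    {g₀ : Lp F 2 (volume : Measure R3)} (hg : Tendsto g atTop (𝓝 g₀)) {K : ℝ}
    (h : ∀ n, MemLp (wmul w (g n)) 2) (hK : ∀ n, ‖toL2 (wmul w (g n))‖ ≤ K) :
    MemLp (wmul w g₀) 2 ∧ ‖toL2 (wmul w g₀)‖ ≤ K := by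
  have hK0 : 0 ≤ K := (norm_nonneg _).trans (hK 0)
  obtain ⟨ns, -, hns⟩ := (tendstoInMeasure_of_tendsto_Lp hg).exists_seq_tendsto_ae
  have h1 : eLpNorm (wmul w g₀) 2 ≤ ENNReal.ofReal K := by
    refine (Lp.eLpNorm_lim_le_liminf_eLpNorm (f := fun n => wmul w (g (ns n)))
      (fun n => (h _).1) (wmul w g₀) ?_).trans ?_
    · filter_upwards [hns] with ξ hξ
      exact hξ.const_smul _
    · refine liminf_le_of_le (by isBoundedDefault) fun b hb => ?_
      obtain ⟨n, hn⟩ := hb.exists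
      refine hn.trans ?_
      rw [← enorm_toL2 (h _), ← ofReal_norm]
      exact ENNReal.ofReal_le_ofReal (hK _)
  have h2 : MemLp (wmul w g₀) 2 :=
    ⟨aestronglyMeasurable_wmul hw (Lp.memLp g₀).1, h1.trans_lt ENNReal.ofReal_lt_top⟩
  refine ⟨h2, ?_⟩
  rw [norm_toL2 h2]
  exact ENNReal.toReal_le_of_le_ofReal hK0 h1

lemma wmul_expPow_hat54 {a : ℝ} {f : 𝓢'(R3, C3)} (h : MemHom (5 / 4) f) :
    wmul (expPow a 0) (hat54 f) =ᵐ[volume] wmul (expPow a (5 / 4)) (funRep (𝓕 f)) :=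
  (wmul_expPow_invW a (hat54 f)).symm.trans (wmul_congr _ (InDomain.funRep_ae_eq_invW h).symm)

/-- The bounds that the iterates satisfy hold for the solution. -/
theorem IsGlobalMildSolution.inDomain {C₁ C₃ : ℝ} (h₁ : IsLinearConstant C₁)
    (h₃ : IsBilinearConstant M P C₃) (hu₀ : MemHom (1 / 2) u₀)
    (hs₀ : 4 * C₁ * C₃ * expNorm 0 (1 / 2) u₀ < 1)
    {X : ℝ → 𝓢'(R3, C3)} (hX : IsGlobalMildSolution M P u₀ X) {lam0 : ℝ} (h0 : 0 ≤ lam0)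
    (hs : 4 * C₁ * C₃ * expNorm 0 (1 / 2) u₀ * jap lam0 ^ 2 * Real.exp (lam0 ^ 2 / 4) < 1)
    {T t : ℝ} (ht : t ∈ Ioc 0 T) :
    InDomain (expPow (theta lam0 T t) (5 / 4)) (X t) ∧
      ‖hatMul (expPow (theta lam0 T t) (5 / 4)) (X t)‖ ≤
        2 * (C₁ * expNorm 0 (1 / 2) u₀) * (t ^ (-(3 / 8) : ℝ) * Real.exp (zeta lam0 T t)) := by
  have hT := ht.1.trans_le ht.2
  have hE : 0 ≤ expNorm 0 (1 / 2) u₀ := norm_nonneg _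
  have p1 := h₁.1
  have p3 := h₃.1
  have hR : 0 ≤ C₁ * expNorm 0 (1 / 2) u₀ := mul_nonneg p1.le hE
  -- By uniqueness the given solution may be replaced by the Picard limit, whose iterates obey the
  -- weighted bounds on `(0,T]`.
  obtain ⟨X', hX', hlim⟩ := exists_globalMildSolution (isBilinearBound_Ioi h₃) p3.le hR
    (memB_heat_Ioi h₁ hu₀).1 (memB_heat_Ioi h₁ hu₀).2 (by linarith)
  have hXt : X t = X' t := hX.unique hX' ht.1.le
  have hm : MemHom (5 / 4) (X' t) := hX'.2.1.memHom t ht.1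
  have hY := h₁.2 lam0 T h0 hT u₀ hu₀
  have hp := picard_memB (M := M) (P := P) Ioc_subset_Ioi_zero (continuous_zeta _ _).continuousOn
    (h₃.2 lam0 T h0 hT) (mul_nonneg (mul_nonneg p3.le (sq_nonneg _)) (Real.exp_nonneg _)) hR hY.1
    hY.2 (by linarith)
  have hz : 0 ≤ t ^ (-(3 / 8) : ℝ) * Real.exp (zeta lam0 T t) := by
    have := ht.1
    positivity
  have e (n : ℕ) := wmul_expPow_hat54 (a := theta lam0 T t) ((hp n).1.memHom t ht)
  have h := memLp_wmul_of_tendsto (measurable_expPow (theta lam0 T t) 0) (hlim t ht.1)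
    (fun n => (((hp n).1.inDomain t ht).memLp).ae_eq (e n).symm) (fun n => by
      rw [toL2_congr (e n)]
      exact ((hp n).1.norm_hatMul_le Ioc_subset_Ioi_zero ht).trans
        (mul_le_mul_of_nonneg_right (hp n).2 hz))
  have e' := wmul_expPow_hat54 (a := theta lam0 T t) hm
  rw [hXt]
  refine ⟨(InDomain.rep hm).inDomain (h.1.ae_eq e'), ?_⟩
  rw [hatMul, ← toL2_congr e']
  exact h.2

end MildNS
end

noncomputable section

namespace MildNS

set_option linter.unusedSectionVars false

open Filter Topology

variable {F : Type*} [NormedAddCommGroup F] [InnerProductSpace ℂ F] [CompleteSpace F]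
variable {M : Matrix (Fin 3) (Fin 3) ℝ} {P : FiberedProjection} {u₀ : 𝓢'(R3, C3)}

/-! ### Bounds of lower order -/

lemma zeta_self {lam0 t : ℝ} (ht : 0 < t) : Real.exp (zeta lam0 t t) =
    Real.exp (lam0 ^ 2 / 4) * jap lam0 ^ (3 / 4 : ℝ) := by
  rw [exp_zeta, lam, div_self ht.ne', Real.sqrt_one, mul_one]

lemma theta_self {lam0 t : ℝ} (ht : 0 < t) : theta lam0 t t = lam0 * √t := by
  rw [theta, lam, div_self ht.ne', Real.sqrt_one, mul_one]

/-- The constant in the bounds of lower order. -/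
def lowConst (M : Matrix (Fin 3) (Fin 3) ℝ) (σ : ℝ) : ℝ :=
  2 + 2 * √(convectionConst M).toReal * betaConst σ

lemma lowConst_pos (M : Matrix (Fin 3) (Fin 3) ℝ) (σ : ℝ) : 0 < lowConst M σ := by
  have := betaConst_nonneg σ
  unfold lowConst; positivity

lemma lowConst_sum_le {M : Matrix (Fin 3) (Fin 3) ℝ} {σ a b x y : ℝ} (hx : 0 ≤ x) (hy : 0 ≤ y)
    (ha : a ≤ 2 * x) (hb : b ≤ 2 * √(convectionConst M).toReal * betaConst σ * y) :
    a + b ≤ lowConst M σ * (x + y) := by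
  have h : 0 ≤ 2 * √(convectionConst M).toReal * betaConst σ := by
    have := betaConst_nonneg σ
    positivity
  rw [lowConst]
  nlinarith [mul_nonneg h hx]

/-- A bootstrap through `X = Y + B(X,X)`: the `Ḣ^{5/4}` bound makes the nonlinear term admissible in
the Duhamel estimate, which is now evaluated with the lower exponent `σ`. The heat term gains no
power of `A` and is bounded by its weight alone. The choice `T = t` gives `κ√t = λ₀`. -/
theorem IsGlobalMildSolution.inDomain_low {C₁ C₃ σ : ℝ} (h₁ : IsLinearConstant C₁)
    (h₃ : IsBilinearConstant M P C₃) (hu₀ : MemHom (1 / 2) u₀)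
    (hs₀ : 4 * C₁ * C₃ * expNorm 0 (1 / 2) u₀ < 1)
    {X : ℝ → 𝓢'(R3, C3)} (hX : IsGlobalMildSolution M P u₀ X) {lam0 : ℝ} (h0 : 0 ≤ lam0)
    (hs : 4 * C₁ * C₃ * expNorm 0 (1 / 2) u₀ * jap lam0 ^ 2 * Real.exp (lam0 ^ 2 / 4) < 1)
    (hσ₀ : 0 ≤ σ) (hσ : σ < 2) (hu : InDomain (expPow 0 σ) u₀) {t : ℝ} (ht : 0 < t) :
    InDomain (expPow (lam0 * √t) σ) (X t) ∧ expNorm (lam0 * √t) σ (X t) ≤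
      lowConst M σ * (Real.exp (lam0 ^ 2 / 4) * expNorm 0 σ u₀ +
        jap lam0 ^ (σ + 3 / 2) * Real.exp (lam0 ^ 2 / 2) *
          (2 * C₁ * expNorm 0 (1 / 2) u₀) ^ 2 * t ^ (1 / 4 - σ / 2)) := by
  have hE : 0 ≤ expNorm 0 (1 / 2) u₀ := norm_nonneg _
  have p1 := h₁.1
  have hN : 0 ≤ 2 * (C₁ * expNorm 0 (1 / 2) u₀) :=
    mul_nonneg two_pos.le (mul_nonneg p1.le hE)
  have hb (s : ℝ) (hs' : s ∈ Ioc 0 t) := hX.inDomain h₁ h₃ hu₀ hs₀ h0 hs hs'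
  have hc : ContinuousOn (fun t => hat54 (X t)) (Ioc 0 t) :=
    hX.2.1.continuousOn_hat54_Ioi.mono Ioc_subset_Ioi_zero
  have hQ := duhamelBound_of_le (M := M) (P := P) h0 hN hc hc (fun s hs' => (hb s hs').1)
    (fun s hs' => (hb s hs').1) (fun s hs' => (hb s hs').2) (fun s hs' => (hb s hs').2)
  have hD : 0 ≤ √(convectionConst M).toReal * (2 * (C₁ * expNorm 0 (1 / 2) u₀)) *
      (2 * (C₁ * expNorm 0 (1 / 2) u₀)) := mul_nonneg (mul_nonneg (Real.sqrt_nonneg _) hN) hN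
  have hκ : 0 ≤ lam0 / √t := div_nonneg h0 (Real.sqrt_nonneg _)
  have htt : t ∈ Ioc 0 t := ⟨ht, le_rfl⟩
  have hm (s : ℝ) (hs' : s ∈ Ioc 0 t) : MemHom (5 / 4) (X s) := hX.2.1.memHom s hs'.1
  have hst : √t ≠ 0 := (Real.sqrt_pos.2 ht).ne'
  have e1 : lam0 / √t * t = lam0 * √t := by
    rw [← theta_eq lam0 t ht.le, theta_self ht]
  have e2 : lam0 / √t * √t = lam0 := div_mul_cancel₀ _ hst
  have e3 : (lam0 / √t) ^ 2 * t = lam0 ^ 2 := by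
    nth_rewrite 2 [← Real.sq_sqrt ht.le]
    rw [← mul_pow, e2]
  have hB := inDomain_bilin hκ hD hσ₀ hσ htt hm hm hQ
  have hBn := norm_bilinHat_le hκ hD hσ₀ hσ hQ htt
  have hH := InDomain.heat (κ := lam0 / √t) (τ := 0) ht le_rfl two_pos.le hu
  have hHn := norm_hatMul_heat_le (κ := lam0 / √t) (τ := 0) ht le_rfl two_pos.le hu
  rw [add_zero, e1] at hH hHn
  rw [e1] at hB
  have hXt := (hX.1 t ht.le).2
  rw [hXt]
  refine ⟨hH.1.add hB.1, ?_⟩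
  rw [expNorm_eq, hatMul_add hH.1 hB.1, hB.2]
  refine (norm_add_le _ _).trans (lowConst_sum_le (mul_nonneg (Real.exp_nonneg _) (norm_nonneg _))
    ?_ ?_ ?_)
  · have p := jap_pos lam0
    refine mul_nonneg (mul_nonneg (mul_nonneg (Real.rpow_nonneg p.le _) (Real.exp_nonneg _))
      (sq_nonneg _)) (Real.rpow_nonneg ht.le _)
  · refine hHn.trans_eq ?_
    rw [kerBound, e3, expNorm_eq]
    simp
    ring
  · refine hBn.trans_eq ?_
    rw [timeBound, e2, e3]
    ring

lemma rep_toTD_of_eq {f : Lp F 2 (volume : Measure R3)} {u : 𝓢'(R3, F)}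
    (h : u = Lp.toTemperedDistribution f) :
    InDomain (expPow 0 0) u ∧ expNorm 0 0 u = ‖f‖ := by
  have hr := fourier_toTD f
  rw [← h] at hr
  have e : wmul (expPow 0 0) (𝓕 f : Lp F 2 (volume : Measure R3)) =
      (𝓕 f : Lp F 2 (volume : Measure R3)) := by
    ext1 ξ; simp [wmul, expPow]
  refine ⟨hr.inDomain (by rw [e]; exact Lp.memLp _), ?_⟩
  rw [expNorm_eq, hr.hatMul, e, toL2_coeFn]
  exact (Lp.fourierTransformₗᵢ R3 F).norm_map f

/-! ### The critical parameter -/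

lemma jap_sq (x : ℝ) : jap x ^ 2 = 1 + x ^ 2 := Real.sq_sqrt (by positivity)

lemma expNorm_zero (a s : ℝ) : expNorm a s (0 : 𝓢'(R3, F)) = 0 := by
  rw [expNorm_eq, (inDomain_zero _).2, norm_zero]

lemma eq_zero_of_expNorm {s : ℝ} {f : 𝓢'(R3, F)} (h : MemHom s f) (h0 : expNorm 0 s f = 0) :
    f = 0 := by
  rw [expNorm_eq, norm_eq_zero] at h0
  have h1 := InDomain.coeFn_hatMul h
  rw [h0] at h1
  refine eq_of_fourier_rep (InDomain.rep h) fourier_zero_rep ?_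
  filter_upwards [ae_symA_pos, h1, Lp.coeFn_zero F 2 (volume : Measure R3)] with ξ hξ h2 h3
  rw [h3] at h2
  simp only [Pi.zero_apply, wmul, expPow_zero_left] at h2
  have h4 : ((symA ξ ^ s : ℝ) : ℂ) ≠ 0 := Complex.ofReal_ne_zero.2 (Real.rpow_pos_of_pos hξ s).ne'
  exact (smul_eq_zero.1 h2.symm).resolve_left h4

/-- The function whose value is `1` at the critical parameter. -/
def critFun (c l : ℝ) : ℝ := c * jap l ^ 2 * Real.exp (l ^ 2 / 4)

lemma critFun_lt {c l l' : ℝ} (hc : 0 < c) (hl : 0 ≤ l) (h : l < l') :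
    critFun c l < critFun c l' := by
  have h2 : l ^ 2 < l' ^ 2 := by gcongr
  rw [critFun, critFun, jap_sq, jap_sq]
  gcongr

lemma exists_critFun_eq_one {c : ℝ} (hc : 0 < c) (h : c < 1) : ∃ l, 0 < l ∧ critFun c l = 1 := by
  have h0 : critFun c 0 = c := by simp [critFun, jap]
  have hcont : Continuous (critFun c) := by
    unfold critFun
    have := continuous_jap
    fun_prop
  -- At `l² = 1/c` the polynomial factor alone gives `c(1 + 1/c) = c + 1 ≥ 1`.
  have h1 : 1 ≤ critFun c √(1 / c) := by
    rw [critFun, jap_sq, Real.sq_sqrt (by positivity)]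
    have h2 : 1 ≤ Real.exp (1 / c / 4) := Real.one_le_exp (by positivity)
    have h3 : 1 ≤ c * (1 + 1 / c) := by
      rw [mul_add, mul_one_div_cancel hc.ne']; linarith
    calc (1 : ℝ) = 1 * 1 := (mul_one 1).symm
      _ ≤ _ := by gcongr
  obtain ⟨l, hl, hl1⟩ := intermediate_value_Icc (Real.sqrt_nonneg (1 / c)) hcont.continuousOn
    ⟨h0.trans_le h.le, h1⟩
  refine ⟨l, hl.1.lt_of_ne ?_, hl1⟩
  rintro rfl
  rw [h0] at hl1
  exact h.ne hl1

theorem existsUnique_isCriticalLambda {C₁ C₃ : ℝ} (p₁ : 0 < C₁) (p₃ : 0 < C₃)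
    (hu₀ : MemHom (1 / 2) u₀) (hs : 4 * C₁ * C₃ * expNorm 0 (1 / 2) u₀ < 1) :
    ∃! L : ℝ≥0∞, IsCriticalLambda C₁ C₃ u₀ L := by
  by_cases h : u₀ = 0
  · refine ⟨⊤, Or.inl ⟨h, rfl⟩, fun L hL => ?_⟩
    rcases hL with hL | hL
    · exact hL.2
    · exact absurd h hL.1
  · have hE : 0 < expNorm 0 (1 / 2) u₀ :=
      (norm_nonneg _).lt_of_ne fun h' => h (eq_zero_of_expNorm hu₀ h'.symm)
    have hc : 0 < 4 * C₁ * C₃ * expNorm 0 (1 / 2) u₀ := mul_pos (by positivity) hE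
    obtain ⟨l, hl0, hl⟩ := exists_critFun_eq_one hc hs
    refine ⟨ENNReal.ofReal l, Or.inr ⟨h, l, hl0, rfl, hl⟩, fun L hL => ?_⟩
    rcases hL with hL | ⟨-, l', hl0', rfl, hl'⟩
    · exact absurd hL.1 h
    · rcases lt_trichotomy l l' with h1 | h1 | h1
      · exact absurd (hl.trans hl'.symm) (critFun_lt hc hl0.le h1).ne
      · rw [h1]
      · exact absurd (hl'.trans hl.symm) (critFun_lt hc hl0'.le h1).ne

lemma IsCriticalLambda.lt_one {C₁ C₃ : ℝ} (p₁ : 0 < C₁) (p₃ : 0 < C₃) (hu₀ : MemHom (1 / 2) u₀)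
    {L : ℝ≥0∞} (h : IsCriticalLambda C₁ C₃ u₀ L) {lam0 : ℝ} (h0 : 0 ≤ lam0)
    (hl : ENNReal.ofReal lam0 < L) :
    4 * C₁ * C₃ * expNorm 0 (1 / 2) u₀ * jap lam0 ^ 2 * Real.exp (lam0 ^ 2 / 4) < 1 := by
  rcases h with ⟨rfl, -⟩ | ⟨h, l, hl0, rfl, he⟩
  · rw [expNorm_zero]; simp
  · have hE : 0 < expNorm 0 (1 / 2) u₀ :=
      (norm_nonneg _).lt_of_ne fun h' => h (eq_zero_of_expNorm hu₀ h'.symm)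
    have hc : 0 < 4 * C₁ * C₃ * expNorm 0 (1 / 2) u₀ := mul_pos (by positivity) hE
    exact (critFun_lt hc h0 ((ENNReal.ofReal_lt_ofReal_iff hl0).1 hl)).trans_eq he

end MildNS
end

noncomputable section

namespace MildNS

set_option linter.unusedSectionVars false

open Filter Topology

variable {F : Type*} [NormedAddCommGroup F] [InnerProductSpace ℂ F] [CompleteSpace F]

/-! ### Translations and components in Fourier space -/

/-- The complex exponential `e^{2πi z·ξ}`. -/
def phase (z : C3) (ξ : R3) : ℂ := Complex.exp (2 * Real.pi * Complex.I * ∑ j, z j * ξ j)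

lemma phase_toComplex (η ξ : R3) :
    phase (toComplex η) ξ = Complex.exp (Complex.I * ((2 * Real.pi * inner ℝ ξ η : ℝ) : ℂ)) := by
  rw [phase]
  congr 1
  simp only [toComplex, PiLp.inner_apply, RCLike.inner_apply, conj_trivial]
  push_cast
  ring

lemma iteratedDeriv_exp_I (n : ℕ) :
    iteratedDeriv n (fun x : ℝ => Complex.exp (Complex.I * x)) =
      fun x : ℝ => Complex.I ^ n * Complex.exp (Complex.I * x) := by
  induction n with
  | zero => simp
  | succ n ih =>
    rw [iteratedDeriv_succ, ih]
    ext1 x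
    have h : HasDerivAt (fun x : ℝ => Complex.I ^ n * Complex.exp (Complex.I * x))
        (Complex.I ^ n * (Complex.exp (Complex.I * x) * (Complex.I * 1))) x :=
      ((Complex.ofRealCLM.hasDerivAt.const_mul Complex.I).cexp).const_mul _
    rw [h.deriv]
    ring

lemma hasTemperateGrowth_exp_I :
    (fun x : ℝ => Complex.exp (Complex.I * x)).HasTemperateGrowth := by
  refine ⟨(contDiff_const.mul Complex.ofRealCLM.contDiff).cexp, fun n => ⟨0, 1, fun x => ?_⟩⟩
  rw [norm_iteratedFDeriv_eq_norm_iteratedDeriv, iteratedDeriv_exp_I, norm_mul, norm_pow,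
    Complex.norm_I, mul_comm Complex.I, Complex.norm_exp_ofReal_mul_I]
  simp

lemma hasTemperateGrowth_phase (η : R3) : (phase (toComplex η)).HasTemperateGrowth := by
  have h : phase (toComplex η) = (fun x : ℝ => Complex.exp (Complex.I * x)) ∘
      fun ξ : R3 => 2 * Real.pi * inner ℝ ξ η := by
    ext1 ξ; exact phase_toComplex η ξ
  rw [h]
  exact hasTemperateGrowth_exp_I.comp (by fun_prop)

lemma fourier_translate (η : R3) (f : 𝓢'(R3, F)) : 𝓕 (translate η f) =
    TemperedDistribution.smulLeftCLM F (phase (toComplex η)) (𝓕 f) := by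
  ext φ
  rw [TemperedDistribution.smulLeftCLM_apply_apply, TemperedDistribution.fourier_apply,
    TemperedDistribution.fourier_apply]
  change f (SchwartzMap.compSubConstCLM ℂ η (𝓕 φ)) = _
  congr 1
  ext x
  rw [SchwartzMap.compSubConstCLM_apply, SchwartzMap.fourier_coe, SchwartzMap.fourier_coe,
    Real.fourier_eq', Real.fourier_eq']
  refine integral_congr_ae (ae_of_all _ fun ξ => ?_)
  simp only [SchwartzMap.smulLeftCLM_apply_apply (hasTemperateGrowth_phase η), phase_toComplex,
    smul_eq_mul, ← mul_assoc, ← Complex.exp_add, inner_sub_right]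
  congr 2
  push_cast
  ring

lemma IsRepresentedBy.component {f : 𝓢'(R3, C3)} {g : R3 → C3} (h : IsRepresentedBy f g)
    (j : Fin 3) : IsRepresentedBy (component j f) (fun ξ => g ξ j) := by
  intro φ
  let p : C3 →L[ℂ] ℂ := EuclideanSpace.proj j
  have e : (fun x => φ x • g x j) = fun x => p (φ x • g x) := by
    ext1 x; simp [p]
  rw [e]
  refine ⟨p.integrable_comp (h φ).1, ?_⟩
  rw [p.integral_comp_comm (h φ).1, ← (h φ).2]
  rfl

lemma fourier_component (j : Fin 3) (f : 𝓢'(R3, C3)) :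
    𝓕 (component j f) = component j (𝓕 f) := rfl

lemma InDomain.component {w : R3 → ℝ} {f : 𝓢'(R3, C3)} (h : InDomain w f) (j : Fin 3) :
    InDomain w (component j f) := by
  have hr : IsRepresentedBy (𝓕 (MildNS.component j f)) (fun ξ => funRep (𝓕 f) ξ j) := by
    rw [fourier_component]
    exact h.rep.component j
  refine hr.inDomain ?_
  have h1 := (EuclideanSpace.proj j : C3 →L[ℂ] ℂ).comp_memLp' h.memLp
  refine h1.ae_eq (ae_of_all _ fun ξ => ?_)
  simp [wmul]

/-! ### Analyticity in a tube -/

/-- Only `Im z` contributes to the modulus, and Cauchy-Schwarz bounds `-2π ξ·Im z` by `|Im z| A`. -/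
lemma norm_phase_le (z : C3) (ξ : R3) : ‖phase z ξ‖ ≤ Real.exp (‖imPart z‖ * symA ξ) := by
  rw [phase, Complex.norm_exp, Real.exp_le_exp]
  have e : (2 * Real.pi * Complex.I * ∑ j, z j * (ξ j : ℂ)).re =
      -(2 * Real.pi * inner ℝ ξ (imPart z)) := by
    simp only [PiLp.inner_apply, RCLike.inner_apply, conj_trivial, imPart, Fin.sum_univ_three]
    simp
  rw [e, symA]
  have h1 := neg_le_of_abs_le (abs_real_inner_le_norm ξ (imPart z))
  nlinarith [Real.pi_pos]

lemma continuous_phase (z : C3) : Continuous (phase z) := by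
  unfold phase; fun_prop

lemma phase_add (z v : C3) (ξ : R3) : phase (z + v) ξ = phase z ξ * phase v ξ := by
  rw [phase, phase, phase, ← Complex.exp_add]
  congr 1
  simp only [PiLp.add_apply, add_mul, Finset.sum_add_distrib, mul_add]

lemma norm_imPart_add_le (z v : C3) : ‖imPart (z + v)‖ ≤ ‖imPart z‖ + ‖v‖ := by
  have h1 : imPart (z + v) = imPart z + imPart v := by
    ext j; simp [imPart]
  have h2 : ‖imPart v‖ ≤ ‖v‖ := by
    rw [EuclideanSpace.norm_eq, EuclideanSpace.norm_eq]
    refine Real.sqrt_le_sqrt (Finset.sum_le_sum fun j _ => ?_)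
    have : ‖imPart v j‖ ≤ ‖v j‖ := Complex.abs_im_le_norm (v j)
    gcongr
  rw [h1]
  exact (norm_add_le _ _).trans (by gcongr)

/-- The logarithmic derivative of the exponential in the direction `v`. -/
def phaseDeriv (v : C3) (ξ : R3) : ℂ := 2 * Real.pi * Complex.I * ∑ j, v j * ξ j

lemma norm_phaseDeriv_le (v : C3) (ξ : R3) : ‖phaseDeriv v ξ‖ ≤ ‖v‖ * symA ξ := by
  have h : (∑ j, v j * (ξ j : ℂ)) = inner ℂ (toComplex ξ) v := by
    simp [toComplex, PiLp.inner_apply]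
  have h2 : ‖toComplex ξ‖ = ‖ξ‖ := by
    simp [toComplex, EuclideanSpace.norm_eq]
  rw [phaseDeriv, norm_mul, h, symA]
  have h3 := norm_inner_le_norm (𝕜 := ℂ) (toComplex ξ) v
  rw [h2] at h3
  have h4 : ‖(2 * Real.pi * Complex.I : ℂ)‖ = 2 * Real.pi := by
    simp [abs_of_pos Real.pi_pos]
  rw [h4]
  calc 2 * Real.pi * ‖inner ℂ (toComplex ξ) v‖ ≤ 2 * Real.pi * (‖ξ‖ * ‖v‖) := by gcongr
    _ = _ := by ring

/-- The second order Taylor remainder of the exponential in the increment `2πi v·ξ`, whose modulus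
is at most `|v| A`. -/
lemma norm_phase_sub_le (z v : C3) (ξ : R3) :
    ‖phase (z + v) ξ - phase z ξ - phaseDeriv v ξ * phase z ξ‖ ≤
      Real.exp (‖imPart z‖ * symA ξ) * ((‖v‖ * symA ξ) ^ 2 * Real.exp (‖v‖ * symA ξ)) := by
  have e : phase (z + v) ξ - phase z ξ - phaseDeriv v ξ * phase z ξ =
      phase z ξ * (Complex.exp (phaseDeriv v ξ) - ∑ m ∈ Finset.range 2, phaseDeriv v ξ ^ m / m.factorial) := by
    rw [phase_add]
    have : phase v ξ = Complex.exp (phaseDeriv v ξ) := rfl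
    rw [this]
    simp [Finset.sum_range_succ]
    ring
  rw [e, norm_mul]
  refine mul_le_mul (norm_phase_le z ξ) ?_ (norm_nonneg _) (Real.exp_nonneg _)
  refine (Complex.norm_exp_sub_sum_le_norm_mul_exp _ 2).trans ?_
  have := norm_phaseDeriv_le v ξ
  gcongr

lemma mul_exp_neg_le {δ x : ℝ} (hδ : 0 < δ) : x * Real.exp (-(δ * x)) ≤ 1 / δ := by
  have h := Real.add_one_le_exp (δ * x)
  rw [Real.exp_neg, ← div_eq_mul_inv, div_le_div_iff₀ (Real.exp_pos _) hδ]
  linarith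

lemma sq_mul_exp_neg_le {δ x : ℝ} (hδ : 0 < δ) (hx : 0 ≤ x) :
    x ^ 2 * Real.exp (-(δ * x)) ≤ 2 / δ ^ 2 := by
  have h := Real.quadratic_le_exp_of_nonneg (x := δ * x) (by positivity)
  rw [Real.exp_neg, ← div_eq_mul_inv, div_le_div_iff₀ (Real.exp_pos _) (by positivity)]
  nlinarith [mul_nonneg hδ.le hx]

/-- Multiplication by a complex function, as a map to `L²`. -/
def cmul (m : R3 → ℂ) (h : R3 → F) : R3 → F := fun ξ => m ξ • h ξ

lemma memLp_cmul {m : R3 → ℂ} (hm : Measurable m) {K : ℝ} (hK : ∀ ξ, ‖m ξ‖ ≤ K) {h : R3 → F}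
    (hh : MemLp h 2) : MemLp (cmul m h) 2 := by
  refine hh.of_le_mul (c := K) (hm.aestronglyMeasurable.smul hh.1) (ae_of_all _ fun ξ => ?_)
  rw [cmul, norm_smul]
  exact mul_le_mul_of_nonneg_right (hK ξ) (norm_nonneg _)

lemma norm_toL2_cmul_le {m : R3 → ℂ} (hm : Measurable m) {K : ℝ} (hK : ∀ ξ, ‖m ξ‖ ≤ K)
    {h : R3 → F} (hh : MemLp h 2) : ‖toL2 (cmul m h)‖ ≤ K * ‖toL2 h‖ :=
  norm_toL2_le (memLp_cmul hm hK hh) hh (ae_of_all _ fun ξ => by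
    rw [cmul, norm_smul]
    exact mul_le_mul_of_nonneg_right (hK ξ) (norm_nonneg _))

/-- The symbol `e^{2πi z·ξ} e^{-bA}`. -/
def tubeW (b : ℝ) (z : C3) (ξ : R3) : ℂ := phase z ξ * (Real.exp (-(b * symA ξ)) : ℂ)

lemma measurable_tubeW (b : ℝ) (z : C3) : Measurable (tubeW b z) := by
  have := (continuous_phase z).measurable
  have := measurable_symA
  unfold tubeW
  fun_prop

lemma norm_tubeW_le {b δ : ℝ} {z : C3} (hz : ‖imPart z‖ + δ ≤ b) (ξ : R3) :
    ‖tubeW b z ξ‖ ≤ Real.exp (-(δ * symA ξ)) := by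
  rw [tubeW, norm_mul, Complex.norm_real, Real.norm_of_nonneg (Real.exp_nonneg _)]
  refine (mul_le_mul_of_nonneg_right (norm_phase_le z ξ) (Real.exp_nonneg _)).trans ?_
  rw [← Real.exp_add, Real.exp_le_exp]
  nlinarith [symA_nonneg ξ]

lemma norm_tubeW_le_one {b : ℝ} {z : C3} (hz : ‖imPart z‖ ≤ b) (ξ : R3) : ‖tubeW b z ξ‖ ≤ 1 := by
  have := norm_tubeW_le (b := b) (δ := 0) (z := z) (by linarith) ξ
  simpa using this

lemma differentiableAt_toL2_tubeW {b : ℝ} {z : C3} (hz : ‖imPart z‖ < b) {h : R3 → F} (hh : MemLp h 2) :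
    DifferentiableAt ℂ (fun z => toL2 (cmul (tubeW b z) h)) z := by
  -- The distance to the boundary of the tube is split in two: one `δ` allows increments `|v| ≤ δ`,
  -- the other leaves the decay `e^{-δA}` that absorbs the factor `A²` of the Taylor remainder.
  obtain ⟨δ, hδ, hδb⟩ : ∃ δ : ℝ, 0 < δ ∧ ‖imPart z‖ + 2 * δ = b :=
    ⟨(b - ‖imPart z‖) / 2, by linarith, by ring⟩
  have hA : ∀ ξ, ‖tubeW b z ξ‖ ≤ Real.exp (-(2 * δ * symA ξ)) :=
    fun ξ => norm_tubeW_le hδb.le ξ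
  let m : Fin 3 → R3 → ℂ := fun j ξ => phaseDeriv (EuclideanSpace.single j 1) ξ * tubeW b z ξ
  have hmm (j : Fin 3) : Measurable (m j) := by
    have h1 := measurable_tubeW b z
    have h2 : Measurable (phaseDeriv (EuclideanSpace.single j 1)) := by
      unfold phaseDeriv; fun_prop
    exact h2.mul h1
  have hmb (j : Fin 3) (ξ : R3) : ‖m j ξ‖ ≤ 1 / (2 * δ) := by
    have h1 := norm_phaseDeriv_le (EuclideanSpace.single j 1) ξ
    rw [PiLp.norm_single, norm_one, one_mul] at h1
    rw [norm_mul]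
    exact (mul_le_mul h1 (hA ξ) (norm_nonneg _) (symA_nonneg ξ)).trans
      (mul_exp_neg_le (by positivity))
  let D : C3 →L[ℂ] Lp F 2 (volume : Measure R3) :=
    ∑ j, (EuclideanSpace.proj j : C3 →L[ℂ] ℂ).smulRight (toL2 (cmul (m j) h))
  have hm (j : Fin 3) := memLp_cmul (hmm j) (hmb j) hh
  have hD (v : C3) : MemLp (cmul (fun ξ => phaseDeriv v ξ * tubeW b z ξ) h) 2 ∧
      D v = toL2 (cmul (fun ξ => phaseDeriv v ξ * tubeW b z ξ) h) := by
    have e : cmul (fun ξ => phaseDeriv v ξ * tubeW b z ξ) h =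
        (v 0 • cmul (m 0) h + v 1 • cmul (m 1) h) + v 2 • cmul (m 2) h := by
      ext1 ξ
      simp only [cmul, m, Pi.add_apply, Pi.smul_apply, smul_smul, ← add_smul]
      congr 1
      simp [phaseDeriv, Fin.sum_univ_three]
      ring
    have m0 := (hm 0).const_smul (v 0)
    have m1 := (hm 1).const_smul (v 1)
    have m2 := (hm 2).const_smul (v 2)
    rw [e]
    refine ⟨(m0.add m1).add m2, ?_⟩
    rw [toL2_add (m0.add m1) m2, toL2_add m0 m1, toL2_smul _ (hm 0), toL2_smul _ (hm 1),
      toL2_smul _ (hm 2)]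
    simp [D, Fin.sum_univ_three]
  have hE (v : C3) (hv : ‖v‖ ≤ δ) : ‖toL2 (cmul (tubeW b (z + v)) h) - toL2 (cmul (tubeW b z) h) -
      D v‖ ≤ (2 / δ ^ 2 * ‖toL2 h‖) * ‖‖v‖ ^ 2‖ := by
    have hzv : ‖imPart (z + v)‖ ≤ b := by
      have := norm_imPart_add_le z v
      linarith
    have m1 := memLp_cmul (measurable_tubeW b (z + v)) (norm_tubeW_le_one hzv) hh
    have m2 := memLp_cmul (measurable_tubeW b z) (norm_tubeW_le_one hz.le) hh
    rw [(hD v).2, ← toL2_sub m1 m2, ← toL2_sub (m1.sub m2) (hD v).1]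
    rw [Real.norm_of_nonneg (sq_nonneg _), mul_right_comm]
    refine norm_toL2_le ((m1.sub m2).sub (hD v).1) hh (ae_of_all _ fun ξ => ?_)
    have e : (cmul (tubeW b (z + v)) h - cmul (tubeW b z) h -
        cmul (fun ξ => phaseDeriv v ξ * tubeW b z ξ) h) ξ =
        ((phase (z + v) ξ - phase z ξ - phaseDeriv v ξ * phase z ξ) *
          (Real.exp (-(b * symA ξ)) : ℂ)) • h ξ := by
      simp only [Pi.sub_apply, cmul, tubeW, ← sub_smul]
      congr 1
      ring
    rw [e, norm_smul, norm_mul, Complex.norm_real,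
      Real.norm_of_nonneg (Real.exp_nonneg _)]
    refine mul_le_mul_of_nonneg_right ?_ (norm_nonneg _)
    have hs := symA_nonneg ξ
    calc _ ≤ Real.exp (‖imPart z‖ * symA ξ) * ((‖v‖ * symA ξ) ^ 2 * Real.exp (δ * symA ξ)) *
          Real.exp (-(b * symA ξ)) := by
          refine mul_le_mul_of_nonneg_right ((norm_phase_sub_le z v ξ).trans ?_) (Real.exp_nonneg _)
          gcongr
      _ = symA ξ ^ 2 * Real.exp (-(δ * symA ξ)) * ‖v‖ ^ 2 := by
          have : Real.exp (-(δ * symA ξ)) = Real.exp (‖imPart z‖ * symA ξ) *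
              Real.exp (δ * symA ξ) * Real.exp (-(b * symA ξ)) := by
            rw [← Real.exp_add, ← Real.exp_add, ← hδb]; congr 1; ring
          rw [this]; ring
      _ ≤ _ := by
          gcongr
          exact sq_mul_exp_neg_le hδ hs
  have hder : HasFDerivAt (fun z => toL2 (cmul (tubeW b z) h)) D z := by
    rw [hasFDerivAt_iff_isLittleO_nhds_zero]
    refine (Asymptotics.IsBigO.of_bound (g := fun v : C3 => ‖v‖ ^ 2) (2 / δ ^ 2 * ‖toL2 h‖)
      ?_).trans_isLittleO (Asymptotics.isLittleO_norm_pow_id one_lt_two)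
    filter_upwards [Metric.closedBall_mem_nhds (0 : C3) hδ] with v hv
    exact hE v (by simpa using hv)
  exact hder.differentiableAt

lemma imPart_toComplex (η : R3) : imPart (toComplex η) = 0 := by
  ext j; simp [imPart, toComplex]

/-- A function in the domain of `e^{bA} w(D)` is uniformly analytic in the tube of radius `a ≤ b`. -/
theorem uniformlyAnalytic_of_inDomain {w : R3 → ℝ} {a b : ℝ} (ha : 0 ≤ a) (hab : a ≤ b)
    {f : 𝓢'(R3, F)} (hf : InDomain (fun ξ => Real.exp (b * symA ξ) * w ξ) f) :
    UniformlyAnalytic w a f := by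
  set h : R3 → F := wmul (fun ξ => Real.exp (b * symA ξ) * w ξ) (funRep (𝓕 f)) with hh
  have hm : MemLp h 2 := hf.memLp
  -- The symbol `e^{2πi z·ξ} e^{-bA}` has modulus at most one in the tube, so the extension is
  -- bounded by `‖h‖`; for real `z` the factor `e^{-bA}` undoes the weight in `h` and leaves a
  -- translation.
  refine ⟨fun z => (Lp.fourierTransformₗᵢ R3 F).symm (toL2 (cmul (tubeW b z) h)), ?_,
    ⟨‖toL2 h‖, fun z hz => ?_⟩, fun η => ?_⟩
  · intro z hz
    have h1 := differentiableAt_toL2_tubeW (lt_of_lt_of_le hz hab) hm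
    exact (((Lp.fourierTransformₗᵢ R3 F).symm.toContinuousLinearEquiv.differentiableAt).comp z
      h1).differentiableWithinAt
  · rw [LinearIsometryEquiv.norm_map]
    have := norm_toL2_cmul_le (measurable_tubeW b z) (norm_tubeW_le_one (hz.le.trans hab)) hm
    rwa [one_mul] at this
  · have hr : IsRepresentedBy (𝓕 (translate η f))
        (fun ξ => phase (toComplex η) ξ • funRep (𝓕 f) ξ) := by
      rw [fourier_translate]
      exact hf.rep.smulLeft (hasTemperateGrowth_phase η)
    have e : wmul w (fun ξ => phase (toComplex η) ξ • funRep (𝓕 f) ξ) =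
        cmul (tubeW b (toComplex η)) h := by
      ext1 ξ
      have : ((Real.exp (-(b * symA ξ)) : ℝ) : ℂ) * ((Real.exp (b * symA ξ) : ℝ) : ℂ) = 1 := by
        rw [← Complex.ofReal_mul, ← Real.exp_add]; simp
      simp only [wmul, cmul, tubeW, hh, smul_smul]
      congr 1
      push_cast at this ⊢
      linear_combination (-(w ξ : ℂ) * phase (toComplex η) ξ) * this
    have hz : ‖imPart (toComplex η)‖ ≤ b := by
      rw [imPart_toComplex, norm_zero]; exact ha.trans hab
    refine ⟨hr.inDomain ?_, ?_⟩
    · rw [e]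
      exact memLp_cmul (measurable_tubeW b _) (norm_tubeW_le_one hz) hm
    · rw [applyMul_eq, hr.hatMul, e]
      rfl

/-! ### Lower bounds for the analyticity radius -/

lemma le_rad {w : R3 → ℝ} {f : 𝓢'(R3, C3)} {L : ℝ≥0∞} {τ : ℝ} (hτ : 0 < τ)
    (h : ∀ b : ℝ, 0 < b → ENNReal.ofReal b < L →
      InDomain (fun ξ => Real.exp (b * τ * symA ξ) * w ξ) f) :
    L * ENNReal.ofReal τ ≤ rad w f := by
  refine le_iInf fun j => le_of_forall_lt fun x hx => ?_
  have hτ' : ENNReal.ofReal τ ≠ 0 := (ENNReal.ofReal_pos.2 hτ).ne'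
  rw [← ENNReal.div_lt_iff (Or.inl hτ') (Or.inl ENNReal.ofReal_ne_top)] at hx
  obtain ⟨b, hb1, hb2⟩ := ENNReal.lt_iff_exists_nnreal_btwn.1 hx
  rw [ENNReal.div_lt_iff (Or.inl hτ') (Or.inl ENNReal.ofReal_ne_top)] at hb1
  have hb0 : 0 < (b : ℝ) := by
    rw [NNReal.coe_pos, pos_iff_ne_zero]
    rintro rfl
    simp at hb1
  have e : (b : ℝ≥0∞) = ENNReal.ofReal b := (ENNReal.ofReal_coe_nnreal).symm
  rw [e, ← ENNReal.ofReal_mul hb0.le] at hb1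
  rw [e] at hb2
  refine hb1.trans_le (le_sSup ⟨b * τ, mul_pos hb0 hτ, rfl, ?_⟩)
  exact uniformlyAnalytic_of_inDomain (mul_pos hb0 hτ).le le_rfl ((h b hb0 hb2).component j)

/-- An arbitrarily small exponential dominates any power: `⟨A⟩^r` is at most an integer power `n` of
`1 + A²`, and the rate `ε` is shared among the factors. Division by `n + 1` instead of `n` includes
the case `n = 0`. -/
lemma japPow_le {r ε : ℝ} (hε : 0 < ε) : ∃ K, ∀ ξ, japPow r ξ ≤ K * Real.exp (ε * symA ξ) := by
  obtain ⟨n, hn⟩ := exists_nat_ge (r / 2)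
  have h1 (x : ℝ) (hx : 0 ≤ x) : 1 + x ^ 2 ≤ (1 + 1 / ε ^ 2 * 2 * (n + 1) ^ 2) * Real.exp (ε / (n + 1) * x) := by
    have hd : 0 < ε / (n + 1) := by positivity
    have h := sq_mul_exp_neg_le hd hx
    have h2 := Real.one_le_exp (mul_nonneg hd.le hx)
    rw [Real.exp_neg, ← div_eq_mul_inv, div_le_iff₀ (Real.exp_pos _)] at h
    have e : 2 / (ε / (n + 1)) ^ 2 = 1 / ε ^ 2 * 2 * (n + 1) ^ 2 := by
      field_simp
    rw [e] at h
    linarith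
  set K := 1 + 1 / ε ^ 2 * 2 * ((n : ℝ) + 1) ^ 2
  have hK : 0 ≤ K := by positivity
  refine ⟨K ^ n, fun ξ => ?_⟩
  have hs := symA_nonneg ξ
  calc japPow r ξ ≤ (1 + symA ξ ^ 2) ^ (n : ℝ) := by
        rw [japPow]
        exact Real.rpow_le_rpow_of_exponent_le (by nlinarith [sq_nonneg (symA ξ)]) hn
    _ = (1 + symA ξ ^ 2) ^ n := Real.rpow_natCast _ _
    _ ≤ (K * Real.exp (ε / (n + 1) * symA ξ)) ^ n := by
        gcongr
        exact h1 _ hs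
    _ = K ^ n * Real.exp (n * (ε / (n + 1) * symA ξ)) := by
        rw [mul_pow, ← Real.exp_nat_mul]
    _ ≤ K ^ n * Real.exp (ε * symA ξ) := by
        refine mul_le_mul_of_nonneg_left (Real.exp_le_exp.2 ?_) (by positivity)
        have : (n : ℝ) * (ε / (n + 1)) ≤ ε := by
          rw [← mul_div_assoc, div_le_iff₀ (by positivity)]
          nlinarith
        calc (n : ℝ) * (ε / (n + 1) * symA ξ) = n * (ε / (n + 1)) * symA ξ := by ring
          _ ≤ ε * symA ξ := by gcongr

/-- The gap between `a` and `b` pays for the polynomial weight, so an exponential bound in `L²`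
serves every `H^r`. -/
lemma InDomain.japPow {a b r : ℝ} (hab : a < b) {f : 𝓢'(R3, F)} (h : InDomain (expPow b 0) f) :
    InDomain (fun ξ => Real.exp (a * symA ξ) * japPow r ξ) f := by
  obtain ⟨K, hK⟩ := japPow_le (r := r) (sub_pos.2 hab)
  have hm : Measurable fun ξ => Real.exp (a * symA ξ) * MildNS.japPow r ξ := by
    have := measurable_symA
    unfold MildNS.japPow
    fun_prop
  refine h.rep.inDomain (h.memLp.of_le_mul (c := K)
    (aestronglyMeasurable_wmul hm h.rep.aestronglyMeasurable) (ae_of_all _ fun ξ => ?_))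
  have h0 : 0 ≤ MildNS.japPow r ξ := Real.rpow_nonneg (by nlinarith [sq_nonneg (symA ξ)]) _
  rw [norm_wmul, norm_wmul, abs_of_nonneg (mul_nonneg (Real.exp_nonneg _) h0),
    abs_of_nonneg (expPow_nonneg _ _ _), ← mul_assoc]
  refine mul_le_mul_of_nonneg_right ?_ (norm_nonneg _)
  rw [expPow, Real.rpow_zero, mul_one]
  calc _ ≤ Real.exp (a * symA ξ) * (K * Real.exp ((b - a) * symA ξ)) := by
        gcongr
        exact hK ξ
    _ = K * (Real.exp (a * symA ξ) * Real.exp ((b - a) * symA ξ)) := by ring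
    _ = _ := by
        rw [← Real.exp_add]
        congr 2
        ring

end MildNS
end

/-! ### Conclusion -/

theorem mainTheorem5 (M : Matrix (Fin 3) (Fin 3) ℝ) (P : FiberedProjection) :
    (∃ C₁, IsLinearConstant C₁) ∧ (∃ C₃, IsBilinearConstant M P C₃) ∧
    ∃ C C' : ℝ, 0 < C ∧ 0 < C' ∧
      ∀ C₁ C₃ : ℝ, IsLinearConstant C₁ → IsBilinearConstant M P C₃ →
      ∀ u₀ : 𝓢'(R3, C3), MemHom (1 / 2) u₀ →
        4 * C₁ * C₃ * expNorm 0 (1 / 2) u₀ < 1 →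
        -- the global solution exists and is unique, and the critical parameter is well defined
        (∃ X, IsGlobalMildSolution M P u₀ X) ∧
        (∀ X X', IsGlobalMildSolution M P u₀ X → IsGlobalMildSolution M P u₀ X' →
          ∀ t, 0 ≤ t → X t = X' t) ∧
        (∃! L : ℝ≥0∞, IsCriticalLambda C₁ C₃ u₀ L) ∧
        ∀ X, IsGlobalMildSolution M P u₀ X → ∀ L : ℝ≥0∞, IsCriticalLambda C₁ C₃ u₀ L →
          -- the bounds in `Ḣ^{5/4}` and `Ḣ^{1/2}`
          (∀ lam0 : ℝ, 0 ≤ lam0 → ENNReal.ofReal lam0 < L → ∀ t : ℝ, 0 < t →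
            (InDomain (expPow (lam0 * √t) (5 / 4)) (X t) ∧
              expNorm (lam0 * √t) (5 / 4) (X t) ≤
                2 * C₁ * expNorm 0 (1 / 2) u₀ * jap lam0 ^ (3 / 4 : ℝ) *
                  Real.exp (lam0 ^ 2 / 4) * t ^ (-(3 / 8) : ℝ)) ∧
            (InDomain (expPow (lam0 * √t) (1 / 2)) (X t) ∧
              expNorm (lam0 * √t) (1 / 2) (X t) ≤
                C * (Real.exp (lam0 ^ 2 / 4) * expNorm 0 (1 / 2) u₀ +
                  jap lam0 ^ 2 * Real.exp (lam0 ^ 2 / 2) *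
                    (2 * C₁ * expNorm 0 (1 / 2) u₀) ^ 2))) ∧
          -- the bound in `L²`
          (∀ f : Lp C3 2 (volume : Measure R3), u₀ = Lp.toTemperedDistribution f →
            ∀ lam0 : ℝ, 0 ≤ lam0 → ENNReal.ofReal lam0 < L → ∀ t : ℝ, 0 < t →
            InDomain (expPow (lam0 * √t) 0) (X t) ∧
              expNorm (lam0 * √t) 0 (X t) ≤
                C' * (Real.exp (lam0 ^ 2 / 4) * ‖f‖ +
                  jap lam0 ^ (3 / 2 : ℝ) * Real.exp (lam0 ^ 2 / 2) *
                    (2 * C₁ * expNorm 0 (1 / 2) u₀) ^ 2 * t ^ (1 / 4 : ℝ))) ∧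
          -- the analyticity radius, in the `Ḣ^{1/2}` sense and, for `u₀ ∈ L²`, in every `H^r` sense
          (∀ t : ℝ, 0 < t → L * ENNReal.ofReal √t ≤ rad (expPow 0 (1 / 2)) (X t)) ∧
          ((∃ f : Lp C3 2 (volume : Measure R3), u₀ = Lp.toTemperedDistribution f) →
            ∀ r t : ℝ, 0 < t → L * ENNReal.ofReal √t ≤ rad (japPow r) (X t)) := by
  have hbil := exists_isBilinearConstant M P
  -- The constants of (i) and (ii) are the bootstrap constants for `σ = 1/2` and `σ = 0`, chosen
  -- before `C₁` and `C₃`.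
  refine ⟨⟨2, isLinearConstant_two⟩, hbil, lowConst M (1 / 2), lowConst M 0, lowConst_pos _ _,
    lowConst_pos _ _, fun C₁ C₃ h₁ h₃ u₀ hu₀ hs => ?_⟩
  have p₁ := h₁.1
  have p₃ := h₃.1
  have hR : 0 ≤ C₁ * expNorm 0 (1 / 2) u₀ := mul_nonneg p₁.le (norm_nonneg _)
  obtain ⟨X₀, hX₀, -⟩ := exists_globalMildSolution (isBilinearBound_Ioi h₃) p₃.le hR
    (memB_heat_Ioi h₁ hu₀).1 (memB_heat_Ioi h₁ hu₀).2 (by linarith)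
  refine ⟨⟨X₀, hX₀⟩, fun X X' hX hX' t ht => hX.unique hX' ht,
    existsUnique_isCriticalLambda p₁ p₃ hu₀ hs, fun X hX L hL => ?_⟩
  have hlow (σ : ℝ) (hσ₀ : 0 ≤ σ) (hσ : σ < 2) (hu : InDomain (expPow 0 σ) u₀) (lam0 : ℝ)
      (h0 : 0 ≤ lam0) (hl : ENNReal.ofReal lam0 < L) (t : ℝ) (ht : 0 < t) :=
    hX.inDomain_low h₁ h₃ hu₀ hs h0 (hL.lt_one p₁ p₃ hu₀ h0 hl) hσ₀ hσ hu ht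
  have hL2 (f : Lp C3 2 (volume : Measure R3)) (hf : u₀ = Lp.toTemperedDistribution f) (lam0 : ℝ)
      (h0 : 0 ≤ lam0) (hl : ENNReal.ofReal lam0 < L) (t : ℝ) (ht : 0 < t) :=
    hlow 0 le_rfl two_pos (rep_toTD_of_eq hf).1 lam0 h0 hl t ht
  refine ⟨fun lam0 h0 hl t ht => ⟨?_, ?_⟩, fun f hf lam0 h0 hl t ht => ?_, fun t ht => ?_,
    fun ⟨f, hf⟩ r t ht => ?_⟩
  · have h := hX.inDomain h₁ h₃ hu₀ hs h0 (hL.lt_one p₁ p₃ hu₀ h0 hl) (T := t) ⟨ht, le_rfl⟩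
    rw [theta_self ht, zeta_self ht, ← expNorm_eq] at h
    refine ⟨h.1, h.2.trans_eq ?_⟩
    ring
  · have h := hlow (1 / 2) (by norm_num) (by norm_num) hu₀ lam0 h0 hl t ht
    refine ⟨h.1, h.2.trans_eq ?_⟩
    rw [show (1 / 2 + 3 / 2 : ℝ) = 2 by norm_num, show (1 / 4 - 1 / 2 / 2 : ℝ) = 0 by norm_num,
      Real.rpow_two, Real.rpow_zero, mul_one]
  · have h := hL2 f hf lam0 h0 hl t ht
    rw [(rep_toTD_of_eq hf).2, zero_add, zero_div, sub_zero] at h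
    exact h
  · refine le_rad (Real.sqrt_pos.2 ht) fun b hb hl => ?_
    have h := (hlow (1 / 2) (by norm_num) (by norm_num) hu₀ b hb.le hl t ht).1
    have e : (fun ξ => Real.exp (b * √t * symA ξ) * expPow 0 (1 / 2) ξ) =
        expPow (b * √t) (1 / 2) := by
      ext1 ξ; simp [expPow]
    rwa [e]
  · refine le_rad (Real.sqrt_pos.2 ht) fun b hb hl => ?_
    -- An intermediate `c` leaves room for the weight `⟨A⟩^r`; in the `Ḣ^{1/2}` case the bound
    -- already carries the right weight and no such margin is needed.
    obtain ⟨c, hbc, hc⟩ := ENNReal.lt_iff_exists_real_btwn.1 hl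
    obtain ⟨hc1, hc2⟩ := hc
    have hbc' : b < c := (ENNReal.ofReal_lt_ofReal_iff_of_nonneg hb.le).1 hc1
    exact (hL2 f hf c hbc hc2 t ht).1.japPow (mul_lt_mul_of_pos_right hbc' (Real.sqrt_pos.2 ht))
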